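/- All manifolds and vector bundles are smooth, real and of finite rank. Let $M$ be a (Hausdorff, second countable) manifold and let $A\to M$ be a Lie algebroid with anchor $\rho\colon A\to TM$ and bracket $[\cdot,\cdot]$. The generalised tangent bundle $\mathbb{T}A=TA\oplus T^*A$ is a double vector bundle with sides $A$ and $TM\oplus A^*$ and core $A\oplus T^*M$; as a vector bundle over $A$ it is the standard Courant algebroid of the manifold $A$, and as a vector bundle over $TM\oplus A^*$ it is a Lie algebroid (the sum of the tangent prolongation $TA\to TM$ and the cotangent Lie algebroid $T^*A\to A^*$): writing, for $a\in\Gamma(A)$, $\sigma(a)$ for the linear section $(X,\alpha)\mapsto (Ta\,X,\,\mathbf{d}\ell_{\alpha}-q_A^*\mathbf{d}\langle\alpha,a\rangle)$ over $a$, and $\tau^\dagger$ for the core section of $\tau\in\Gamma(A\oplus T^*M)$, one has $[\sigma(a),\sigma(b)]=\sigma([a,b])$, $[\sigma(a),\tau^\dagger]=(\mathcal{L}_a\tau)^\dagger$ and $[\tau_1^\dagger,\tau_2^\dagger]=0$, where $\mathcal{L}_a(b,\theta)=([a,b],\mathcal{L}_{\rho(a)}\theta)$; the anchor maps $\sigma(a)$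 to the linear vector field on $TM\oplus A^*$ defined by the derivation $\mathcal{L}_a$, and $\tau^\dagger$ to the vertical lift of $(\rho,\rho^t)\tau$. Let $(A,\mathcal{J})$ be a generalised complex Lie algebroid with side morphism $j\colon TM\oplus A^*\to TM\oplus A^*$. That is, $\mathcal{J}\colon\mathbb{T}A\to\mathbb{T}A$ is a vector bundle morphism over $\mathrm{id}_A$ with $\mathcal{J}^2=-\mathrm{id}$, orthogonal for the canonical pairing, and with vanishing Nijenhuis torsion for the Courant–Dorfman bracket (a generalised complex structure on the manifold $A$); it is a morphism of double vector bundles over $\mathrm{id}_A$ and $j$; and it is a morphism of Lie algebroids over $j$. On $A\oplus T^*M$ consider the degenerate Courant algebroid structure with anchor $\rho\circ\mathrm{pr}_A$ and, for $(a,\theta),(b,\eta)\in\Gamma(A\oplus T^*M)$, \[ \langle(a,\theta),(b,\eta)\rangle_d=\eta(\rho(a))+\theta(\rho(b)),\qquad [\![(a,\theta),(b,\eta)]\!]_d=\bigl([a,b],\ \mathcal{L}_{\rho(a)}\eta-i_{\rho(b)}\mathbf{d}\theta\bigr). \] Then $\mathcal{J}$ has a unique core morphism $j_C\colon A\oplus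 T^*M\to A\oplus T^*M$ (the restriction of $\mathcal{J}$ to the core), and $j_C$ is a smooth vector bundle morphism over $\mathrm{id}_M$ such that 1. $j_C^2=-\mathrm{id}$; 2. $\langle j_C\tau_1,j_C\tau_2\rangle_d=\langle\tau_1,\tau_2\rangle_d$ for all $\tau_1,\tau_2\in A\oplus T^*M$ over the same point of $M$; 3. for all $\tau_1,\tau_2\in\Gamma(A\oplus T^*M)$ the Nijenhuis torsion vanishes: \[ [\![\tau_1,\tau_2]\!]_d-[\![j_C\tau_1,j_C\tau_2]\!]_d+j_C\bigl([\![j_C\tau_1,\tau_2]\!]_d+[\![\tau_1,j_C\tau_2]\!]_d\bigr)=0 . \] In other words, $j_C$ is a degenerate generalised complex structure in the degenerate Courant algebroid $A\oplus T^*M$. -/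

import Mathlib

open Set Bundle Manifold
open scoped ContDiff Topology

noncomputable section

namespace GenComplex

/-! ### One-forms and the standard Courant algebroid of a manifold -/

section Forms

variable {E : Type*} [NormedAddCommGroup E] [NormedSpace ℝ E]
  {H : Type*} [TopologicalSpace H] (I : ModelWithCorners ℝ E H)
  {M : Type*} [TopologicalSpace M] [ChartedSpace H M] [IsManifold I ∞ M]

/-- The cotangent space `T*_x M`. -/
abbrev Cotangent (x : M) : Type _ := TangentSpace I x →L[ℝ] ℝ

/-- The fibre `T_x M ⊕ T*_x M` of the generalised tangent bundle. -/
abbrev GTangent (x : M) : Type _ := TangentSpace I x × Cotangent I x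

/-- The differential `df` of a function. -/
def dFun (f : M → ℝ) (x : M) : Cotangent I x := mfderiv I 𝓘(ℝ, ℝ) f x

/-- Smoothness of a vector field. -/
def SmoothField (X : ∀ x : M, TangentSpace I x) : Prop :=
  ContMDiff I (I.prod 𝓘(ℝ, E)) ∞ (fun x => TotalSpace.mk' E x (X x))

/-- Smoothness of a one-form, as a section of the cotangent bundle. -/
def SmoothForm (θ : ∀ x : M, Cotangent I x) : Prop :=
  ContMDiff I (I.prod 𝓘(ℝ, E →L[ℝ] ℝ)) ∞ (fun x => TotalSpace.mk' (E →L[ℝ] ℝ) x (θ x))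

/-- The exterior derivative of a one-form: `extDeriv₁ I θ x v w = (dθ)_x(v, w)`.
In the chart at `x`, `dθ (v, w) = (D_v θ)(w) - (D_w θ)(v)`. -/
def extDeriv₁ (θ : ∀ x : M, Cotangent I x) (x : M) : TangentSpace I x →L[ℝ] Cotangent I x :=
  let θ' : E → (E →L[ℝ] ℝ) := fun z =>
    (θ ((extChartAt I x).symm z)).comp
      (mfderivWithin 𝓘(ℝ, E) I (extChartAt I x).symm (range I) z)
  let D : E →L[ℝ] E →L[ℝ] ℝ := fderivWithin ℝ θ' (range I) (extChartAt I x x)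
  let φ : TangentSpace I x →L[ℝ] E := mfderiv I 𝓘(ℝ, E) (extChartAt I x) x
  (ContinuousLinearMap.precomp ℝ φ).comp ((D - D.flip).comp φ)

/-- The Lie derivative `L_X θ = d(θ(X)) + i_X dθ` of a one-form. -/
def lieDerivForm (X : ∀ x : M, TangentSpace I x) (θ : ∀ x : M, Cotangent I x) (x : M) :
    Cotangent I x :=
  dFun I (fun y => θ y (X y)) x + extDeriv₁ I θ x (X x)

/-- The Courant–Dorfman bracket `⟦(X,θ),(Y,ω)⟧ = ([X,Y], L_X ω - i_Y dθ)` on `TM ⊕ T*M`. -/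
def courantDorfman (s t : ∀ x : M, GTangent I x) (x : M) : GTangent I x :=
  (VectorField.mlieBracket I (fun y => (s y).1) (fun y => (t y).1) x,
    lieDerivForm I (fun y => (s y).1) (fun y => (t y).2) x
      - extDeriv₁ I (fun y => (s y).2) x (t x).1)

/-- The Nijenhuis torsion of a fibrewise map `J` with respect to a bracket on sections of `V`:
`⟦s,t⟧ - ⟦Js,Jt⟧ + J(⟦Js,t⟧ + ⟦s,Jt⟧)`. -/
def nijenhuis {V : M → Type*} [∀ x, AddCommGroup (V x)]
    (br : (∀ x, V x) → (∀ x, V x) → ∀ x, V x) (J : ∀ x, V x → V x)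
    (s t : ∀ x, V x) (x : M) : V x :=
  br s t x - br (fun y => J y (s y)) (fun y => J y (t y)) x
    + J x (br (fun y => J y (s y)) t x + br s (fun y => J y (t y)) x)

/-- `J` is a generalised complex structure on the manifold `M`, that is, in the standard Courant
algebroid `TM ⊕ T*M`. -/
structure IsGeneralisedComplex
    (J : ∀ x : M, GTangent I x →L[ℝ] GTangent I x) : Prop where
  /-- `J` is a (smooth) vector bundle morphism over the identity. -/
  smooth : ContMDiff (I.prod 𝓘(ℝ, E × (E →L[ℝ] ℝ))) (I.prod 𝓘(ℝ, E × (E →L[ℝ] ℝ))) ∞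
    (fun p : TotalSpace (E × (E →L[ℝ] ℝ))
        ((fun x : M => TangentSpace I x) ×ᵇ (fun x : M => TangentSpace I x →L[ℝ] ℝ)) =>
      (TotalSpace.mk' (E × (E →L[ℝ] ℝ)) p.proj (J p.proj p.2) : TotalSpace (E × (E →L[ℝ] ℝ))
        ((fun x : M => TangentSpace I x) ×ᵇ (fun x : M => TangentSpace I x →L[ℝ] ℝ))))
  sq : ∀ (x : M) (p : GTangent I x), J x (J x p) = -p
  orthogonal : ∀ (x : M) (p q : GTangent I x),
    (J x p).2 (J x q).1 + (J x q).2 (J x p).1 = p.2 q.1 + q.2 p.1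
  integrable : ∀ s t : ∀ x : M, GTangent I x,
    SmoothField I (fun x => (s x).1) → SmoothForm I (fun x => (s x).2) →
    SmoothField I (fun x => (t x).1) → SmoothForm I (fun x => (t x).2) →
    ∀ x, nijenhuis (courantDorfman I) (fun x p => J x p) s t x = 0

end Forms

/-! ### Lie algebroids and the degenerate Courant algebroid `A ⊕ T*M` -/

section Algebroid

variable {E : Type*} [NormedAddCommGroup E] [NormedSpace ℝ E]
  {H : Type*} [TopologicalSpace H] (I : ModelWithCorners ℝ E H)
  {M : Type*} [TopologicalSpace M] [ChartedSpace H M] [IsManifold I ∞ M]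
  (F : Type*) [NormedAddCommGroup F] [NormedSpace ℝ F]
  (A : M → Type*) [TopologicalSpace (TotalSpace F A)]
  [∀ x, AddCommGroup (A x)] [∀ x, Module ℝ (A x)] [∀ x, TopologicalSpace (A x)]
  [FiberBundle F A]

variable {A} in
/-- Smoothness of a section of `A`. -/
def SmoothSec (a : ∀ x : M, A x) : Prop :=
  ContMDiff I (I.prod 𝓘(ℝ, F)) ∞ (fun x => TotalSpace.mk' F x (a x))

/-- A Lie algebroid structure on the vector bundle `A → M`: a smooth anchor `A → TM` and a Lie
bracket on the smooth sections. The bracket is a total function on all set-theoretic sections;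
only its values on smooth sections are constrained or ever used. -/
structure LieAlgebroid where
  anchor : ∀ x : M, A x →L[ℝ] TangentSpace I x
  anchor_smooth : ContMDiff (I.prod 𝓘(ℝ, F)) (I.prod 𝓘(ℝ, E)) ∞
    (fun p : TotalSpace F A =>
      (TotalSpace.mk' E p.proj (anchor p.proj p.2) : TangentBundle I M))
  bracket : (∀ x : M, A x) → (∀ x : M, A x) → ∀ x : M, A x
  bracket_smooth : ∀ a b, SmoothSec I F a → SmoothSec I F b → SmoothSec I F (bracket a b)
  bracket_add : ∀ a b c, SmoothSec I F a → SmoothSec I F b → SmoothSec I F c →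
    bracket a (b + c) = bracket a b + bracket a c
  bracket_smul : ∀ (r : ℝ) (a b), SmoothSec I F a → SmoothSec I F b →
    bracket a (r • b) = r • bracket a b
  bracket_skew : ∀ a b, SmoothSec I F a → SmoothSec I F b → bracket a b = -bracket b a
  jacobi : ∀ a b c, SmoothSec I F a → SmoothSec I F b → SmoothSec I F c →
    bracket a (bracket b c) = bracket (bracket a b) c + bracket b (bracket a c)
  leibniz : ∀ (f : M → ℝ) (a b), ContMDiff I 𝓘(ℝ, ℝ) ∞ f → SmoothSec I F a → SmoothSec I F b →
    ∀ x, bracket a (fun y => f y • b y) x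
      = f x • bracket a b x + dFun I f x (anchor x (a x)) • b x
  anchor_bracket : ∀ a b, SmoothSec I F a → SmoothSec I F b →
    ∀ x, anchor x (bracket a b x)
      = VectorField.mlieBracket I (fun y => anchor y (a y)) (fun y => anchor y (b y)) x

/-- The fibre `A_x ⊕ T*_x M` of the core bundle. -/
abbrev Core (x : M) : Type _ := A x × Cotangent I x

/-- The fibre `T_x M ⊕ A*_x` of the side bundle. -/
abbrev Side (x : M) : Type _ := TangentSpace I x × (A x →L[ℝ] ℝ)

variable {A} in
/-- Smoothness of a section of `A ⊕ T*M`. -/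
def SmoothCore (τ : ∀ x : M, Core I A x) : Prop :=
  SmoothSec I F (fun x => (τ x).1) ∧
    ContMDiff I (I.prod 𝓘(ℝ, E →L[ℝ] ℝ)) ∞
      (fun x => TotalSpace.mk' (E →L[ℝ] ℝ) x ((τ x).2 : TangentSpace I x →L[ℝ] ℝ))

variable {I F A} (L : LieAlgebroid I F A)

/-- The degenerate pairing `⟨(a,θ),(b,η)⟩_d = η(ρ(a)) + θ(ρ(b))` on `A ⊕ T*M`. -/
def degPairing (x : M) (τ υ : Core I A x) : ℝ :=
  υ.2 (L.anchor x τ.1) + τ.2 (L.anchor x υ.1)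

/-- The derivation `L_a(b,η) = ([a,b], L_{ρ(a)} η)` of `Γ(A ⊕ T*M)`. -/
def lieDerivCore (a : ∀ x : M, A x) (υ : ∀ x : M, Core I A x) (x : M) : Core I A x :=
  (L.bracket a (fun y => (υ y).1) x,
    lieDerivForm I (fun y => L.anchor y (a y)) (fun y => (υ y).2) x)

/-- The degenerate Courant bracket `⟦(a,θ),(b,η)⟧_d = ([a,b], L_{ρ(a)} η - i_{ρ(b)} dθ)`. -/
def degBracket (τ υ : ∀ x : M, Core I A x) (x : M) : Core I A x :=
  (L.bracket (fun y => (τ y).1) (fun y => (υ y).1) x,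
    lieDerivForm I (fun y => L.anchor y (τ y).1) (fun y => (υ y).2) x
      - extDeriv₁ I (fun y => (τ y).2) x (L.anchor x (υ x).1))

/-- `j` is a degenerate generalised complex structure in the degenerate Courant algebroid
`A ⊕ T*M` (with anchor `ρ ∘ pr_A`, pairing `degPairing` and bracket `degBracket`). -/
structure IsDegenerateGeneralisedComplex [VectorBundle ℝ F A]
    (j : ∀ x : M, Core I A x →L[ℝ] Core I A x) : Prop where
  /-- `j` is a (smooth) vector bundle morphism over the identity. -/
  smooth : ContMDiff (I.prod 𝓘(ℝ, F × (E →L[ℝ] ℝ))) (I.prod 𝓘(ℝ, F × (E →L[ℝ] ℝ))) ∞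
    (fun p : TotalSpace (F × (E →L[ℝ] ℝ)) (A ×ᵇ (fun x : M => TangentSpace I x →L[ℝ] ℝ)) =>
      (TotalSpace.mk' (F × (E →L[ℝ] ℝ)) p.proj (j p.proj p.2) :
        TotalSpace (F × (E →L[ℝ] ℝ)) (A ×ᵇ (fun x : M => TangentSpace I x →L[ℝ] ℝ))))
  sq : ∀ (x : M) (τ : Core I A x), j x (j x τ) = -τ
  orthogonal : ∀ (x : M) (τ υ : Core I A x),
    degPairing L x (j x τ) (j x υ) = degPairing L x τ υ
  torsion : ∀ τ υ : ∀ x : M, Core I A x, SmoothCore I F τ → SmoothCore I F υ →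
    ∀ x, nijenhuis (degBracket L) (fun x τ => j x τ) τ υ x = 0

end Algebroid

/-! ### The double vector bundle `𝕋A = TA ⊕ T*A` over `A` and over `TM ⊕ A*` -/

section Double

variable {E : Type*} [NormedAddCommGroup E] [NormedSpace ℝ E]
  {H : Type*} [TopologicalSpace H] {I : ModelWithCorners ℝ E H}
  {M : Type*} [TopologicalSpace M] [ChartedSpace H M] [IsManifold I ∞ M]
  {F : Type*} [NormedAddCommGroup F] [NormedSpace ℝ F]
  {A : M → Type*} [TopologicalSpace (TotalSpace F A)]
  [∀ x, AddCommGroup (A x)] [∀ x, Module ℝ (A x)] [∀ x, TopologicalSpace (A x)]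
  [FiberBundle F A] [VectorBundle ℝ F A]

variable (I) in
/-- The tangent map `Tq : T_v A → T_{q(v)} M` of the bundle projection. -/
def tproj (v : TotalSpace F A) :
    TangentSpace (I.prod 𝓘(ℝ, F)) v →L[ℝ] TangentSpace I v.proj :=
  mfderiv (I.prod 𝓘(ℝ, F)) I (fun u : TotalSpace F A => u.proj) v

variable (I) in
/-- The vertical vector `d/dt|₀ (v + t e) ∈ T_v A`. -/
def vert (v : TotalSpace F A) (e : A v.proj) : TangentSpace (I.prod 𝓘(ℝ, F)) v :=
  mfderiv 𝓘(ℝ, ℝ) (I.prod 𝓘(ℝ, F))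
    (fun t : ℝ => TotalSpace.mk' F v.proj (v.2 + t • e)) 0 (1 : ℝ)

variable (I) in
/-- A linear left inverse of `vert v`: the derivative at `v` of the fibre coordinate of a local
trivialisation, transported back to the fibre. On vertical vectors it does not depend on the
trivialisation. -/
def fibrePart (v : TotalSpace F A) : TangentSpace (I.prod 𝓘(ℝ, F)) v →L[ℝ] A v.proj :=
  ((trivializationAt F A v.proj).symmL ℝ v.proj).comp
    (mfderiv (I.prod 𝓘(ℝ, F)) 𝓘(ℝ, F) (fun u => (trivializationAt F A v.proj u).2) v)

variable (I) in
/-- The value at `v` of the core section `(e,θ)↑ = (vertical lift of e, (Tq)^t θ)`. -/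
def coreLift (v : TotalSpace F A) (τ : Core I A v.proj) : GTangent (I.prod 𝓘(ℝ, F)) v :=
  (vert I v τ.1, τ.2.comp (tproj I v))

/-- `p ∈ T_v A ⊕ T*_v A` projects to `ν ∈ T_x M ⊕ A*_x` under the bundle projection
`𝕋A → TM ⊕ A*`, `(w, ξ) ↦ (Tq w, e ↦ ξ (vert e))`. -/
def LiesOver (v : TotalSpace F A) (p : GTangent (I.prod 𝓘(ℝ, F)) v) (ν : Side I A v.proj) : Prop :=
  tproj I v p.1 = ν.1 ∧ ∀ e, p.2 (vert I v e) = ν.2 e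

/-- `p₃ = p₁ + p₂` for the addition of the vector bundle `𝕋A → TM ⊕ A*`. With the bundle
projections `pr₁, pr₂` and the fibrewise addition `+` from `A ×_M A` to `A`, it is
`T(+)(w₁, w₂)` on `TA`, and `(ξ₁ + ξ₂)(T(+)(w₁, w₂)) = ξ₁(w₁) + ξ₂(w₂)` on `T*A`. -/
def IsSum (x : M) (e₁ e₂ : A x)
    (p₁ : GTangent (I.prod 𝓘(ℝ, F)) (TotalSpace.mk' F x e₁))
    (p₂ : GTangent (I.prod 𝓘(ℝ, F)) (TotalSpace.mk' F x e₂))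
    (p₃ : GTangent (I.prod 𝓘(ℝ, F)) (TotalSpace.mk' F x (e₁ + e₂))) : Prop :=
  let u : TotalSpace (F × F) (A ×ᵇ A) := TotalSpace.mk' (F × F) x (e₁, e₂)
  let T₁ := mfderiv (I.prod 𝓘(ℝ, F × F)) (I.prod 𝓘(ℝ, F))
    (fun z : TotalSpace (F × F) (A ×ᵇ A) => TotalSpace.mk' F z.proj z.2.1) u
  let T₂ := mfderiv (I.prod 𝓘(ℝ, F × F)) (I.prod 𝓘(ℝ, F))
    (fun z : TotalSpace (F × F) (A ×ᵇ A) => TotalSpace.mk' F z.proj z.2.2) u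
  let T₃ := mfderiv (I.prod 𝓘(ℝ, F × F)) (I.prod 𝓘(ℝ, F))
    (fun z : TotalSpace (F × F) (A ×ᵇ A) => TotalSpace.mk' F z.proj (z.2.1 + z.2.2)) u
  (∃ w, T₁ w = p₁.1 ∧ T₂ w = p₂.1 ∧ T₃ w = p₃.1) ∧
    ∀ w, p₃.2 (T₃ w) = p₁.2 (T₁ w) + p₂.2 (T₂ w)

/-- `p' = r · p` for the scalar multiplication of the vector bundle `𝕋A → TM ⊕ A*`: with
`m_r` the fibrewise multiplication of `A` by `r`, it is `T(m_r)(w)` on `TA`, and on `T*A` the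
covector `ξ'` over the same element of `A*` as `ξ` with `ξ'(T(m_r)(w)) = r ξ(w)`. -/
def IsScaled (r : ℝ) (x : M) (e : A x)
    (p : GTangent (I.prod 𝓘(ℝ, F)) (TotalSpace.mk' F x e))
    (p' : GTangent (I.prod 𝓘(ℝ, F)) (TotalSpace.mk' F x (r • e))) : Prop :=
  let T := mfderiv (I.prod 𝓘(ℝ, F)) (I.prod 𝓘(ℝ, F))
    (fun z : TotalSpace F A => TotalSpace.mk' F z.proj (r • z.2)) (TotalSpace.mk' F x e)
  T p.1 = p'.1 ∧ (∀ w, p'.2 (T w) = r * p.2 w) ∧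
    ∀ e' : A x, p'.2 (vert I (TotalSpace.mk' F x (r • e)) e') = p.2 (vert I (TotalSpace.mk' F x e) e')

variable (I F A) in
/-- The total space of the side bundle `TM ⊕ A*`. -/
abbrev SideTot : Type _ :=
  TotalSpace (E × (F →L[ℝ] ℝ)) ((fun x : M => TangentSpace I x) ×ᵇ (fun x : M => A x →L[ℝ] ℝ))

variable (I F A E) in
/-- The model with corners of the manifold `TM ⊕ A*`. -/
abbrev sideModel : ModelWithCorners ℝ (E × (E × (F →L[ℝ] ℝ))) (ModelProd H (E × (F →L[ℝ] ℝ))) :=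
  I.prod 𝓘(ℝ, E × (F →L[ℝ] ℝ))

variable (F) in
/-- The map of total spaces of a fibrewise map `j` of `TM ⊕ A*`. -/
def sideMap (j : ∀ x : M, Side I A x →L[ℝ] Side I A x) (ν : SideTot I F A) : SideTot I F A :=
  TotalSpace.mk' (E × (F →L[ℝ] ℝ)) ν.proj (j ν.proj ν.2)

/-- A fibrewise linear map `J` of `𝕋A → A` is linear over `j`, i.e. it is a morphism of double
vector bundles over the side morphisms `id_A` and `j`: it is also a vector bundle morphism
of `𝕋A → TM ⊕ A*` over `j`, and `j` is a vector bundle morphism. -/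
structure IsLinearOver
    (J : ∀ v : TotalSpace F A,
      GTangent (I.prod 𝓘(ℝ, F)) v →L[ℝ] GTangent (I.prod 𝓘(ℝ, F)) v)
    (j : ∀ x : M, Side I A x →L[ℝ] Side I A x) : Prop where
  side_smooth : ContMDiff (I.prod 𝓘(ℝ, E × (F →L[ℝ] ℝ))) (I.prod 𝓘(ℝ, E × (F →L[ℝ] ℝ))) ∞
    (sideMap F j)
  lies_over : ∀ v p ν, LiesOver v p ν → LiesOver v (J v p) (j v.proj ν)
  add : ∀ (x : M) (e₁ e₂ : A x) (p₁ p₂ p₃), IsSum (I := I) (F := F) x e₁ e₂ p₁ p₂ p₃ →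
    IsSum x e₁ e₂ (J _ p₁) (J _ p₂) (J _ p₃)
  smul : ∀ (r : ℝ) (x : M) (e : A x) (p p'), IsScaled (I := I) (F := F) r x e p p' →
    IsScaled r x e (J _ p) (J _ p')

/-- `jC` is the core morphism of `J`: the restriction of `J` to the core `A ⊕ T*M` of `𝕋A`, which
sits in `𝕋A` over the zero section of `A`. -/
def IsCoreMorphism
    (J : ∀ v : TotalSpace F A,
      GTangent (I.prod 𝓘(ℝ, F)) v →L[ℝ] GTangent (I.prod 𝓘(ℝ, F)) v)
    (jC : ∀ x : M, Core I A x →L[ℝ] Core I A x) : Prop :=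
  ∀ (x : M) (τ : Core I A x),
    J (TotalSpace.mk' F x 0) (coreLift I (TotalSpace.mk' F x 0) τ)
      = coreLift I (TotalSpace.mk' F x 0) (jC x τ)

/-! ### The Lie algebroid `𝕋A → TM ⊕ A*` of a Lie algebroid `A`

For `a ∈ Γ(A)` and `τ = (b, θ) ∈ Γ(A ⊕ T*M)` there is a section `σ(a) + τ†` of `𝕋A → TM ⊕ A*`, where
`σ(a)(X, α) = (Ta X, a^R(α))` is the linear section of `a` and `τ†` is the core section of `τ`.
These sections span every fibre, and the Lie algebroid structure of `𝕋A → TM ⊕ A*` is the one with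
`[σ(a), σ(b)] = σ([a,b])`, `[σ(a), τ†] = (L_a τ)†`, `[τ†, υ†] = 0`, and anchors
`σ(a) ↦` the linear vector field of the derivation `L_a`, `τ† ↦ ((ρ, ρ^t) τ)↑`. -/

variable (I A) in
/-- Pairs `(a, τ)` of a section of `A` and a section of `A ⊕ T*M`. -/
abbrev Gen : Type _ := (∀ x : M, A x) × (∀ x : M, Core I A x)

variable (F) in
/-- Smoothness of a pair `(a, τ)`. -/
def SmoothGen (g : Gen I A) : Prop := SmoothSec I F g.1 ∧ SmoothCore I F g.2

variable (I F A) in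
/-- The total space of `𝕋A → A`. -/
abbrev TTot : Type _ :=
  TotalSpace ((E × F) × ((E × F) →L[ℝ] ℝ)) (fun v : TotalSpace F A => GTangent (I.prod 𝓘(ℝ, F)) v)

/-- The map of total spaces of a fibrewise map `J` of `𝕋A → A`. -/
def ttMap (J : ∀ v : TotalSpace F A,
      GTangent (I.prod 𝓘(ℝ, F)) v →L[ℝ] GTangent (I.prod 𝓘(ℝ, F)) v)
    (p : TTot I F A) : TTot I F A :=
  ⟨p.proj, J p.proj p.2⟩

/-- The section `σ(a) + τ†` of `𝕋A → TM ⊕ A*` at `ν = (X, α)`, an element of the fibre of `𝕋A` over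
`a(x) ∈ A`. Here `σ(a)(X, α) = (Ta X, a^R(α))`, where `a^R(α)` is the covector at `a(x)` which
vanishes on the image of `T_x a` and restricts to `α` on vertical vectors (equivalently
`d ℓ_α - q^* d⟨α, a⟩` at `a(x)` for any local extension of `α`). -/
def genLift (g : Gen I A) (ν : SideTot I F A) : TTot I F A :=
  let x : M := ν.proj
  let v : TotalSpace F A := TotalSpace.mk' F x (g.1 x)
  let Ta : TangentSpace I x →L[ℝ] TangentSpace (I.prod 𝓘(ℝ, F)) v :=
    mfderiv I (I.prod 𝓘(ℝ, F)) (fun y => TotalSpace.mk' F y (g.1 y)) x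
  let aR : Cotangent (I.prod 𝓘(ℝ, F)) v :=
    ν.2.2.comp ((fibrePart I v).comp (ContinuousLinearMap.id ℝ _ - Ta.comp (tproj I v)))
  ⟨v, (Ta ν.2.1, aR) + coreLift I v (g.2 x)⟩

/-- The linear function `ℓ_υ(ν) = ⟨ν, υ⟩` on `TM ⊕ A*` of a section `υ` of `A ⊕ T*M`. -/
def linFun (υ : ∀ x : M, Core I A x) (ν : SideTot I F A) : ℝ :=
  ν.2.2 (υ ν.proj).1 + (υ ν.proj).2 ν.2.1

variable (L : LieAlgebroid I F A)

/-- `w ∈ T_ν(TM ⊕ A*)` is the image of `σ(a)(ν) + τ†(ν)` under the anchor of `𝕋A → TM ⊕ A*`, i.e.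
`w` projects to `ρ(a)` and `w(ℓ_υ) = ⟨ν, L_a υ⟩ + ⟨(ρ, ρ^t) τ, υ⟩` for all `υ ∈ Γ(A ⊕ T*M)`. There is
exactly one such vector. -/
def IsAnchorAt (g : Gen I A) (ν : SideTot I F A) (w : TangentSpace (sideModel E I F) ν) : Prop :=
  mfderiv (sideModel E I F) I (fun μ : SideTot I F A => μ.proj) ν w
      = L.anchor ν.proj (g.1 ν.proj) ∧
    ∀ υ : ∀ x : M, Core I A x, SmoothCore I F υ →
      dFun (sideModel E I F) (linFun υ) ν w
        = linFun (lieDerivCore L g.1 υ) ν + degPairing L ν.proj (g.2 ν.proj) (υ ν.proj)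

/-- The anchor of `σ(a)(ν) + τ†(ν)`: the unique vector `w` with `IsAnchorAt L g ν w`. -/
def genAnchor (g : Gen I A) (ν : SideTot I F A) : TangentSpace (sideModel E I F) ν :=
  Classical.epsilon (IsAnchorAt L g ν)

/-- The bracket on generating sections:
`[σ(a) + τ†, σ(b) + υ†] = σ([a,b]) + (L_a υ - L_b τ)†`. -/
def genBracket (g h : Gen I A) : Gen I A :=
  (L.bracket g.1 h.1, lieDerivCore L g.1 h.2 - lieDerivCore L h.1 g.2)

variable (I F A) in
/-- A smooth section `∑ f_i s_i` of `𝕋A → TM ⊕ A*`, where the `f_i` are smooth functions on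
`TM ⊕ A*` and the `s_i = σ(a_i) + τ_i†` are generating sections. Every smooth section is locally
of this form. -/
structure SideSection where
  n : ℕ
  coeff : Fin n → SideTot I F A → ℝ
  gen : Fin n → Gen I A
  coeff_smooth : ∀ i, ContMDiff (sideModel E I F) 𝓘(ℝ, ℝ) ∞ (coeff i)
  gen_smooth : ∀ i, SmoothGen F (gen i)

namespace SideSection

/-- The pair `∑ f_i(ν) (a_i, τ_i)` with coefficients frozen at `ν`. As `(a, τ) ↦ σ(a) + τ†` is
`ℝ`-linear, the generating section of this pair has the same value at `ν` as `∑ f_i s_i`. -/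
def frozen (s : SideSection I F A) (ν : SideTot I F A) : Gen I A :=
  ∑ i, s.coeff i ν • s.gen i

/-- The value of the section at `ν`. -/
def val (s : SideSection I F A) (ν : SideTot I F A) : TTot I F A := genLift (s.frozen ν) ν

/-- The value at `ν` of the Lie algebroid bracket of `𝕋A → TM ⊕ A*`, given by the Leibniz rule
`[∑ f_i s_i, ∑ g_k t_k] = ∑ f_i g_k [s_i, t_k] + ∑ Θ(s)(g_k) t_k - ∑ Θ(t)(f_i) s_i`
from the bracket and the anchor `Θ` of the generating sections. -/
def bracketVal (s t : SideSection I F A) (ν : SideTot I F A) : TTot I F A :=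
  genLift
    (genBracket L (s.frozen ν) (t.frozen ν)
      + ∑ k, dFun (sideModel E I F) (t.coeff k) ν (genAnchor L (s.frozen ν) ν) • t.gen k
      - ∑ i, dFun (sideModel E I F) (s.coeff i) ν (genAnchor L (t.frozen ν) ν) • s.gen i)
    ν

end SideSection

/-- `J` is a morphism of the Lie algebroid `𝕋A → TM ⊕ A*` over the diffeomorphism `j` of the base:
it intertwines the anchor with `Tj`, and brackets of `J`-related (local) sections are
`J`-related. -/
structure IsAlgebroidMorphism
    (J : ∀ v : TotalSpace F A,
      GTangent (I.prod 𝓘(ℝ, F)) v →L[ℝ] GTangent (I.prod 𝓘(ℝ, F)) v)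
    (j : ∀ x : M, Side I A x →L[ℝ] Side I A x) : Prop where
  anchor : ∀ (g h : Gen I A) (ν : SideTot I F A), SmoothGen F g → SmoothGen F h →
    ttMap J (genLift g ν) = genLift h (sideMap F j ν) →
    mfderiv (sideModel E I F) (sideModel E I F) (sideMap F j) ν (genAnchor L g ν)
      = genAnchor L h (sideMap F j ν)
  bracket : ∀ (s t s' t' : SideSection I F A) (ν₀ : SideTot I F A),
    (∀ᶠ ν in 𝓝 ν₀, ttMap J (s.val ν) = s'.val (sideMap F j ν)) →
    (∀ᶠ ν in 𝓝 ν₀, ttMap J (t.val ν) = t'.val (sideMap F j ν)) →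
    ttMap J (s.bracketVal L t ν₀) = s'.bracketVal L t' (sideMap F j ν₀)

/-- `(A, J)` is a generalised complex Lie algebroid with side morphism `j`: `J` is a generalised
complex structure on the manifold `A` which is linear over `j` and a Lie algebroid morphism of
`𝕋A → TM ⊕ A*` over `j`. -/
structure IsGeneralisedComplexLieAlgebroid [IsManifold (I.prod 𝓘(ℝ, F)) ∞ (TotalSpace F A)]
    (J : ∀ v : TotalSpace F A,
      GTangent (I.prod 𝓘(ℝ, F)) v →L[ℝ] GTangent (I.prod 𝓘(ℝ, F)) v)
    (j : ∀ x : M, Side I A x →L[ℝ] Side I A x) : Prop where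
  generalisedComplex : IsGeneralisedComplex (I.prod 𝓘(ℝ, F)) J
  linear : IsLinearOver J j
  morphism : IsAlgebroidMorphism L J j

end Double

end GenComplex

end

/-! Elements of `𝕋A` over `0 ∈ TM ⊕ A*` are exactly the core lifts, and an element over `ν` pairs
with the core lift of `τ` to `⟨ν, τ⟩`, whatever the point in the fibre of `A`. Since `J` covers `j`,
is orthogonal and squares to `-1`, it maps core lifts to core lifts and `⟨ν, jC τ⟩ = -⟨j ν, τ⟩`: the
core morphism is minus the transpose of `j` (`IsLinearOver.exists_core`). Smoothness and `jC² = -1`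
are inherited from `j`, and `J` acts on core lifts by `jC` away from the zero section as well
(`IsCoreMorphism.apply_coreLift`). Uniqueness is injectivity of the core lift.

The anchor of `𝕋A → TM ⊕ A*` sends `τ†` to the vertical lift of `(ρ, ρ^t) τ`, which differentiates
the linear function `ℓ_υ` to `⟨τ, υ⟩_d`. As `ℓ_υ ∘ j = -ℓ_{jC υ}`, compatibility of `J` with the
anchors says that `jC` is skew for the degenerate pairing (`IsCoreMorphism.degPairing_left`). This
gives orthogonality, and also `(ρ, ρ^t) ∘ jC = j ∘ (ρ, ρ^t)`.

The torsion comes from comparing the two structures of `𝕋A` through the cross term `c_a`, defined by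
`J σ(a)(ν) = σ(a)(j ν) + c_a(ν)†`. Compatibility of `J` with the brackets of `σ(a)` and `τ†` yields
`L_a (jC τ) = jC (L_a τ) + c_a((ρ, ρ^t) τ)` (`IsCoreMorphism.lieDerivCore_apply`). On the manifold
`A`, the Courant–Dorfman bracket of the core section of `τ = (a, θ)` with a linear section `ζ` over
`ν = (X, α)` is, along the zero section, the core lift of (core part of `ζ` along `a`) `- (0, i_X
dθ)` (`IsLinearSection.courantDorfman_coreLift`). The core part of `J ζ` is `c_a(ν)` plus `jC` of
that of `ζ`, so in the torsion of `J` the core parts of `ζ` cancel and only cross terms and exterior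
derivatives remain. For `ν = (ρ, ρ^t) υ` the same remainder is left in the torsion of `jC` on `τ,
υ`, where the terms `L_a υ` cancel in the same way (`torsion_of_cross_terms`). -/

noncomputable section

set_option linter.unusedSectionVars false

namespace GenComplex

/-! ### Exterior derivative and Lie bracket in charts; Cartan's formula. -/

section Cartan

variable {E : Type*} [NormedAddCommGroup E] [NormedSpace ℝ E]
  {H : Type*} [TopologicalSpace H] {I : ModelWithCorners ℝ E H} [I.Boundaryless]
  {N : Type*} [TopologicalSpace N] [ChartedSpace H N] [IsManifold I ∞ N]

variable (I) in
/-- A one-form read in the chart at `x`. -/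
def chartForm (θ : ∀ x : N, Cotangent I x) (x : N) : E → (E →L[ℝ] ℝ) := fun z =>
  (θ ((extChartAt I x).symm z)).comp
    (mfderivWithin 𝓘(ℝ, E) I (extChartAt I x).symm (range I) z)

variable (I) in
/-- A vector field read in the chart at `x`. -/
def chartField (X : ∀ x : N, TangentSpace I x) (x : N) : E → E :=
  VectorField.mpullbackWithin 𝓘(ℝ, E) I (extChartAt I x).symm X (range I)

omit [I.Boundaryless] in
theorem chartField_self (X : ∀ x : N, TangentSpace I x) (x : N) :
    chartField I X x (extChartAt I x x) = X x := by
  have h := mfderivWithin_extChartAt_symm_inverse_apply (I := I) (x := x) (v := X x)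
  simp only [chartField, VectorField.mpullbackWithin_apply]
  rw [extChartAt_to_inv]
  exact h

omit [I.Boundaryless] in
theorem chartForm_self (θ : ∀ x : N, Cotangent I x) (x : N) :
    chartForm I θ x (extChartAt I x x) = θ x := by
  simp only [chartForm]
  rw [mfderivWithin_range_extChartAt_symm, extChartAt_to_inv]
  exact ContinuousLinearMap.comp_id _

omit [I.Boundaryless] in
theorem chartForm_chartField (θ : ∀ x : N, Cotangent I x) (X : ∀ x : N, TangentSpace I x) (x : N)
    {z : E} (hz : z ∈ (extChartAt I x).target) :
    chartForm I θ x z (chartField I X x z)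
      = θ ((extChartAt I x).symm z) (X ((extChartAt I x).symm z)) := by
  have h := isInvertible_mfderivWithin_extChartAt_symm (I := I) hz
  simp only [chartField, VectorField.mpullbackWithin_apply, chartForm]
  exact congrArg (θ ((extChartAt I x).symm z))
    (ContinuousLinearMap.IsInvertible.self_apply_inverse h (X ((extChartAt I x).symm z)))

/-- Near the centre of the chart, `chartForm` is the coordinate expression of the section in the
trivialisation of the cotangent bundle at `x`, composed with the inverse chart. -/
theorem SmoothForm.differentiableAt_chartForm {θ : ∀ x : N, Cotangent I x} (hθ : SmoothForm I θ)
    (x : N) : DifferentiableAt ℝ (chartForm I θ x) (extChartAt I x x) := by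
  have h := ((contMDiffAt_hom_bundle (F₂ := ℝ) (E₂ := Bundle.Trivial N ℝ) _).1 (hθ x)).2
  have h1 : ContMDiffAt 𝓘(ℝ, E) I ∞ (extChartAt I x).symm (extChartAt I x x) := by
    have := contMDiffWithinAt_extChartAt_symm_range (I := I) (n := ∞) x (mem_extChartAt_target x)
    rw [I.range_eq_univ] at this
    exact this
  have h2 := ContMDiffAt.comp_of_eq (x := extChartAt I x x) h h1 (extChartAt_to_inv x)
  have h3 := h2.contDiffAt.differentiableAt (by simp)
  refine h3.congr_of_eventuallyEq ?_
  filter_upwards [extChartAt_target_mem_nhds (I := I) x] with z hz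
  have hs : (extChartAt I x).symm z ∈ (chartAt H x).source := by
    rw [← extChartAt_source I]; exact (extChartAt I x).map_target hz
  simp only [Function.comp, ContinuousLinearMap.inCoordinates, chartForm]
  rw [TangentBundle.symmL_trivializationAt hs, (extChartAt I x).right_inv hz]
  ext u
  simp

theorem SmoothField.differentiableAt_chartField [CompleteSpace E] {X : ∀ x : N, TangentSpace I x}
    (hX : SmoothField I X) (x : N) :
    DifferentiableAt ℝ (chartField I X x) (extChartAt I x x) := by
  have h : DifferentiableWithinAt ℝ (chartField I X x) ((extChartAt I x).symm ⁻¹' univ ∩ range I)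
      (extChartAt I x x) :=
    MDifferentiableWithinAt.differentiableWithinAt_mpullbackWithin_vectorField (I := I)
      (V := X) (s := univ) (x := x)
      ((hX x).mdifferentiableAt (by simp)).mdifferentiableWithinAt
  rwa [I.range_eq_univ, preimage_univ, inter_self, differentiableWithinAt_univ] at h

/-- Without boundary the derivative within the range is the full derivative, and the chart at `x`
has the identity as its derivative at `x`, so no transport terms survive. -/
theorem extDeriv₁_apply (θ : ∀ x : N, Cotangent I x) (x : N) (v w : TangentSpace I x) :
    extDeriv₁ I θ x v w = fderiv ℝ (chartForm I θ x) (extChartAt I x x) v w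
      - fderiv ℝ (chartForm I θ x) (extChartAt I x x) w v := by
  have h : fderivWithin ℝ (chartForm I θ x) (range I) (extChartAt I x x)
      = fderiv ℝ (chartForm I θ x) (extChartAt I x x) := by
    rw [I.range_eq_univ, fderivWithin_univ]
  rw [← h]
  simp only [extDeriv₁]
  rw [mfderiv_extChartAt_self]
  rfl

theorem mlieBracket_eq_chart (X Y : ∀ x : N, TangentSpace I x) (x : N) :
    VectorField.mlieBracket I X Y x
      = fderiv ℝ (chartField I Y x) (extChartAt I x x) (X x)
        - fderiv ℝ (chartField I X x) (extChartAt I x x) (Y x) := by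
  have h : ∀ w : E, (mfderiv I 𝓘(ℝ, E) (extChartAt I x) x).inverse w = w := by
    intro w
    rw [mfderiv_extChartAt_self]
    exact congrArg (fun f : E →L[ℝ] E => f w) (ContinuousLinearMap.inverse_id (R := ℝ) (M := E))
  have h2 : VectorField.lieBracketWithin ℝ (chartField I X x) (chartField I Y x)
      ((extChartAt I x).symm ⁻¹' univ ∩ range I) (extChartAt I x x)
      = fderiv ℝ (chartField I Y x) (extChartAt I x x) (X x)
        - fderiv ℝ (chartField I X x) (extChartAt I x x) (Y x) := by
    rw [preimage_univ, univ_inter, I.range_eq_univ, VectorField.lieBracketWithin_univ,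
      VectorField.lieBracket_eq]
    beta_reduce
    rw [chartField_self, chartField_self]
  rw [← h2, ← VectorField.mlieBracketWithin_univ, VectorField.mlieBracketWithin_apply]
  exact h _

omit [I.Boundaryless] in
theorem dFun_eq_fderiv {f : N → ℝ} {h : E → ℝ} {x : N}
    (hh : DifferentiableAt ℝ h (extChartAt I x x))
    (hf : ∀ z ∈ (extChartAt I x).target, f ((extChartAt I x).symm z) = h z)
    (v : TangentSpace I x) :
    dFun I f x v = fderiv ℝ h (extChartAt I x x) v := by
  have h1 : f =ᶠ[𝓝 x] h ∘ extChartAt I x := by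
    filter_upwards [extChartAt_source_mem_nhds (I := I) x] with y hy
    rw [Function.comp, ← hf _ ((extChartAt I x).map_source hy), (extChartAt I x).left_inv hy]
  rw [dFun, h1.mfderiv_eq, mfderiv_comp x hh.mdifferentiableAt
    (mdifferentiableAt_extChartAt (mem_chart_source H x)), mfderiv_extChartAt_self, mfderiv_eq_fderiv]
  rfl

/-- Cartan's formula `dθ(X, Y) = X(θ(Y)) - Y(θ(X)) - θ([X, Y])`. -/
theorem extDeriv₁_eq [CompleteSpace E] {θ : ∀ x : N, Cotangent I x} (hθ : SmoothForm I θ)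
    {X Y : ∀ x : N, TangentSpace I x} (hX : SmoothField I X) (hY : SmoothField I Y) (x : N) :
    extDeriv₁ I θ x (X x) (Y x) = dFun I (fun y => θ y (Y y)) x (X x)
      - dFun I (fun y => θ y (X y)) x (Y x) - θ x (VectorField.mlieBracket I X Y x) := by
  -- Leibniz rule for `θ(Z)` in the chart. The terms differentiating `θ` assemble to `dθ`, those
  -- differentiating `X` and `Y` to the Lie bracket.
  have key : ∀ {Z : ∀ x : N, TangentSpace I x}, SmoothField I Z → ∀ v : TangentSpace I x,
      dFun I (fun y => θ y (Z y)) x v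
        = fderiv ℝ (chartForm I θ x) (extChartAt I x x) v (Z x)
          + θ x (fderiv ℝ (chartField I Z x) (extChartAt I x x) v) := by
    intro Z hZ v
    have h1 := (hθ.differentiableAt_chartForm x).hasFDerivAt.clm_apply
      (hZ.differentiableAt_chartField x).hasFDerivAt
    rw [dFun_eq_fderiv h1.differentiableAt
      (fun z hz => (chartForm_chartField θ Z x hz).symm), h1.fderiv, chartField_self,
      chartForm_self]
    exact add_comm _ _
  rw [key hX, key hY, extDeriv₁_apply, mlieBracket_eq_chart]
  erw [map_sub]
  ring

theorem contDiffAt_chart_comp {f : N → ℝ} (hf : ContMDiff I 𝓘(ℝ, ℝ) ∞ f) (x : N) {z : E}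
    (hz : z ∈ (extChartAt I x).target) :
    ContDiffAt ℝ ∞ (f ∘ (extChartAt I x).symm) z := by
  have h1 := contMDiffWithinAt_extChartAt_symm_range (I := I) (n := ∞) x hz
  rw [I.range_eq_univ] at h1
  exact ((hf _).comp z h1).contDiffAt

theorem chartForm_dFun {f : N → ℝ} (hf : ContMDiff I 𝓘(ℝ, ℝ) ∞ f) (x : N) {z : E}
    (hz : z ∈ (extChartAt I x).target) :
    chartForm I (dFun I f) x z = fderiv ℝ (f ∘ (extChartAt I x).symm) z := by
  have h1 := contMDiffWithinAt_extChartAt_symm_range (I := I) (n := ∞) x hz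
  have h2 := mfderiv_comp_mfderivWithin (I := 𝓘(ℝ, E)) z
    ((hf _).mdifferentiableAt (by simp)) (h1.mdifferentiableWithinAt (by simp))
    (by rw [I.range_eq_univ]; exact uniqueMDiffWithinAt_univ _)
  have h3 : mfderivWithin 𝓘(ℝ, E) 𝓘(ℝ, ℝ) (f ∘ (extChartAt I x).symm) (range I) z
      = fderiv ℝ (f ∘ (extChartAt I x).symm) z := by
    rw [I.range_eq_univ, mfderivWithin_univ, mfderiv_eq_fderiv]
  rw [← h3, h2]
  rfl

/-- In the chart, `df` is the derivative of the coordinate expression of `f`, and second derivatives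
are symmetric. -/
theorem extDeriv₁_dFun {f : N → ℝ} (hf : ContMDiff I 𝓘(ℝ, ℝ) ∞ f) (x : N)
    (v w : TangentSpace I x) : extDeriv₁ I (dFun I f) x v w = 0 := by
  have h : chartForm I (dFun I f) x =ᶠ[𝓝 (extChartAt I x x)]
      fderiv ℝ (f ∘ (extChartAt I x).symm) := by
    filter_upwards [extChartAt_target_mem_nhds (I := I) x] with z hz
    exact chartForm_dFun hf x hz
  rw [extDeriv₁_apply, h.fderiv_eq, sub_eq_zero]
  have hs : IsSymmSndFDerivAt ℝ (f ∘ (extChartAt I x).symm) (extChartAt I x x) :=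
    (contDiffAt_chart_comp hf x (mem_extChartAt_target x)).isSymmSndFDerivAt
      (by simpa using ENat.LEInfty.out)
  exact hs v w

omit [I.Boundaryless] in
theorem dFun_smooth {f : N → ℝ} (hf : ContMDiff I 𝓘(ℝ, ℝ) ∞ f) : SmoothForm I (dFun I f) := by
  intro x
  refine (contMDiffAt_hom_bundle (F₂ := ℝ) (E₂ := Bundle.Trivial N ℝ) _).2
    ⟨contMDiffAt_id, ?_⟩
  have h := ContMDiffAt.mfderiv_const (hf x) (m := ∞) (by simp)
  refine h.congr_of_eventuallyEq ?_
  filter_upwards with y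
  simp only [inTangentCoordinates, ContinuousLinearMap.inCoordinates]
  ext u
  simp [dFun]
  rfl

/-- The Lie bracket is the commutator of derivations. -/
theorem dFun_mlieBracket [CompleteSpace E] {f : N → ℝ} (hf : ContMDiff I 𝓘(ℝ, ℝ) ∞ f)
    {X Y : ∀ x : N, TangentSpace I x} (hX : SmoothField I X) (hY : SmoothField I Y) (x : N) :
    dFun I f x (VectorField.mlieBracket I X Y x)
      = dFun I (fun y => dFun I f y (Y y)) x (X x)
        - dFun I (fun y => dFun I f y (X y)) x (Y x) := by
  -- Cartan's formula for `df`, whose left side vanishes because `d² = 0`.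
  have h := extDeriv₁_eq (dFun_smooth hf) hX hY x
  rw [extDeriv₁_dFun hf] at h
  linarith

end Cartan

/-! ### Smooth sections of vector bundles: cut-offs, local frames, duality. -/

section Sections

variable {E : Type*} [NormedAddCommGroup E] [NormedSpace ℝ E]
  {H : Type*} [TopologicalSpace H] {I : ModelWithCorners ℝ E H}
  {N : Type*} [TopologicalSpace N] [ChartedSpace H N] [IsManifold I ∞ N]
  {F : Type*} [NormedAddCommGroup F] [NormedSpace ℝ F]
  {V : N → Type*} [TopologicalSpace (TotalSpace F V)]
  [∀ x, AddCommGroup (V x)] [∀ x, Module ℝ (V x)] [∀ x, TopologicalSpace (V x)]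
  [FiberBundle F V] [VectorBundle ℝ F V]

omit [IsManifold I ∞ N] [∀ x, AddCommGroup (V x)] [∀ x, Module ℝ (V x)] [VectorBundle ℝ F V] in
theorem SmoothSec.congr_of_eventually {s : ∀ x, V x}
    (h : ∀ x₀, ∃ t : ∀ x, V x, SmoothSec I F t ∧ ∀ᶠ x in 𝓝 x₀, s x = t x) : SmoothSec I F s := by
  intro x₀
  obtain ⟨t, ht, hst⟩ := h x₀
  refine (ht x₀).congr_of_eventuallyEq ?_
  filter_upwards [hst] with x hx
  rw [hx]

theorem contMDiffAt_pairing {P : Type*} {EP : Type*} [NormedAddCommGroup EP] [NormedSpace ℝ EP]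
    {HP : Type*} [TopologicalSpace HP] {IP : ModelWithCorners ℝ EP HP} [TopologicalSpace P]
    [ChartedSpace HP P] {b : P → N} {α : ∀ p, V (b p) →L[ℝ] ℝ} {v : ∀ p, V (b p)} {p : P}
    (hα : ContMDiffAt IP (I.prod 𝓘(ℝ, F →L[ℝ] ℝ)) ∞
      (fun p => TotalSpace.mk' (F →L[ℝ] ℝ) (E := fun x => V x →L[ℝ] ℝ) (b p) (α p)) p)
    (hv : ContMDiffAt IP (I.prod 𝓘(ℝ, F)) ∞ (fun p => TotalSpace.mk' F (b p) (v p)) p) :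
    ContMDiffAt IP 𝓘(ℝ, ℝ) ∞ (fun p => α p (v p)) p := by
  have h := ContMDiffAt.clm_bundle_apply (F₂ := ℝ) (E₂ := Bundle.Trivial N ℝ) (IB := I) hα hv
  exact ((contMDiffAt_totalSpace).1 h).2

theorem SmoothSec.pairing {α : ∀ x, V x →L[ℝ] ℝ} {v : ∀ x, V x} (hα : SmoothSec I (F →L[ℝ] ℝ) α)
    (hv : SmoothSec I F v) : ContMDiff I 𝓘(ℝ, ℝ) ∞ (fun x => α x (v x)) :=
  fun x => contMDiffAt_pairing (hα x) (hv x)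

theorem SmoothSec.add {s t : ∀ x, V x} (hs : SmoothSec I F s) (ht : SmoothSec I F t) :
    SmoothSec I F (s + t) := ContMDiff.add_section hs ht

theorem SmoothSec.neg {s : ∀ x, V x} (hs : SmoothSec I F s) : SmoothSec I F (-s) :=
  ContMDiff.neg_section hs

theorem SmoothSec.smul {f : N → ℝ} {s : ∀ x, V x} (hf : ContMDiff I 𝓘(ℝ, ℝ) ∞ f)
    (hs : SmoothSec I F s) : SmoothSec I F (fun x => f x • s x) := ContMDiff.smul_section hf hs

theorem SmoothSec.zero : SmoothSec I F (0 : ∀ x, V x) := contMDiff_zeroSection ℝ V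

theorem SmoothSec.sum {ι : Type*} {S : Finset ι} {t : ι → ∀ x, V x}
    (ht : ∀ i ∈ S, SmoothSec I F (t i)) : SmoothSec I F (fun x => ∑ i ∈ S, t i x) :=
  ContMDiff.sum_section ht

variable [FiniteDimensional ℝ E] [T2Space N]

theorem exists_bump {x₀ : N} {U : Set N} (hU : U ∈ 𝓝 x₀) :
    ∃ ψ : N → ℝ, ContMDiff I 𝓘(ℝ, ℝ) ∞ ψ ∧ tsupport ψ ⊆ U ∧ ∀ᶠ x in 𝓝 x₀, ψ x = 1 := by
  obtain ⟨ψ, -, hψ⟩ := (SmoothBumpFunction.nhds_basis_tsupport (I := I) x₀).mem_iff.1 hU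
  exact ⟨ψ, ψ.contMDiff, hψ, ψ.eventuallyEq_one⟩

theorem exists_smoothSec_eventuallyEq {s : ∀ x, V x} {x₀ : N} {U : Set N} (hU : IsOpen U)
    (hx : x₀ ∈ U)
    (hs : ContMDiffOn I (I.prod 𝓘(ℝ, F)) ∞ (fun x => TotalSpace.mk' F x (s x)) U) :
    ∃ t : ∀ x, V x, SmoothSec I F t ∧ ∀ᶠ x in 𝓝 x₀, t x = s x := by
  obtain ⟨ψ, hψ, hsupp, h1⟩ := exists_bump (I := I) (hU.mem_nhds hx)
  refine ⟨ψ • s, ContMDiffOn.smul_section_of_tsupport hψ.contMDiffOn hU hsupp hs, ?_⟩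
  filter_upwards [h1] with x hx
  simp [hx]

variable [ContMDiffVectorBundle ∞ F V I]

theorem exists_smoothSec_eq {x₀ : N} (v : V x₀) : ∃ s : ∀ x, V x, SmoothSec I F s ∧ s x₀ = v := by
  obtain ⟨U, hU, hs⟩ := FiberBundle.exists_contMDiffOn_extend (k := ∞) I F v
  obtain ⟨W, hWU, hW, hxW⟩ := mem_nhds_iff.1 hU
  obtain ⟨t, ht, hts⟩ := exists_smoothSec_eventuallyEq hW hxW (hs.mono hWU)
  exact ⟨t, ht, by rw [hts.self_of_nhds, FiberBundle.extend_apply_self]⟩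

variable [FiniteDimensional ℝ F]

variable (I F V) in
/-- Near every point there is a frame of smooth sections with a smooth dual frame. -/
theorem exists_smooth_frame (x₀ : N) :
    ∃ (n : ℕ) (s : Fin n → ∀ x, V x) (α : Fin n → ∀ x, V x →L[ℝ] ℝ),
      (∀ i, SmoothSec I F (s i)) ∧ (∀ i, SmoothSec I (F →L[ℝ] ℝ) (α i)) ∧
      ∀ᶠ x in 𝓝 x₀, ∀ v : V x, v = ∑ i, α i x v • s i x := by
  let e := trivializationAt F V x₀
  let b := Module.finBasis ℝ F
  have hx₀ : x₀ ∈ e.baseSet := FiberBundle.mem_baseSet_trivializationAt' x₀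
  -- The frame is constant in a trivialisation; cutting it off makes the sections global without
  -- changing their germs at `x₀`.
  have h1 : ∀ i, ∃ t : ∀ x, V x, SmoothSec I F t ∧ ∀ᶠ x in 𝓝 x₀, t x = e.symm x (b i) := by
    intro i
    refine exists_smoothSec_eventuallyEq e.open_baseSet hx₀ ?_
    rw [e.contMDiffOn_section_baseSet_iff]
    refine (contMDiffOn_const (c := b i)).congr fun x hx => ?_
    rw [e.apply_mk_symm hx]
  have h2 : ∀ i, ∃ t : ∀ x, V x →L[ℝ] ℝ, SmoothSec I (F →L[ℝ] ℝ) t ∧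
      ∀ᶠ x in 𝓝 x₀, t x = (b.coord i).toContinuousLinearMap.comp (e.continuousLinearMapAt ℝ x) := by
    intro i
    refine exists_smoothSec_eventuallyEq (V := fun x => V x →L[ℝ] ℝ) e.open_baseSet hx₀ ?_
    intro x hx
    refine ContMDiffAt.contMDiffWithinAt ?_
    refine (contMDiffAt_hom_bundle (F₂ := ℝ) (E₂ := Bundle.Trivial N ℝ) _).2
      ⟨contMDiffAt_id, ?_⟩
    let e' := trivializationAt F V x
    have hx' : x ∈ e'.baseSet := FiberBundle.mem_baseSet_trivializationAt' x
    -- Read in the trivialisation at `x`, the covector is a coordinate functional composed with a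
    -- coordinate change, which depends smoothly on the point.
    have h3 : ContMDiffAt I 𝓘(ℝ, F →L[ℝ] ℝ) ∞
        (fun y => (b.coord i).toContinuousLinearMap.comp (e'.coordChangeL ℝ e y : F →L[ℝ] F)) x :=
      ContMDiffAt.clm_comp contMDiffAt_const (contMDiffAt_coordChangeL hx' hx)
    refine h3.congr_of_eventuallyEq ?_
    filter_upwards [e.open_baseSet.mem_nhds hx, e'.open_baseSet.mem_nhds hx'] with y hy hy'
    ext u
    simp [ContinuousLinearMap.inCoordinates, e'.coordChangeL_apply e ⟨hy', hy⟩, e'.symmL_apply hy',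
      e', e.coe_linearMapAt_of_mem hy]
  choose s hs hse using h1
  choose α hα hαe using h2
  refine ⟨_, s, α, hs, hα, ?_⟩
  filter_upwards [Filter.eventually_all.2 hse, Filter.eventually_all.2 hαe,
    e.open_baseSet.mem_nhds hx₀] with x h1 h2 hx v
  simp only [h1, h2]
  have h4 := b.sum_repr (e.continuousLinearMapAt ℝ x v)
  have h5 := congrArg (e.symmL ℝ x) h4
  rw [e.symmL_continuousLinearMapAt hx, map_sum] at h5
  refine h5.symm.trans (Finset.sum_congr rfl fun i _ => ?_)
  rw [map_smul, e.symmL_apply hx]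
  rfl

/-- A section is smooth if its pairings with smooth sections of the dual are. -/
theorem smoothSec_of_dual {s : ∀ x, V x}
    (h : ∀ α : ∀ x, V x →L[ℝ] ℝ, SmoothSec I (F →L[ℝ] ℝ) α →
      ContMDiff I 𝓘(ℝ, ℝ) ∞ (fun x => α x (s x))) : SmoothSec I F s := by
  refine SmoothSec.congr_of_eventually fun x₀ => ?_
  obtain ⟨n, t, α, ht, hα, hx⟩ := exists_smooth_frame I F V x₀
  refine ⟨_, SmoothSec.sum (S := Finset.univ) fun i _ => SmoothSec.smul (h _ (hα i)) (ht i), ?_⟩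
  filter_upwards [hx] with x hx
  exact hx (s x)

/-- A section of the dual is smooth if its pairings with smooth sections are. -/
theorem smoothSec_dual_of_pairing {α : ∀ x, V x →L[ℝ] ℝ}
    (h : ∀ s : ∀ x, V x, SmoothSec I F s → ContMDiff I 𝓘(ℝ, ℝ) ∞ (fun x => α x (s x))) :
    SmoothSec I (F →L[ℝ] ℝ) α := by
  refine SmoothSec.congr_of_eventually fun x₀ => ?_
  obtain ⟨n, t, β, ht, hβ, hx⟩ := exists_smooth_frame I F V x₀
  refine ⟨_, SmoothSec.sum (S := Finset.univ) fun i _ => SmoothSec.smul (h _ (ht i)) (hβ i), ?_⟩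
  filter_upwards [hx] with x hx
  ext v
  conv_lhs => rw [hx v]
  simp [map_sum, mul_comm]

/-- A linear fibrewise map which preserves smooth sections is a smooth map of total spaces. -/
theorem contMDiff_of_smoothSec {F' : Type*} [NormedAddCommGroup F'] [NormedSpace ℝ F']
    {V' : N → Type*} [TopologicalSpace (TotalSpace F' V')]
    [∀ x, AddCommGroup (V' x)] [∀ x, Module ℝ (V' x)] [∀ x, TopologicalSpace (V' x)]
    [FiberBundle F' V'] [VectorBundle ℝ F' V'] {φ : ∀ x, V x →L[ℝ] V' x}
    (h : ∀ s : ∀ x, V x, SmoothSec I F s → SmoothSec I F' (fun x => φ x (s x))) :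
    ContMDiff (I.prod 𝓘(ℝ, F)) (I.prod 𝓘(ℝ, F')) ∞
      (fun p : TotalSpace F V => TotalSpace.mk' F' p.proj (φ p.proj p.2)) := by
  intro p₀
  obtain ⟨n, t, β, ht, hβ, hx⟩ := exists_smooth_frame I F V p₀.proj
  have hproj : ContMDiffAt (I.prod 𝓘(ℝ, F)) I ∞ (TotalSpace.proj : TotalSpace F V → N) p₀ :=
    contMDiffAt_proj V
  refine contMDiffAt_totalSpace.2 ⟨hproj, ?_⟩
  let e := trivializationAt F' V' p₀.proj
  have hp₀ : p₀.proj ∈ e.baseSet := FiberBundle.mem_baseSet_trivializationAt' p₀.proj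
  -- Expanding `p` in the frame, the fibre coordinate of `φ p` is a sum of smooth fibrewise linear
  -- functions times coordinates of the smooth sections `φ (t i)`.
  have h1 : ContMDiffAt (I.prod 𝓘(ℝ, F)) 𝓘(ℝ, F') ∞ (fun p : TotalSpace F V =>
      ∑ i, β i p.proj p.2 • (e ⟨p.proj, φ p.proj (t i p.proj)⟩).2) p₀ := by
    refine ContMDiffAt.sum fun i _ => ?_
    have hc : ContMDiffAt (I.prod 𝓘(ℝ, F)) 𝓘(ℝ, ℝ) ∞
        (fun p : TotalSpace F V => β i p.proj p.2) p₀ :=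
      contMDiffAt_pairing (b := TotalSpace.proj) (v := fun p : TotalSpace F V => p.2)
        (ContMDiffAt.comp p₀ (hβ i p₀.proj) hproj) contMDiffAt_id
    have hv : ContMDiffAt (I.prod 𝓘(ℝ, F)) 𝓘(ℝ, F') ∞
        (fun p : TotalSpace F V => (e ⟨p.proj, φ p.proj (t i p.proj)⟩).2) p₀ :=
      ContMDiffAt.comp (g := fun x => (e ⟨x, φ x (t i x)⟩).2) p₀
        ((contMDiffAt_section _).1 (h _ (ht i) p₀.proj)) hproj
    exact hc.smul hv
  refine h1.congr_of_eventuallyEq ?_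
  filter_upwards [hproj.continuousAt hx, hproj.continuousAt (e.open_baseSet.mem_nhds hp₀)]
    with p hp hp'
  have h2 := congrArg (fun v => e.linearMapAt ℝ p.proj (φ p.proj v)) (hp p.2)
  simp only [map_sum, map_smul] at h2
  simpa [e.coe_linearMapAt_of_mem hp'] using h2

end Sections

/-! ### Smoothness in a direct sum of bundles. -/

section ProductBundle

variable {E : Type*} [NormedAddCommGroup E] [NormedSpace ℝ E]
  {H : Type*} [TopologicalSpace H] {I : ModelWithCorners ℝ E H}
  {N : Type*} [TopologicalSpace N] [ChartedSpace H N]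
  {F₁ : Type*} [NormedAddCommGroup F₁] [NormedSpace ℝ F₁]
  {V₁ : N → Type*} [TopologicalSpace (TotalSpace F₁ V₁)]
  [∀ x, AddCommGroup (V₁ x)] [∀ x, Module ℝ (V₁ x)] [∀ x, TopologicalSpace (V₁ x)]
  [FiberBundle F₁ V₁] [VectorBundle ℝ F₁ V₁]
  {F₂ : Type*} [NormedAddCommGroup F₂] [NormedSpace ℝ F₂]
  {V₂ : N → Type*} [TopologicalSpace (TotalSpace F₂ V₂)]
  [∀ x, AddCommGroup (V₂ x)] [∀ x, Module ℝ (V₂ x)] [∀ x, TopologicalSpace (V₂ x)]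
  [FiberBundle F₂ V₂] [VectorBundle ℝ F₂ V₂]
  {P : Type*} {EP : Type*} [NormedAddCommGroup EP] [NormedSpace ℝ EP]
    {HP : Type*} [TopologicalSpace HP] {IP : ModelWithCorners ℝ EP HP} [TopologicalSpace P]
    [ChartedSpace HP P]

theorem contMDiffAt_prodBundle {b : P → N} {v₁ : ∀ p, V₁ (b p)} {v₂ : ∀ p, V₂ (b p)} {p : P} :
    ContMDiffAt IP (I.prod 𝓘(ℝ, F₁ × F₂)) ∞
      (fun p => (TotalSpace.mk' (F₁ × F₂) (b p) (v₁ p, v₂ p) : TotalSpace (F₁ × F₂) (V₁ ×ᵇ V₂))) p ↔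
    ContMDiffAt IP (I.prod 𝓘(ℝ, F₁)) ∞ (fun p => TotalSpace.mk' F₁ (b p) (v₁ p)) p ∧
    ContMDiffAt IP (I.prod 𝓘(ℝ, F₂)) ∞ (fun p => TotalSpace.mk' F₂ (b p) (v₂ p)) p := by
  simp only [contMDiffAt_totalSpace]
  have h : ∀ q, (trivializationAt (F₁ × F₂) (V₁ ×ᵇ V₂) (b p)
      (TotalSpace.mk' (F₁ × F₂) (b q) (v₁ q, v₂ q) : TotalSpace (F₁ × F₂) (V₁ ×ᵇ V₂))).2
      = ((trivializationAt F₁ V₁ (b p) ⟨b q, v₁ q⟩).2, (trivializationAt F₂ V₂ (b p) ⟨b q, v₂ q⟩).2) :=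
    fun _ => rfl
  simp only [h]
  rw [contMDiffAt_prod_module_iff]
  simp only [Function.comp_def]
  tauto

theorem contMDiff_prodBundle_fst :
    ContMDiff (I.prod 𝓘(ℝ, F₁ × F₂)) (I.prod 𝓘(ℝ, F₁)) ∞
      (fun p : TotalSpace (F₁ × F₂) (V₁ ×ᵇ V₂) => TotalSpace.mk' F₁ p.proj p.2.1) := fun p =>
  (contMDiffAt_prodBundle (b := TotalSpace.proj)
    (v₁ := fun p : TotalSpace (F₁ × F₂) (V₁ ×ᵇ V₂) => p.2.1) (v₂ := fun p => p.2.2) (p := p)).1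
    contMDiffAt_id |>.1

theorem contMDiff_prodBundle_snd :
    ContMDiff (I.prod 𝓘(ℝ, F₁ × F₂)) (I.prod 𝓘(ℝ, F₂)) ∞
      (fun p : TotalSpace (F₁ × F₂) (V₁ ×ᵇ V₂) => TotalSpace.mk' F₂ p.proj p.2.2) := fun p =>
  (contMDiffAt_prodBundle (b := TotalSpace.proj)
    (v₁ := fun p : TotalSpace (F₁ × F₂) (V₁ ×ᵇ V₂) => p.2.1) (v₂ := fun p => p.2.2) (p := p)).1
    contMDiffAt_id |>.2

theorem smoothSec_prod {s : ∀ x, V₁ x × V₂ x} :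
    SmoothSec I (F₁ × F₂) (A := V₁ ×ᵇ V₂) s ↔
      SmoothSec I F₁ (fun x => (s x).1) ∧ SmoothSec I F₂ (fun x => (s x).2) :=
  ⟨fun h => ⟨fun x => ((contMDiffAt_prodBundle (b := id)).1 (h x)).1,
    fun x => ((contMDiffAt_prodBundle (b := id)).1 (h x)).2⟩,
   fun h x => (contMDiffAt_prodBundle (b := id)).2 ⟨h.1 x, h.2 x⟩⟩

end ProductBundle

/-! ### Functions with prescribed differential. -/

section Covectors

variable {E : Type*} [NormedAddCommGroup E] [NormedSpace ℝ E] [FiniteDimensional ℝ E]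
  {H : Type*} [TopologicalSpace H] {I : ModelWithCorners ℝ E H}
  {N : Type*} [TopologicalSpace N] [ChartedSpace H N] [IsManifold I ∞ N] [T2Space N]

/-- Every covector is the differential of a smooth function. -/
theorem exists_dFun_eq (x : N) (φ : Cotangent I x) :
    ∃ f : N → ℝ, ContMDiff I 𝓘(ℝ, ℝ) ∞ f ∧ dFun I f x = φ := by
  obtain ⟨ψ, -⟩ := (SmoothBumpFunction.nhds_basis_tsupport (I := I) x).ex_mem
  let φ' : E →L[ℝ] ℝ := φ
  -- The functional is read in the chart at `x`, whose derivative there is the identity, and cut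
  -- off.
  refine ⟨fun y => ψ y • φ' (extChartAt I x y), ψ.contMDiff_smul ?_, ?_⟩
  · exact φ'.contDiff.contMDiff.comp_contMDiffOn contMDiffOn_extChartAt
  · have h : (fun y => ψ y • φ' (extChartAt I x y)) =ᶠ[𝓝 x] φ' ∘ extChartAt I x := by
      filter_upwards [ψ.eventuallyEq_one] with y hy
      simp [hy]
    rw [dFun, h.mfderiv_eq, mfderiv_comp x φ'.differentiableAt.mdifferentiableAt
      (mdifferentiableAt_extChartAt (mem_chart_source H x)), mfderiv_extChartAt_self,
      mfderiv_eq_fderiv, φ'.fderiv]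
    rfl

theorem tangent_ext {x : N} {u v : TangentSpace I x}
    (h : ∀ f : N → ℝ, ContMDiff I 𝓘(ℝ, ℝ) ∞ f → dFun I f x u = dFun I f x v) : u = v := by
  let u' : E := u
  let v' : E := v
  refine (SeparatingDual.eq_iff_forall_dual_eq (R := ℝ) (x := u') (y := v')).2 fun φ => ?_
  obtain ⟨f, hf, hfφ⟩ := exists_dFun_eq (I := I) x φ
  have := h f hf
  rw [hfφ] at this
  exact this

end Covectors

/-! ### Tangent vectors of the total space of `A`. -/

section TotalSpaceGeometry

variable {E : Type*} [NormedAddCommGroup E] [NormedSpace ℝ E] [FiniteDimensional ℝ E]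
  {H : Type*} [TopologicalSpace H] {I : ModelWithCorners ℝ E H}
  {M : Type*} [TopologicalSpace M] [ChartedSpace H M] [IsManifold I ∞ M] [T2Space M]
  {F : Type*} [NormedAddCommGroup F] [NormedSpace ℝ F] [FiniteDimensional ℝ F]
  {A : M → Type*} [TopologicalSpace (TotalSpace F A)]
  [∀ x, AddCommGroup (A x)] [∀ x, Module ℝ (A x)] [∀ x, TopologicalSpace (A x)]
  [FiberBundle F A] [VectorBundle ℝ F A] [ContMDiffVectorBundle ∞ F A I]

theorem mfderiv_affine {g : ℝ → F} {c d : F} (h : ∀ t, g t = c + t • d) :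
    mfderiv 𝓘(ℝ, ℝ) 𝓘(ℝ, F) g 0 (1 : ℝ) = d := by
  have hg : g = fun t => c + t • d := funext h
  have h2 : HasFDerivAt g ((ContinuousLinearMap.id ℝ ℝ).smulRight d) 0 := by
    rw [hg]
    exact ((hasFDerivAt_id (0 : ℝ)).smul_const d).const_add c
  exact (congrArg (fun L => L 1) (mfderiv_eq_fderiv.trans h2.fderiv)).trans (one_smul ℝ d)

variable (I) in
theorem contMDiff_fibreLine (x : M) (v e : A x) :
    ContMDiff 𝓘(ℝ, ℝ) (I.prod 𝓘(ℝ, F)) ∞ (fun t : ℝ => TotalSpace.mk' F x (v + t • e)) := by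
  intro t
  refine contMDiffAt_totalSpace.2 ⟨contMDiffAt_const, ?_⟩
  have hx : x ∈ (trivializationAt F A x).baseSet := FiberBundle.mem_baseSet_trivializationAt' x
  have h : ∀ s : ℝ, (trivializationAt F A x ⟨x, v + s • e⟩).2
      = (trivializationAt F A x ⟨x, v⟩).2 + s • (trivializationAt F A x ⟨x, e⟩).2 := by
    intro s
    have := ((trivializationAt F A x).linear ℝ hx)
    rw [this.map_add, this.map_smul]
  simp only [h]
  exact contMDiffAt_const.add (contMDiffAt_id.smul contMDiffAt_const)

theorem mfderiv_vert {E' : Type*} [NormedAddCommGroup E'] [NormedSpace ℝ E']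
    {H' : Type*} [TopologicalSpace H'] {I' : ModelWithCorners ℝ E' H'}
    {M' : Type*} [TopologicalSpace M'] [ChartedSpace H' M'] {g : TotalSpace F A → M'}
    {v : TotalSpace F A} (hg : MDifferentiableAt (I.prod 𝓘(ℝ, F)) I' g v) (e : A v.proj) :
    mfderiv (I.prod 𝓘(ℝ, F)) I' g v (vert I v e)
      = mfderiv 𝓘(ℝ, ℝ) I' (fun t : ℝ => g (TotalSpace.mk' F v.proj (v.2 + t • e))) 0 (1 : ℝ) := by
  have h := mfderiv_comp_apply_of_eq (x := (0 : ℝ)) hg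
    ((contMDiff_fibreLine I v.proj v.2 e).mdifferentiable (by simp) 0)
    (by simp) (1 : ℝ)
  exact h.symm

@[simp]
theorem tproj_vert (v : TotalSpace F A) (e : A v.proj) : tproj I v (vert I v e) = 0 := by
  have h := mfderiv_vert (I := I) ((contMDiff_proj A v).mdifferentiableAt (n := ∞) (by simp)) e
  refine h.trans ?_
  have : (fun t : ℝ => (TotalSpace.mk' F v.proj (v.2 + t • e)).proj) = fun _ => v.proj := rfl
  erw [this, mfderiv_const]
  rfl

theorem contMDiffAt_fibreCoord (v : TotalSpace F A) :
    ContMDiffAt (I.prod 𝓘(ℝ, F)) 𝓘(ℝ, F) ∞ (fun u => (trivializationAt F A v.proj u).2) v :=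
  (contMDiffAt_totalSpace.1 (contMDiffAt_id (I := I.prod 𝓘(ℝ, F)) (x := v))).2

theorem mfderiv_fibreCoord_vert (v : TotalSpace F A) (e : A v.proj) :
    mfderiv (I.prod 𝓘(ℝ, F)) 𝓘(ℝ, F) (fun u => (trivializationAt F A v.proj u).2) v (vert I v e)
      = (trivializationAt F A v.proj ⟨v.proj, e⟩).2 := by
  rw [mfderiv_vert ((contMDiffAt_fibreCoord v).mdifferentiableAt (by simp))]
  have hx : v.proj ∈ (trivializationAt F A v.proj).baseSet :=
    FiberBundle.mem_baseSet_trivializationAt' v.proj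
  have h : ∀ s : ℝ, (trivializationAt F A v.proj ⟨v.proj, v.2 + s • e⟩).2
      = (trivializationAt F A v.proj v).2 + s • (trivializationAt F A v.proj ⟨v.proj, e⟩).2 := by
    intro s
    have := ((trivializationAt F A v.proj).linear ℝ hx)
    rw [this.map_add, this.map_smul]
  exact mfderiv_affine h

@[simp]
theorem fibrePart_vert (v : TotalSpace F A) (e : A v.proj) : fibrePart I v (vert I v e) = e := by
  have hx : v.proj ∈ (trivializationAt F A v.proj).baseSet :=
    FiberBundle.mem_baseSet_trivializationAt' v.proj
  have h := mfderiv_fibreCoord_vert (I := I) v e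
  refine (congrArg ((trivializationAt F A v.proj).symmL ℝ v.proj) h).trans ?_
  have := (trivializationAt F A v.proj).symmL_continuousLinearMapAt (R := ℝ) hx e
  simpa [Trivialization.coe_linearMapAt_of_mem _ hx] using this

/-- The projection and the fibre coordinate together form a local diffeomorphism (the
trivialisation), so a vector killed by both derivatives is zero. -/
theorem tangent_eq_zero {v : TotalSpace F A} {w : TangentSpace (I.prod 𝓘(ℝ, F)) v}
    (h1 : tproj I v w = 0) (h2 : fibrePart I v w = 0) : w = 0 := by
  let e := trivializationAt F A v.proj
  have hx : v.proj ∈ e.baseSet := FiberBundle.mem_baseSet_trivializationAt' v.proj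
  have hc : mfderiv (I.prod 𝓘(ℝ, F)) 𝓘(ℝ, F) (fun u => (e u).2) v w = 0 := by
    have := congrArg (e.continuousLinearMapAt ℝ v.proj) h2
    simp only [fibrePart] at this
    rw [map_zero] at this
    erw [e.continuousLinearMapAt_symmL hx] at this
    exact this
  let g : TotalSpace F A → M × F := fun u => (u.proj, (e u).2)
  have hp : MDifferentiableAt (I.prod 𝓘(ℝ, F)) I (fun u : TotalSpace F A => u.proj) v :=
    (contMDiff_proj A v).mdifferentiableAt (n := ∞) (by simp)
  have hf : MDifferentiableAt (I.prod 𝓘(ℝ, F)) 𝓘(ℝ, F) (fun u => (e u).2) v :=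
    (contMDiffAt_fibreCoord v).mdifferentiableAt (by simp)
  have hg : mfderiv (I.prod 𝓘(ℝ, F)) (I.prod 𝓘(ℝ, F)) g v w = 0 := by
    have := congrArg (fun L => L w) (mfderiv_prodMk hp hf)
    refine this.trans ?_
    exact Prod.ext h1 hc
  have hs : MDifferentiableAt (I.prod 𝓘(ℝ, F)) (I.prod 𝓘(ℝ, F)) e.toOpenPartialHomeomorph.symm
      (g v) :=
    ((e.contMDiffOn_symm (IB := I) (n := ∞)).contMDiffAt (e.open_target.mem_nhds
      (e.mem_target.2 hx))).mdifferentiableAt (by simp)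
  have hid : e.toOpenPartialHomeomorph.symm ∘ g =ᶠ[𝓝 v] id := by
    have : e.source ∈ 𝓝 v := e.open_source.mem_nhds (e.mem_source.2 hx)
    filter_upwards [this] with u hu
    have h3 : g u = e u := Prod.ext (e.coe_fst hu).symm rfl
    simp only [Function.comp, h3]
    exact e.toOpenPartialHomeomorph.left_inv hu
  have hchain := mfderiv_comp_apply v hs (hp.prodMk hf) w
  rw [hid.mfderiv_eq, mfderiv_id] at hchain
  exact hchain.trans ((congrArg _ hg).trans (map_zero _))

theorem tangent_ext_parts {v : TotalSpace F A} {w w' : TangentSpace (I.prod 𝓘(ℝ, F)) v}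
    (h1 : tproj I v w = tproj I v w') (h2 : fibrePart I v w = fibrePart I v w') : w = w' :=
  sub_eq_zero.1 (tangent_eq_zero (I := I) (by rw [map_sub, h1, sub_self])
    (by rw [map_sub, h2, sub_self]))

theorem vert_fibrePart {v : TotalSpace F A} {w : TangentSpace (I.prod 𝓘(ℝ, F)) v}
    (h : tproj I v w = 0) : vert I v (fibrePart I v w) = w :=
  tangent_ext_parts (by rw [tproj_vert, h]) (by rw [fibrePart_vert])

theorem vert_add (v : TotalSpace F A) (e e' : A v.proj) :
    vert I v (e + e') = vert I v e + vert I v e' :=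
  tangent_ext_parts (by simp) (by simp)

theorem vert_smul (v : TotalSpace F A) (r : ℝ) (e : A v.proj) :
    vert I v (r • e) = r • vert I v e :=
  tangent_ext_parts (by simp) (by simp)

variable (I F) in
/-- The tangent map of a section of `A`. -/
abbrev secTangent (a : ∀ x : M, A x) (x : M) :
    TangentSpace I x →L[ℝ] TangentSpace (I.prod 𝓘(ℝ, F)) (TotalSpace.mk' F x (a x)) :=
  mfderiv I (I.prod 𝓘(ℝ, F)) (fun y => TotalSpace.mk' F y (a y)) x

theorem SmoothSec.mdifferentiableAt {a : ∀ x : M, A x} (ha : SmoothSec I F a) (x : M) :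
    MDifferentiableAt I (I.prod 𝓘(ℝ, F)) (fun y => TotalSpace.mk' F y (a y)) x :=
  (ha x).mdifferentiableAt (by simp)

theorem tproj_secTangent {a : ∀ x : M, A x} (ha : SmoothSec I F a) (x : M) (X : TangentSpace I x) :
    tproj I (TotalSpace.mk' F x (a x)) (secTangent I F a x X) = X := by
  have h := mfderiv_comp_apply x (g := fun u : TotalSpace F A => u.proj)
    ((contMDiff_proj (IB := I) A _).mdifferentiableAt (n := ∞) (by simp))
    (ha.mdifferentiableAt x) X
  refine h.symm.trans ?_
  have h2 : ((fun u : TotalSpace F A => u.proj) ∘ fun y => TotalSpace.mk' F y (a y)) = id := rfl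
  rw [h2, mfderiv_id]
  rfl

/-- A vector at `a(x)` differs from the `Ta`-lift of its projection by a vertical vector. This
splitting along `a` underlies `vertProj`, `sigma` and `corePart`. -/
theorem tangent_decomp {a : ∀ x : M, A x} (ha : SmoothSec I F a) (x : M)
    (w : TangentSpace (I.prod 𝓘(ℝ, F)) (TotalSpace.mk' F x (a x))) :
    w = secTangent I F a x (tproj I _ w)
      + vert I _ (fibrePart I _ (w - secTangent I F a x (tproj I _ w))) := by
  rw [vert_fibrePart]
  · abel
  · rw [map_sub, tproj_secTangent ha, sub_self]

variable (F) in
/-- The fibrewise linear function on `A` of a section of `A*`. -/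
def fibLin (β : ∀ x : M, A x →L[ℝ] ℝ) (v : TotalSpace F A) : ℝ := β v.proj v.2

theorem fibLin_smooth {β : ∀ x : M, A x →L[ℝ] ℝ} (hβ : SmoothSec I (F →L[ℝ] ℝ) β) :
    ContMDiff (I.prod 𝓘(ℝ, F)) 𝓘(ℝ, ℝ) ∞ (fibLin F β) := fun p =>
  contMDiffAt_pairing (I := I) (b := TotalSpace.proj) (α := fun p : TotalSpace F A => β p.proj)
    (v := fun p : TotalSpace F A => p.2)
    (ContMDiffAt.comp p (hβ p.proj) (contMDiffAt_proj A)) contMDiffAt_id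

theorem dFun_fibLin_vert {β : ∀ x : M, A x →L[ℝ] ℝ} (hβ : SmoothSec I (F →L[ℝ] ℝ) β)
    (v : TotalSpace F A) (e : A v.proj) :
    dFun (I.prod 𝓘(ℝ, F)) (fibLin F β) v (vert I v e) = β v.proj e := by
  refine (mfderiv_vert ((fibLin_smooth hβ v).mdifferentiableAt (by simp)) e).trans ?_
  exact mfderiv_affine (c := β v.proj v.2) fun t => by simp [fibLin]

theorem dFun_secTangent {g : TotalSpace F A → ℝ}
    (hg : ContMDiff (I.prod 𝓘(ℝ, F)) 𝓘(ℝ, ℝ) ∞ g) {a : ∀ x : M, A x} (ha : SmoothSec I F a)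
    (x : M) (X : TangentSpace I x) :
    dFun (I.prod 𝓘(ℝ, F)) g (TotalSpace.mk' F x (a x)) (secTangent I F a x X)
      = dFun I (fun y => g (TotalSpace.mk' F y (a y))) x X :=
  (mfderiv_comp_apply x ((hg _).mdifferentiableAt (by simp)) (ha.mdifferentiableAt x) X).symm

theorem dFun_comp_proj {f : M → ℝ} (hf : ContMDiff I 𝓘(ℝ, ℝ) ∞ f) (v : TotalSpace F A)
    (w : TangentSpace (I.prod 𝓘(ℝ, F)) v) :
    dFun (I.prod 𝓘(ℝ, F)) (fun u : TotalSpace F A => f u.proj) v w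
      = dFun I f v.proj (tproj I v w) :=
  mfderiv_comp_apply v ((hf _).mdifferentiableAt (by simp))
    ((contMDiff_proj A v).mdifferentiableAt (n := ∞) (by simp)) w

theorem fibre_ext {x : M} {e e' : A x}
    (h : ∀ β : ∀ x : M, A x →L[ℝ] ℝ, SmoothSec I (F →L[ℝ] ℝ) β → β x e = β x e') : e = e' := by
  obtain ⟨n, s, α, -, hα, hx⟩ := exists_smooth_frame I F A x
  have h1 := hx.self_of_nhds
  rw [h1 e, h1 e']
  exact Finset.sum_congr rfl fun i _ => by rw [h _ (hα i)]

/-- A tangent vector of `A` is determined by its projection and its action on fibrewise linear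
functions. -/
theorem tangent_ext_fibLin {v : TotalSpace F A} {w w' : TangentSpace (I.prod 𝓘(ℝ, F)) v}
    (h1 : tproj I v w = tproj I v w')
    (h2 : ∀ β : ∀ x : M, A x →L[ℝ] ℝ, SmoothSec I (F →L[ℝ] ℝ) β →
      dFun (I.prod 𝓘(ℝ, F)) (fibLin F β) v w = dFun (I.prod 𝓘(ℝ, F)) (fibLin F β) v w') :
    w = w' := by
  have h3 : tproj I v (w - w') = 0 := by rw [map_sub, h1, sub_self]
  have h4 : fibrePart I v (w - w') = 0 := by
    refine fibre_ext (I := I) (F := F) fun β hβ => ?_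
    rw [← dFun_fibLin_vert hβ, vert_fibrePart h3, map_sub, h2 β hβ, sub_self, map_zero]
  exact sub_eq_zero.1 (tangent_eq_zero h3 h4)

end TotalSpaceGeometry

/-! ### Fibres of `𝕋A`: side, core and the pairing between them. -/

section CoreAlgebra

variable {E : Type*} [NormedAddCommGroup E] [NormedSpace ℝ E] [FiniteDimensional ℝ E]
  {H : Type*} [TopologicalSpace H] {I : ModelWithCorners ℝ E H}
  {M : Type*} [TopologicalSpace M] [ChartedSpace H M] [IsManifold I ∞ M] [T2Space M]
  {F : Type*} [NormedAddCommGroup F] [NormedSpace ℝ F] [FiniteDimensional ℝ F]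
  {A : M → Type*} [TopologicalSpace (TotalSpace F A)]
  [∀ x, AddCommGroup (A x)] [∀ x, Module ℝ (A x)] [∀ x, TopologicalSpace (A x)]
  [FiberBundle F A] [VectorBundle ℝ F A] [ContMDiffVectorBundle ∞ F A I]

/-- The pairing of `TM ⊕ A*` with `A ⊕ T*M`. -/
def sidePair {x : M} (ν : Side I A x) (τ : Core I A x) : ℝ := ν.2 τ.1 + τ.2 ν.1

/-- The canonical pairing of `TA ⊕ T*A`. -/
def gPair {v : TotalSpace F A} (p q : GTangent (I.prod 𝓘(ℝ, F)) v) : ℝ := p.2 q.1 + q.2 p.1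

theorem coreLift_add (v : TotalSpace F A) (τ υ : Core I A v.proj) :
    coreLift I v (τ + υ) = coreLift I v τ + coreLift I v υ :=
  Prod.ext (vert_add v _ _) (ContinuousLinearMap.add_comp _ _ _)

theorem coreLift_smul (v : TotalSpace F A) (r : ℝ) (τ : Core I A v.proj) :
    coreLift I v (r • τ) = r • coreLift I v τ :=
  Prod.ext (vert_smul v _ _) (ContinuousLinearMap.smul_comp _ _ _)

variable (I) in
/-- `coreLift` as a linear map. -/
def coreLiftₗ (v : TotalSpace F A) : Core I A v.proj →ₗ[ℝ] GTangent (I.prod 𝓘(ℝ, F)) v where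
  toFun := coreLift I v
  map_add' := coreLift_add v
  map_smul' := coreLift_smul v

theorem coreLift_zero (v : TotalSpace F A) : coreLift I v 0 = 0 := (coreLiftₗ I v).map_zero

theorem coreLift_sub (v : TotalSpace F A) (τ υ : Core I A v.proj) :
    coreLift I v (τ - υ) = coreLift I v τ - coreLift I v υ := (coreLiftₗ I v).map_sub τ υ

section LiesOver

variable {v : TotalSpace F A} {p p' : GTangent (I.prod 𝓘(ℝ, F)) v} {ν ν' : Side I A v.proj}

theorem LiesOver.unique (h : LiesOver v p ν) (h' : LiesOver v p ν') : ν = ν' :=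
  Prod.ext (h.1.symm.trans h'.1) (ContinuousLinearMap.ext fun e => (h.2 e).symm.trans (h'.2 e))

theorem LiesOver.neg (h : LiesOver v p ν) : LiesOver v (-p) (-ν) :=
  ⟨(map_neg _ _).trans (congrArg _ h.1), fun e => congrArg (- ·) (h.2 e)⟩

/-- Core elements see only the side component of `p`, and they see it independently of the point of
the fibre of `A`. This is how orthogonality of `J` is turned into duality between `j` and `jC`. -/
theorem LiesOver.gPair_coreLift (h : LiesOver v p ν) (τ : Core I A v.proj) :
    gPair p (coreLift I v τ) = sidePair ν τ :=
  congrArg₂ (· + ·) (h.2 τ.1) (congrArg τ.2 h.1)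

theorem liesOver_coreLift (τ : Core I A v.proj) : LiesOver v (coreLift I v τ) 0 :=
  ⟨tproj_vert v _, fun e => (congrArg τ.2 (tproj_vert v e)).trans (map_zero _)⟩

end LiesOver

include F in
theorem sidePair_core_ext {x : M} {τ υ : Core I A x}
    (h : ∀ ν : Side I A x, sidePair ν τ = sidePair ν υ) : τ = υ := by
  refine Prod.ext (fibre_ext (I := I) (F := F) fun β _ => ?_) (ContinuousLinearMap.ext fun X => ?_)
  · simpa [sidePair] using h (0, β x)
  · simpa [sidePair] using h (X, 0)

variable (I F) in
/-- The projection of `T_{a(x)} A` onto the vertical vectors along the image of `Ta`. -/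
def vertProj (a : ∀ x : M, A x) (x : M) :
    TangentSpace (I.prod 𝓘(ℝ, F)) (TotalSpace.mk' F x (a x)) →L[ℝ] A x :=
  (fibrePart I (TotalSpace.mk' F x (a x))).comp
    (ContinuousLinearMap.id ℝ _ - (secTangent I F a x).comp (tproj I _))

variable (I F) in
/-- The linear section `σ(a)` at a point of `TM ⊕ A*`. -/
def sigma (a : ∀ x : M, A x) (x : M) (ν : Side I A x) :
    GTangent (I.prod 𝓘(ℝ, F)) (TotalSpace.mk' F x (a x)) :=
  (secTangent I F a x ν.1, ν.2.comp (vertProj I F a x))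

theorem genLift_eq (g : Gen I A) (ν : SideTot I F A) :
    genLift g ν = (⟨TotalSpace.mk' F ν.proj (g.1 ν.proj),
      sigma I F g.1 ν.proj ν.2 + coreLift I _ (g.2 ν.proj)⟩ : TTot I F A) := rfl

variable (I F) in
/-- The core component along the section `a` of an element of `𝕋A` over `a(x)`. -/
def corePart (a : ∀ x : M, A x) (x : M) :
    GTangent (I.prod 𝓘(ℝ, F)) (TotalSpace.mk' F x (a x)) →ₗ[ℝ] Core I A x where
  toFun p := (vertProj I F a x p.1, p.2.comp (secTangent I F a x))
  map_add' _ _ := Prod.ext (map_add _ _ _) (ContinuousLinearMap.add_comp _ _ _)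
  map_smul' _ _ := Prod.ext (map_smul _ _ _) (ContinuousLinearMap.smul_comp _ _ _)

theorem vertProj_apply (a : ∀ x : M, A x) (x : M)
    (w : TangentSpace (I.prod 𝓘(ℝ, F)) (TotalSpace.mk' F x (a x))) :
    vertProj I F a x w = fibrePart I _ (w - secTangent I F a x (tproj I _ w)) := rfl

theorem vertProj_vert (a : ∀ x : M, A x) (x : M) (e : A x) :
    vertProj I F a x (vert I (TotalSpace.mk' F x (a x)) e) = e := by
  rw [vertProj_apply, tproj_vert (TotalSpace.mk' F x (a x)) e, map_zero, sub_zero]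
  exact fibrePart_vert (TotalSpace.mk' F x (a x)) e

section Smooth

variable {a : ∀ x : M, A x} (ha : SmoothSec I F a) {x : M}
include ha

theorem vertProj_secTangent (X : TangentSpace I x) :
    vertProj I F a x (secTangent I F a x X) = 0 := by
  rw [vertProj_apply, tproj_secTangent ha, sub_self, map_zero]

theorem liesOver_sigma (ν : Side I A x) : LiesOver _ (sigma I F a x ν) ν :=
  ⟨tproj_secTangent ha x ν.1, fun e => congrArg ν.2 (vertProj_vert a x e)⟩

theorem corePart_coreLift (τ : Core I A x) : corePart I F a x (coreLift I _ τ) = τ :=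
  Prod.ext (vertProj_vert a x τ.1)
    (ContinuousLinearMap.ext fun X => congrArg τ.2 (tproj_secTangent ha x X))

/-- Both components come from `tangent_decomp`: applied to the vector itself, and to the argument of
the covector. -/
theorem LiesOver.eq_sigma_add {p : GTangent (I.prod 𝓘(ℝ, F)) (TotalSpace.mk' F x (a x))}
    {ν : Side I A x} (h : LiesOver _ p ν) :
    p = sigma I F a x ν + coreLift I _ (corePart I F a x p) := by
  refine Prod.ext ?_ (ContinuousLinearMap.ext fun w => ?_)
  · refine (tangent_decomp ha x p.1).trans ?_
    exact congrArg (· + _) (congrArg (secTangent I F a x) h.1)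
  · have h1 := congrArg p.2 (tangent_decomp ha x w)
    rw [map_add] at h1
    refine h1.trans ?_
    rw [add_comm, h.2]
    rfl

theorem coreLift_injective : Function.Injective (coreLift I (TotalSpace.mk' F x (a x))) :=
  Function.LeftInverse.injective (corePart_coreLift ha)

end Smooth

theorem exists_liesOver (v : TotalSpace F A) (ν : Side I A v.proj) : ∃ p, LiesOver v p ν := by
  obtain ⟨x, e⟩ := v
  obtain ⟨a, ha, rfl⟩ := exists_smoothSec_eq (I := I) (F := F) e
  exact ⟨_, liesOver_sigma ha ν⟩

theorem LiesOver.exists_coreLift {v : TotalSpace F A} {p : GTangent (I.prod 𝓘(ℝ, F)) v}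
    (h : LiesOver v p 0) : ∃ τ, p = coreLift I v τ := by
  obtain ⟨x, e⟩ := v
  obtain ⟨a, ha, rfl⟩ := exists_smoothSec_eq (I := I) (F := F) e
  have h0 : sigma I F a x 0 = 0 := Prod.ext (map_zero _) (ContinuousLinearMap.zero_comp _)
  have h1 := h.eq_sigma_add ha
  rw [h0, zero_add] at h1
  exact ⟨_, h1⟩

end CoreAlgebra

/-! ### The core morphism as minus the transpose of the side morphism. -/

section CoreMorphism

variable {E : Type*} [NormedAddCommGroup E] [NormedSpace ℝ E] [FiniteDimensional ℝ E]
  {H : Type*} [TopologicalSpace H] {I : ModelWithCorners ℝ E H}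
  {M : Type*} [TopologicalSpace M] [ChartedSpace H M] [IsManifold I ∞ M] [T2Space M]
  {F : Type*} [NormedAddCommGroup F] [NormedSpace ℝ F] [FiniteDimensional ℝ F]
  {A : M → Type*} [TopologicalSpace (TotalSpace F A)]
  [∀ x, AddCommGroup (A x)] [∀ x, Module ℝ (A x)] [∀ x, TopologicalSpace (A x)]
  [FiberBundle F A] [VectorBundle ℝ F A] [ContMDiffVectorBundle ∞ F A I]
  {J : ∀ v : TotalSpace F A, GTangent (I.prod 𝓘(ℝ, F)) v →L[ℝ] GTangent (I.prod 𝓘(ℝ, F)) v}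
  {j : ∀ x : M, Side I A x →L[ℝ] Side I A x} {jC : ∀ x : M, Core I A x →L[ℝ] Core I A x}

variable (F) in
/-- Smoothness of a section of `TM ⊕ A*`. -/
def SmoothSide (ν : ∀ x : M, Side I A x) : Prop :=
  SmoothField I (fun x => (ν x).1) ∧ SmoothSec I (F →L[ℝ] ℝ) (fun x => (ν x).2)

theorem sidePair_neg_left {x : M} (ν : Side I A x) (τ : Core I A x) :
    sidePair (-ν) τ = -sidePair ν τ := by
  simp [sidePair]; ring

theorem sidePair_neg_right {x : M} (ν : Side I A x) (τ : Core I A x) :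
    sidePair ν (-τ) = -sidePair ν τ := by
  simp [sidePair]; ring

theorem sidePair_smooth {ν : ∀ x : M, Side I A x} {τ : ∀ x : M, Core I A x} (hν : SmoothSide F ν)
    (hτ : SmoothCore I F τ) : ContMDiff I 𝓘(ℝ, ℝ) ∞ (fun x => sidePair (ν x) (τ x)) :=
  (SmoothSec.pairing (V := A) hν.2 hτ.1).add
    (SmoothSec.pairing (V := fun x : M => TangentSpace I x) hτ.2 hν.1)

theorem smoothSide_iff {ν : ∀ x : M, Side I A x} : SmoothSide F ν ↔
    ContMDiff I (I.prod 𝓘(ℝ, E × (F →L[ℝ] ℝ))) ∞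
      (fun x => (TotalSpace.mk' (E × (F →L[ℝ] ℝ)) x (ν x) : SideTot I F A)) :=
  (smoothSec_prod (V₁ := fun x : M => TangentSpace I x) (V₂ := fun x : M => A x →L[ℝ] ℝ)).symm

theorem smoothCore_of_sidePair {τ : ∀ x : M, Core I A x}
    (h : ∀ ν : ∀ x : M, Side I A x, SmoothSide F ν →
      ContMDiff I 𝓘(ℝ, ℝ) ∞ (fun x => sidePair (ν x) (τ x))) : SmoothCore I F τ := by
  refine ⟨smoothSec_of_dual fun β hβ => ?_,
    smoothSec_dual_of_pairing (V := fun x : M => TangentSpace I x) fun X hX => ?_⟩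
  · refine (h (fun x => (0, β x)) ⟨SmoothSec.zero (V := fun x : M => TangentSpace I x), hβ⟩).congr
      fun x => ?_
    simp [sidePair]
  · refine (h (fun x => (X x, 0)) ⟨hX, SmoothSec.zero (V := fun x : M => A x →L[ℝ] ℝ)⟩).congr
      fun x => ?_
    simp [sidePair]

section Linear

variable (hlin : IsLinearOver J j)
include hlin

theorem IsLinearOver.smoothSide {ν : ∀ x : M, Side I A x} (hν : SmoothSide F ν) :
    SmoothSide F (fun x => j x (ν x)) :=
  smoothSide_iff.2 (hlin.side_smooth.comp (smoothSide_iff.1 hν))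

variable (hsq : ∀ v p, J v (J v p) = -p)
include hsq

theorem IsLinearOver.side_sq (x : M) (ν : Side I A x) : j x (j x ν) = -ν := by
  obtain ⟨p, hp⟩ := exists_liesOver (I := I) (TotalSpace.mk' F x 0) ν
  have h1 := hlin.lies_over _ _ _ (hlin.lies_over _ _ _ hp)
  rw [hsq] at h1
  exact h1.unique hp.neg

variable (horth : ∀ v p q, gPair (J v p) (J v q) = gPair p q)
include horth

/-- The image of a core lift lies over `j 0 = 0`, so it is again a core lift. Pairing it with `J p`,
for `p` over `j ν`, and using orthogonality with `j² = -1` identifies its core element. -/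
theorem IsLinearOver.exists_core (v : TotalSpace F A) (τ : Core I A v.proj) :
    ∃ c, J v (coreLift I v τ) = coreLift I v c ∧
      ∀ ν : Side I A v.proj, sidePair ν c = -sidePair (j v.proj ν) τ := by
  have h := hlin.lies_over _ _ _ (liesOver_coreLift τ)
  rw [(j v.proj).map_zero] at h
  obtain ⟨c, hc⟩ := h.exists_coreLift
  refine ⟨c, hc, fun ν => ?_⟩
  obtain ⟨p, hp⟩ := exists_liesOver v (j v.proj ν)
  have h1 := horth v p (coreLift I v τ)
  rw [hc, (hlin.lies_over _ _ _ hp).gPair_coreLift, hp.gPair_coreLift,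
    hlin.side_sq hsq, sidePair_neg_left] at h1
  rw [← h1, neg_neg]

theorem IsLinearOver.exists_coreMorphism :
    ∃ jC : ∀ x : M, Core I A x →L[ℝ] Core I A x, IsCoreMorphism J jC := by
  let jL : ∀ x : M, Core I A x →ₗ[ℝ] Core I A x := fun x =>
    ((corePart I F (0 : ∀ x, A x) x).comp (J (TotalSpace.mk' F x 0)).toLinearMap).comp
      (coreLiftₗ I (TotalSpace.mk' F x 0))
  have key : ∀ x τ, J (TotalSpace.mk' F x 0) (coreLift I (TotalSpace.mk' F x 0) τ)
      = coreLift I (TotalSpace.mk' F x 0) (jL x τ) := fun x τ => by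
    obtain ⟨c, hc, -⟩ := hlin.exists_core hsq horth (TotalSpace.mk' F x 0) τ
    rw [hc]
    congr 1
    have h1 := corePart_coreLift (I := I) (F := F) (a := 0) SmoothSec.zero (x := x) c
    exact h1.symm.trans (congrArg (corePart I F 0 x) hc.symm)
  -- Continuity is automatic: the fibres are finite-dimensional Hausdorff topological vector spaces.
  have hT2 : ∀ x, T2Space (A x) := fun x => FiberBundle.t2Space F A x
  have hfd : ∀ x, FiniteDimensional ℝ (A x) := fun x => VectorBundle.finiteDimensional ℝ F A x
  have h1 : ∀ x, IsTopologicalAddGroup (A x) := fun x =>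
    (VectorBundle.continuousLinearEquivAt ℝ F A x).toContinuousAddEquiv.isTopologicalAddGroup
  have h2 : ∀ x, ContinuousSMul ℝ (A x) := fun x =>
    (VectorBundle.continuousLinearEquivAt ℝ F A x).continuousSMul
  have h3 : ∀ x : M, FiniteDimensional ℝ (Cotangent I x) := fun x =>
    inferInstanceAs (FiniteDimensional ℝ (E →L[ℝ] ℝ))
  exact ⟨fun x => LinearMap.toContinuousLinearMap (jL x), key⟩

omit hsq horth hlin in
theorem IsCoreMorphism.unique {jC' : ∀ x : M, Core I A x →L[ℝ] Core I A x}
    (h : IsCoreMorphism J jC) (h' : IsCoreMorphism J jC') : jC = jC' :=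
  funext fun x => ContinuousLinearMap.ext fun τ =>
    coreLift_injective (I := I) (F := F) (a := 0) SmoothSec.zero ((h x τ).symm.trans (h' x τ))

variable (hC : IsCoreMorphism J jC)
include hC

theorem IsCoreMorphism.sidePair_eq {x : M} (ν : Side I A x) (τ : Core I A x) :
    sidePair ν (jC x τ) = -sidePair (j x ν) τ := by
  obtain ⟨c, hc, h⟩ := hlin.exists_core hsq horth (TotalSpace.mk' F x 0) τ
  have : jC x τ = c :=
    coreLift_injective (I := I) (F := F) (a := 0) SmoothSec.zero ((hC x τ).symm.trans hc)
  rw [this]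
  exact h ν

/-- `IsCoreMorphism` speaks of the zero section only. The duality with `j` characterises the core
element at every `v`, and it involves only the base point, so the same `jC` serves on the whole
fibre. -/
theorem IsCoreMorphism.apply_coreLift (v : TotalSpace F A) (τ : Core I A v.proj) :
    J v (coreLift I v τ) = coreLift I v (jC v.proj τ) := by
  obtain ⟨c, hc, h⟩ := hlin.exists_core hsq horth v τ
  rw [hc]
  congr 1
  exact sidePair_core_ext (F := F) fun ν =>
    (h ν).trans (hC.sidePair_eq hlin hsq horth ν τ).symm

theorem IsCoreMorphism.sq (x : M) (τ : Core I A x) : jC x (jC x τ) = -τ := by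
  refine sidePair_core_ext (F := F) fun ν => ?_
  rw [hC.sidePair_eq hlin hsq horth, hC.sidePair_eq hlin hsq horth, hlin.side_sq hsq]
  simp [sidePair]

theorem IsCoreMorphism.smoothCore {τ : ∀ x : M, Core I A x} (hτ : SmoothCore I F τ) :
    SmoothCore I F (fun x => jC x (τ x)) := by
  refine smoothCore_of_sidePair fun ν hν => ?_
  refine (sidePair_smooth (hlin.smoothSide hν) hτ).neg.congr fun x => ?_
  exact hC.sidePair_eq hlin hsq horth _ _

theorem IsCoreMorphism.contMDiff :
    ContMDiff (I.prod 𝓘(ℝ, F × (E →L[ℝ] ℝ))) (I.prod 𝓘(ℝ, F × (E →L[ℝ] ℝ))) ∞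
    (fun p : TotalSpace (F × (E →L[ℝ] ℝ)) (A ×ᵇ (fun x : M => TangentSpace I x →L[ℝ] ℝ)) =>
      (TotalSpace.mk' (F × (E →L[ℝ] ℝ)) p.proj (jC p.proj p.2) :
        TotalSpace (F × (E →L[ℝ] ℝ)) (A ×ᵇ (fun x : M => TangentSpace I x →L[ℝ] ℝ)))) := by
  refine contMDiff_of_smoothSec (V := A ×ᵇ (fun x : M => TangentSpace I x →L[ℝ] ℝ))
    (V' := A ×ᵇ (fun x : M => TangentSpace I x →L[ℝ] ℝ)) (φ := jC) fun τ hτ => ?_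
  exact smoothSec_prod.2 (hC.smoothCore hlin hsq horth (smoothSec_prod.1 hτ))

end Linear

end CoreMorphism

/-! ### The anchor on core sections and orthogonality for the degenerate pairing. -/

section Orthogonality

variable {E : Type*} [NormedAddCommGroup E] [NormedSpace ℝ E] [FiniteDimensional ℝ E]
  {H : Type*} [TopologicalSpace H] {I : ModelWithCorners ℝ E H}
  {M : Type*} [TopologicalSpace M] [ChartedSpace H M] [IsManifold I ∞ M] [T2Space M]
  {F : Type*} [NormedAddCommGroup F] [NormedSpace ℝ F] [FiniteDimensional ℝ F]
  {A : M → Type*} [TopologicalSpace (TotalSpace F A)]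
  [∀ x, AddCommGroup (A x)] [∀ x, Module ℝ (A x)] [∀ x, TopologicalSpace (A x)]
  [FiberBundle F A] [VectorBundle ℝ F A] [ContMDiffVectorBundle ∞ F A I]
  {J : ∀ v : TotalSpace F A, GTangent (I.prod 𝓘(ℝ, F)) v →L[ℝ] GTangent (I.prod 𝓘(ℝ, F)) v}
  {j : ∀ x : M, Side I A x →L[ℝ] Side I A x} {jC : ∀ x : M, Core I A x →L[ℝ] Core I A x}
  {L : LieAlgebroid I F A}

theorem dFun_vert_of_affine {g : TotalSpace F A → ℝ}
    (hg : ContMDiff (I.prod 𝓘(ℝ, F)) 𝓘(ℝ, ℝ) ∞ g) {v : TotalSpace F A} {e : A v.proj} {c d : ℝ}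
    (h : ∀ t : ℝ, g (TotalSpace.mk' F v.proj (v.2 + t • e)) = c + t • d) :
    dFun (I.prod 𝓘(ℝ, F)) g v (vert I v e) = d :=
  (mfderiv_vert ((hg v).mdifferentiableAt (by simp)) e).trans (mfderiv_affine h)

theorem linFun_smooth {υ : ∀ x : M, Core I A x} (hυ : SmoothCore I F υ) :
    ContMDiff (sideModel E I F) 𝓘(ℝ, ℝ) ∞ (linFun (F := F) υ) := fun p => by
  have hp : ContMDiffAt (sideModel E I F) I ∞ (fun p : SideTot I F A => p.proj) p :=
    contMDiffAt_proj _
  refine ContMDiffAt.add ?_ ?_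
  · exact contMDiffAt_pairing (I := I) (V := A) (b := TotalSpace.proj)
      (α := fun p : SideTot I F A => p.2.2) (v := fun p : SideTot I F A => (υ p.proj).1)
      (contMDiff_prodBundle_snd (V₁ := fun x : M => TangentSpace I x)
        (V₂ := fun x : M => A x →L[ℝ] ℝ) p)
      (ContMDiffAt.comp p (hυ.1 p.proj) hp)
  · exact contMDiffAt_pairing (I := I) (V := fun x : M => TangentSpace I x) (b := TotalSpace.proj)
      (α := fun p : SideTot I F A => (υ p.proj).2) (v := fun p : SideTot I F A => p.2.1)
      (ContMDiffAt.comp p (hυ.2 p.proj) hp)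
      (contMDiff_prodBundle_fst (V₁ := fun x : M => TangentSpace I x)
        (V₂ := fun x : M => A x →L[ℝ] ℝ) p)

theorem SmoothCore.add {τ υ : ∀ x : M, Core I A x} (hτ : SmoothCore I F τ)
    (hυ : SmoothCore I F υ) : SmoothCore I F (τ + υ) :=
  ⟨SmoothSec.add hτ.1 hυ.1, SmoothSec.add (V := fun x : M => TangentSpace I x →L[ℝ] ℝ) hτ.2 hυ.2⟩

theorem SmoothCore.neg {τ : ∀ x : M, Core I A x} (hτ : SmoothCore I F τ) :
    SmoothCore I F (-τ) :=
  ⟨SmoothSec.neg hτ.1, SmoothSec.neg (V := fun x : M => TangentSpace I x →L[ℝ] ℝ) hτ.2⟩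

theorem SmoothCore.zero : SmoothCore I F (0 : ∀ x : M, Core I A x) :=
  ⟨SmoothSec.zero, SmoothSec.zero (V := fun x : M => TangentSpace I x →L[ℝ] ℝ)⟩

theorem exists_smoothCore_eq {x : M} (c : Core I A x) :
    ∃ τ : ∀ x : M, Core I A x, SmoothCore I F τ ∧ τ x = c := by
  obtain ⟨a, ha, h1⟩ := exists_smoothSec_eq (I := I) (F := F) c.1
  obtain ⟨θ, hθ, h2⟩ := exists_smoothSec_eq (I := I) (F := E →L[ℝ] ℝ)
    (V := fun x : M => TangentSpace I x →L[ℝ] ℝ) c.2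
  exact ⟨fun x => (a x, θ x), ⟨ha, hθ⟩, Prod.ext h1 h2⟩

theorem exists_smoothSide_eq {x : M} (c : Side I A x) :
    ∃ ν : ∀ x : M, Side I A x, SmoothSide F ν ∧ ν x = c := by
  obtain ⟨X, hX, h1⟩ := exists_smoothSec_eq (I := I) (F := E)
    (V := fun x : M => TangentSpace I x) c.1
  obtain ⟨β, hβ, h2⟩ := exists_smoothSec_eq (I := I) (F := F →L[ℝ] ℝ)
    (V := fun x : M => A x →L[ℝ] ℝ) c.2
  exact ⟨fun x => (X x, β x), ⟨hX, hβ⟩, Prod.ext h1 h2⟩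

theorem LieAlgebroid.bracket_zero_right {b : ∀ x : M, A x} (hb : SmoothSec I F b) :
    L.bracket b 0 = 0 := by
  have := L.bracket_smul 0 b 0 hb SmoothSec.zero
  rwa [zero_smul, zero_smul] at this

theorem LieAlgebroid.bracket_zero_left {b : ∀ x : M, A x} (hb : SmoothSec I F b) :
    L.bracket 0 b = 0 := by
  rw [L.bracket_skew 0 b SmoothSec.zero hb, L.bracket_zero_right hb, neg_zero]

omit [T2Space M] in
theorem dFun_const (c : ℝ) (x : M) : dFun I (fun _ => c) x = 0 := mfderiv_const

theorem lieDerivForm_zero (θ : ∀ x : M, Cotangent I x) (x : M) :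
    lieDerivForm I (fun y => (0 : TangentSpace I y)) θ x = 0 := by
  simp [lieDerivForm, dFun_const]

theorem lieDerivCore_zero {υ : ∀ x : M, Core I A x} (hυ : SmoothCore I F υ) :
    lieDerivCore L 0 υ = 0 := by
  funext x
  refine Prod.ext (congrFun (L.bracket_zero_left hυ.1) x) ?_
  refine Eq.trans ?_ (lieDerivForm_zero (fun y => (υ y).2) x)
  simp [lieDerivCore]

variable (L) in
/-- The anchor `(ρ, ρ^t)` of the degenerate Courant algebroid, with values in `TM ⊕ A*`. -/
def coreAnchor {x : M} (τ : Core I A x) : Side I A x := (L.anchor x τ.1, τ.2.comp (L.anchor x))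

theorem sidePair_coreAnchor {x : M} (τ υ : Core I A x) :
    sidePair (coreAnchor L τ) υ = degPairing L x τ υ := by
  rw [sidePair, degPairing, add_comm]; rfl

/-- The vertical lift of `(ρ, ρ^t) τ` qualifies: along the corresponding fibre line `linFun υ` is
affine with slope `⟨τ, υ⟩_d`. -/
theorem isAnchorAt_core {τ : ∀ x : M, Core I A x} (ν : SideTot I F A) :
    ∃ w, IsAnchorAt L (0, τ) ν w := by
  refine ⟨vert I (A := (fun x : M => TangentSpace I x) ×ᵇ (fun x : M => A x →L[ℝ] ℝ)) ν
    (coreAnchor L (τ ν.proj)), ?_, fun υ hυ => ?_⟩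
  · exact (tproj_vert ν _).trans (map_zero _).symm
  · rw [lieDerivCore_zero hυ]
    refine (dFun_vert_of_affine (c := linFun υ ν) (linFun_smooth hυ)
      (d := sidePair (coreAnchor L (τ ν.proj)) (υ ν.proj)) fun t => ?_).trans ?_
    · simp [linFun, sidePair]
      ring
    · rw [sidePair_coreAnchor]
      simp [linFun]

/-- `genAnchor` is a chosen vector. Existence makes the choice satisfy `IsAnchorAt`, which fixes its
action on linear functions; nothing more about it is used. -/
theorem genAnchor_core {τ υ : ∀ x : M, Core I A x} (hυ : SmoothCore I F υ) (ν : SideTot I F A) :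
    dFun (sideModel E I F) (linFun υ) ν (genAnchor L (0, τ) ν)
      = degPairing L ν.proj (τ ν.proj) (υ ν.proj) := by
  have h := (Classical.epsilon_spec (isAnchorAt_core (L := L) (τ := τ) ν)).2 υ hυ
  rw [lieDerivCore_zero hυ] at h
  refine h.trans ?_
  simp [linFun]

/-- Multiplication by `0` is the projection followed by the zero section, written here as `0 • a`.
-/
theorem mfderiv_zero_smul_section {a : ∀ x : M, A x} (x : M)
    (e : A x) (w : TangentSpace (I.prod 𝓘(ℝ, F)) (TotalSpace.mk' F x e)) :
    mfderiv (I.prod 𝓘(ℝ, F)) (I.prod 𝓘(ℝ, F))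
      (fun z : TotalSpace F A => TotalSpace.mk' F z.proj ((0 : ℝ) • z.2)) (TotalSpace.mk' F x e) w
    = secTangent I F ((0 : ℝ) • a) x (tproj I _ w) := by
  have h0 : SmoothSec I F ((0 : ℝ) • a) := by
    rw [zero_smul]; exact SmoothSec.zero
  have hf : (fun z : TotalSpace F A => TotalSpace.mk' F z.proj ((0 : ℝ) • z.2))
      = (fun y => TotalSpace.mk' F y (((0 : ℝ) • a) y)) ∘ TotalSpace.proj := by
    funext z
    simp
  have h1 := mfderiv_comp_apply (TotalSpace.mk' F x e) (h0.mdifferentiableAt x)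
    ((contMDiff_proj (IB := I) A (TotalSpace.mk' F x e)).mdifferentiableAt (n := ∞) (by simp)) w
  rw [← hf] at h1
  exact h1

/-- `σ(0)(ν)` is the zero element over `ν` of the bundle `𝕋A → TM ⊕ A*`, that is, its own multiple
by `0`, and `J` respects scalar multiplication over `j`. -/
theorem IsLinearOver.apply_sigma_zero (hlin : IsLinearOver J j) (x : M) (ν : Side I A x) :
    J (TotalSpace.mk' F x 0) (sigma I F (0 : ∀ x, A x) x ν) = sigma I F (0 : ∀ x, A x) x (j x ν) := by
  -- `IsScaled` puts the result over `0 • 0`; stating the claim for a section `b` equal to `0 • 0`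
  -- avoids transport between fibres.
  suffices h : ∀ b : ∀ x, A x, b = (0 : ℝ) • (0 : ∀ x, A x) →
      J (TotalSpace.mk' F x (b x)) (sigma I F b x ν) = sigma I F b x (j x ν) from
    h 0 (smul_zero 0).symm
  rintro b rfl
  have h0 : SmoothSec I F (0 : ∀ x, A x) := SmoothSec.zero
  have h0' : SmoothSec I F ((0 : ℝ) • (0 : ∀ x, A x)) := by rw [zero_smul]; exact SmoothSec.zero
  have hs : IsScaled 0 x ((0 : ∀ x, A x) x) (sigma I F 0 x ν)
      (sigma I F ((0 : ℝ) • (0 : ∀ x, A x)) x ν) := by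
    refine ⟨?_, fun w => ?_, fun e => ?_⟩
    · refine (mfderiv_zero_smul_section (a := 0) x _ _).trans ?_
      exact congrArg (secTangent I F ((0 : ℝ) • (0 : ∀ x, A x)) x) (tproj_secTangent h0 x ν.1)
    · rw [zero_mul]
      refine (congrArg _ (mfderiv_zero_smul_section (a := 0) x _ w)).trans ?_
      exact (congrArg ν.2 (vertProj_secTangent h0' _)).trans (map_zero _)
    · exact ((liesOver_sigma h0' ν).2 e).trans ((liesOver_sigma h0 ν).2 e).symm
  obtain ⟨h1, h2, -⟩ := hlin.smul _ _ _ _ _ hs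
  have hover := hlin.lies_over _ _ _ (liesOver_sigma h0' ν)
  -- By `h1` the vector part of the image is tangent to the zero section, and by `h2` its covector
  -- part kills such tangents; hence there is no core component.
  have hz : corePart I F ((0 : ℝ) • (0 : ∀ x, A x)) x (J _ (sigma I F _ x ν)) = 0 := by
    refine Prod.ext ?_ (ContinuousLinearMap.ext fun X => ?_)
    · refine (congrArg (vertProj I F _ x) (h1.symm.trans
        (mfderiv_zero_smul_section (a := 0) x _ _))).trans ?_
      exact vertProj_secTangent h0' _
    · have h3 := h2 (secTangent I F 0 x X)
      rw [zero_mul, mfderiv_zero_smul_section (a := 0) x _ _, tproj_secTangent h0] at h3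
      exact h3
  have h4 := hover.eq_sigma_add h0'
  rw [hz, coreLift_zero, add_zero] at h4
  exact h4

variable (hlin : IsLinearOver J j) (hsq : ∀ v p, J v (J v p) = -p)
  (horth : ∀ v p q, gPair (J v p) (J v q) = gPair p q) (hC : IsCoreMorphism J jC)
include hlin hsq horth hC

theorem IsCoreMorphism.ttMap_core {τ : ∀ x : M, Core I A x} (ν : SideTot I F A) :
    ttMap J (genLift (0, τ) ν) = genLift (0, fun x => jC x (τ x)) (sideMap F j ν) := by
  refine congrArg (fun p => (⟨TotalSpace.mk' F ν.proj 0, p⟩ : TTot I F A)) ?_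
  refine (map_add (J (TotalSpace.mk' F ν.proj 0)) _ _).trans ?_
  exact congrArg₂ (· + ·) (hlin.apply_sigma_zero ν.proj ν.2)
    (hC.apply_coreLift hlin hsq horth (TotalSpace.mk' F ν.proj 0) (τ ν.proj))

variable (hmor : IsAlgebroidMorphism L J j)
include hmor

/-- Differentiate `ℓ_υ ∘ j = ℓ_{-jC υ}` along the anchor of `τ†`. By compatibility with `Tj`, the
left side is the derivative of `ℓ_υ` along the anchor of `(jC τ)†`. -/
theorem IsCoreMorphism.degPairing_left {x : M} (τ υ : Core I A x) :
    degPairing L x (jC x τ) υ = -degPairing L x τ (jC x υ) := by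
  obtain ⟨τ, hτ, rfl⟩ := exists_smoothCore_eq (F := F) τ
  obtain ⟨υ, hυ, rfl⟩ := exists_smoothCore_eq (F := F) υ
  let ν : SideTot I F A := ⟨x, 0⟩
  have hjτ := hC.smoothCore hlin hsq horth hτ
  have hjυ := hC.smoothCore hlin hsq horth hυ
  have h := hmor.anchor (0, τ) (0, fun x => jC x (τ x)) ν ⟨SmoothSec.zero, hτ⟩
    ⟨SmoothSec.zero, hjτ⟩ (hC.ttMap_core hlin hsq horth ν)
  have h1 := genAnchor_core (L := L) (τ := fun x => jC x (τ x)) hυ (sideMap F j ν)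
  have h2 := genAnchor_core (L := L) (τ := τ) hjυ.neg ν
  rw [← h] at h1
  have h3 : linFun υ ∘ sideMap F j = linFun (F := F) (-fun x => jC x (υ x)) := by
    funext μ
    change sidePair (j μ.proj μ.2) (υ μ.proj) = sidePair μ.2 (-(jC μ.proj (υ μ.proj)))
    rw [sidePair_neg_right, hC.sidePair_eq hlin hsq horth, neg_neg]
  have h4 := mfderiv_comp_apply ν ((linFun_smooth hυ _).mdifferentiableAt (by simp))
    ((hlin.side_smooth ν).mdifferentiableAt (by simp)) (genAnchor L (0, τ) ν)
  rw [h3] at h4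
  have h5 : degPairing L x (τ x) ((-fun x => jC x (υ x)) x)
      = -degPairing L x (τ x) (jC x (υ x)) := by
    simp [degPairing]; ring
  exact (h1.symm.trans (h4.symm.trans h2)).trans h5

theorem IsCoreMorphism.degPairing_eq {x : M} (τ υ : Core I A x) :
    degPairing L x (jC x τ) (jC x υ) = degPairing L x τ υ := by
  rw [hC.degPairing_left hlin hsq horth hmor, hC.sq hlin hsq horth]
  simp [degPairing]
  ring

end Orthogonality

/-! ### Smoothness tested on finitely many separating covectors. -/

section Separating

variable {E : Type*} [NormedAddCommGroup E] [NormedSpace ℝ E]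
  {H : Type*} [TopologicalSpace H] {I : ModelWithCorners ℝ E H}
  {N : Type*} [TopologicalSpace N] [ChartedSpace H N]
  {F : Type*} [NormedAddCommGroup F] [NormedSpace ℝ F] [FiniteDimensional ℝ F]
  {V : N → Type*} [TopologicalSpace (TotalSpace F V)]
  [∀ x, AddCommGroup (V x)] [∀ x, Module ℝ (V x)] [∀ x, TopologicalSpace (V x)]
  [FiberBundle F V] [VectorBundle ℝ F V]

/-- A section is smooth if, near every point, its pairings with finitely many smooth sections of
the dual which separate the fibre at that point are smooth. -/
theorem SmoothSec.of_separating {W : ∀ x, V x}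
    (h : ∀ x₀, ∃ (n : ℕ) (θ : Fin n → ∀ x, V x →L[ℝ] ℝ), (∀ i, SmoothSec I (F →L[ℝ] ℝ) (θ i)) ∧
      (∀ i, ContMDiff I 𝓘(ℝ, ℝ) ∞ (fun x => θ i x (W x))) ∧
      ∀ v : V x₀, (∀ i, θ i x₀ v = 0) → v = 0) : SmoothSec I F W := by
  intro x₀
  obtain ⟨n, θ, hθ, hW, hinj⟩ := h x₀
  refine contMDiffAt_totalSpace.2 ⟨contMDiffAt_id, ?_⟩
  let e := trivializationAt F V x₀
  have hx₀ : x₀ ∈ e.baseSet := FiberBundle.mem_baseSet_trivializationAt' x₀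
  let T : Fin n → N → (F →L[ℝ] ℝ) := fun i x =>
    ContinuousLinearMap.inCoordinates F V ℝ (Bundle.Trivial N ℝ) x₀ x x₀ x (θ i x)
  have hT : ∀ i, ContMDiffAt I 𝓘(ℝ, F →L[ℝ] ℝ) ∞ (T i) x₀ := fun i =>
    ((contMDiffAt_hom_bundle (F₂ := ℝ) (E₂ := Bundle.Trivial N ℝ) _).1 (hθ i x₀)).2
  have hTe : ∀ i, ∀ x ∈ e.baseSet, ∀ c : F, T i x c = θ i x (e.symm x c) := fun i x hx c => by
    simp [T, ContinuousLinearMap.inCoordinates, e, Trivialization.symmL_apply _ hx]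
  have hTv : ∀ i, ∀ x ∈ e.baseSet, ∀ v : V x, T i x (e ⟨x, v⟩).2 = θ i x v := fun i x hx v => by
    rw [hTe i x hx, e.symm_apply_apply_mk hx]
  let L₀ : F →ₗ[ℝ] (Fin n → ℝ) := LinearMap.pi fun i => (T i x₀).toLinearMap
  have hL₀ : LinearMap.ker L₀ = ⊥ := by
    refine LinearMap.ker_eq_bot'.2 fun c hc => ?_
    have h1 : e.symm x₀ c = 0 := hinj _ fun i => by
      rw [← hTe i x₀ hx₀]; exact congrFun hc i
    have h2 := e.apply_mk_symm hx₀ c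
    rw [h1] at h2
    have h3 : (e ⟨x₀, 0⟩).2 = 0 := (e.linear ℝ hx₀).map_zero
    rw [h2] at h3
    exact h3
  obtain ⟨R, hR⟩ := L₀.exists_leftInverse_of_injective hL₀
  -- The `r i` are the images of the standard basis under a left inverse of evaluation at `x₀`.
  -- Hence `G x₀ = 1`, and near `x₀` the coordinate of `W` is `G⁻¹` applied to `∑ θ_i(W) r_i`.
  let r : Fin n → F := fun i => R fun k => if i = k then 1 else 0
  let G : N → (F →L[ℝ] F) := fun x => ∑ i, (T i x).smulRight (r i)
  have hG0 : G x₀ = 1 := by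
    ext c
    have h1 := LinearMap.congr_fun hR c
    simp only [LinearMap.comp_apply, LinearMap.id_apply] at h1
    rw [LinearMap.pi_apply_eq_sum_univ R] at h1
    simpa [G, L₀, r] using h1
  have hG : ContMDiffAt I 𝓘(ℝ, F →L[ℝ] F) ∞ G x₀ := by
    refine ContMDiffAt.sum fun i _ => ?_
    exact ((ContinuousLinearMap.smulRightL ℝ F F).flip (r i)).contDiff.contMDiff.contMDiffAt.comp
      x₀ (hT i)
  have hinv : ContMDiffAt I 𝓘(ℝ, F →L[ℝ] F) ∞ (fun x => Ring.inverse (G x)) x₀ := by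
    have h1 : ContDiffAt ℝ ∞ Ring.inverse (G x₀) := by
      rw [hG0]; exact contDiffAt_ringInverse ℝ 1
    exact h1.contMDiffAt.comp x₀ hG
  have hsum : ContMDiffAt I 𝓘(ℝ, F) ∞ (fun x => ∑ i, θ i x (W x) • r i) x₀ :=
    ContMDiffAt.sum fun i _ => (hW i x₀).smul contMDiffAt_const
  have hunit : ∀ᶠ x in 𝓝 x₀, IsUnit (G x) :=
    hG.continuousAt.eventually (Units.isOpen.mem_nhds (by rw [hG0]; exact isUnit_one))
  refine (hinv.clm_apply hsum).congr_of_eventuallyEq ?_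
  filter_upwards [hunit, e.open_baseSet.mem_nhds hx₀] with x hu hx
  have h1 : ∑ i, θ i x (W x) • r i = G x (e ⟨x, W x⟩).2 := by
    simp [G, hTv _ x hx]
  rw [h1]
  exact (congrArg (fun L : F →L[ℝ] F => L (e ⟨x, W x⟩).2) (Ring.inverse_mul_cancel _ hu)).symm

end Separating

/-! ### Linearity of the differential. -/

section Differentials

variable {E : Type*} [NormedAddCommGroup E] [NormedSpace ℝ E]
  {H : Type*} [TopologicalSpace H] {I : ModelWithCorners ℝ E H}
  {N : Type*} [TopologicalSpace N] [ChartedSpace H N]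

theorem dFun_add {f g : N → ℝ} {x : N} (hf : MDifferentiableAt I 𝓘(ℝ, ℝ) f x)
    (hg : MDifferentiableAt I 𝓘(ℝ, ℝ) g x) (X : TangentSpace I x) :
    dFun I (fun y => f y + g y) x X = dFun I f x X + dFun I g x X :=
  congrArg (fun L => L X) (mfderiv_add hf hg)

theorem dFun_const_mul {f : N → ℝ} {x : N} (hf : MDifferentiableAt I 𝓘(ℝ, ℝ) f x) (c : ℝ)
    (X : TangentSpace I x) : dFun I (fun y => c * f y) x X = c * dFun I f x X :=
  congrArg (fun L => L X) (const_smul_mfderiv hf c)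

theorem dFun_sum_const_mul {ι : Type*} {S : Finset ι} {c : ι → ℝ} {f : ι → N → ℝ}
    (hf : ∀ i, ContMDiff I 𝓘(ℝ, ℝ) ∞ (f i)) (x : N) (X : TangentSpace I x) :
    dFun I (fun y => ∑ i ∈ S, c i * f i y) x X = ∑ i ∈ S, c i * dFun I (f i) x X := by
  classical
  induction S using Finset.induction_on with
  | empty =>
    simp only [Finset.sum_empty]
    exact congrArg (fun L : Cotangent I x => L X) mfderiv_const
  | insert i S hi ih =>
    simp only [Finset.sum_insert hi]
    have h1 : ∀ i, ContMDiff I 𝓘(ℝ, ℝ) ∞ (fun y => c i * f i y) := fun i =>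
      contMDiff_const.mul (hf i)
    rw [dFun_add ((h1 i x).mdifferentiableAt (by simp))
      (((contMDiff_finsetSum fun i _ => h1 i) x).mdifferentiableAt (n := ∞) (by simp)),
      dFun_const_mul ((hf i x).mdifferentiableAt (by simp)), ih]

end Differentials

/-! ### Smooth fields and forms on `A`; linear lifts of vector fields. -/

section Geometry

variable {E : Type*} [NormedAddCommGroup E] [NormedSpace ℝ E] [FiniteDimensional ℝ E]
  {H : Type*} [TopologicalSpace H] {I : ModelWithCorners ℝ E H}
  {M : Type*} [TopologicalSpace M] [ChartedSpace H M] [IsManifold I ∞ M] [T2Space M]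
  {F : Type*} [NormedAddCommGroup F] [NormedSpace ℝ F] [FiniteDimensional ℝ F]
  {A : M → Type*} [TopologicalSpace (TotalSpace F A)]
  [∀ x, AddCommGroup (A x)] [∀ x, Module ℝ (A x)] [∀ x, TopologicalSpace (A x)]
  [FiberBundle F A] [VectorBundle ℝ F A] [ContMDiffVectorBundle ∞ F A I]

-- Points over different base points are separated in `M`, points of one fibre in a trivialisation.
-- This is what allows cut-offs on `A` itself, used in `pullForm_smooth`.
variable (F A) in
omit [IsManifold I ∞ M] [ContMDiffVectorBundle ∞ F A I] in
theorem t2Space_totalSpace : T2Space (TotalSpace F A) := by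
  refine ⟨fun p q hpq => ?_⟩
  by_cases h : p.proj = q.proj
  · let e := trivializationAt F A p.proj
    have hp : p ∈ e.source := e.mem_source.2 (FiberBundle.mem_baseSet_trivializationAt' p.proj)
    have hq : q ∈ e.source := e.mem_source.2 (h ▸ FiberBundle.mem_baseSet_trivializationAt' p.proj)
    have hne : (e p).2 ≠ (e q).2 := fun h2 => hpq (e.injOn hp hq
      (Prod.ext ((e.coe_fst hp).trans (h.trans (e.coe_fst hq).symm)) h2))
    obtain ⟨u, v, hu, hv, hpu, hqv, huv⟩ := t2_separation hne
    have hc : ContinuousOn (fun u => (e u).2) e.source := 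
      continuous_snd.comp_continuousOn e.continuousOn
    exact ⟨_, _, hc.isOpen_inter_preimage e.open_source hu,
      hc.isOpen_inter_preimage e.open_source hv,
      ⟨hp, hpu⟩, ⟨hq, hqv⟩, (huv.preimage _).mono inter_subset_right inter_subset_right⟩
  · obtain ⟨u, v, hu, hv, hpu, hqv, huv⟩ := t2_separation h
    have hc := FiberBundle.continuous_proj F A
    exact ⟨_, _, hu.preimage hc, hv.preimage hc, hpu, hqv, huv.preimage _⟩

/-- A vector field on `A` is smooth if it maps basic and fibrewise linear functions to smooth
functions. -/
theorem smoothField_totalSpace {W : ∀ v : TotalSpace F A, TangentSpace (I.prod 𝓘(ℝ, F)) v}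
    (h1 : ∀ f : M → ℝ, ContMDiff I 𝓘(ℝ, ℝ) ∞ f → ContMDiff (I.prod 𝓘(ℝ, F)) 𝓘(ℝ, ℝ) ∞
      (fun v => dFun I f v.proj (tproj I v (W v))))
    (h2 : ∀ β : ∀ x : M, A x →L[ℝ] ℝ, SmoothSec I (F →L[ℝ] ℝ) β →
      ContMDiff (I.prod 𝓘(ℝ, F)) 𝓘(ℝ, ℝ) ∞
        (fun v => dFun (I.prod 𝓘(ℝ, F)) (fibLin F β) v (W v))) :
    SmoothField (I.prod 𝓘(ℝ, F)) W := by
  refine SmoothSec.of_separating fun v₀ => ?_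
  obtain ⟨m, s, α, -, hα, hfr⟩ := exists_smooth_frame I F A v₀.proj
  let b := Module.finBasis ℝ E
  let φ : Fin (Module.finrank ℝ E) → Cotangent I v₀.proj := fun i =>
    (b.coord i).toContinuousLinearMap
  choose f hf hfφ using fun i => exists_dFun_eq (I := I) v₀.proj (φ i)
  have hfq : ∀ i, ContMDiff (I.prod 𝓘(ℝ, F)) 𝓘(ℝ, ℝ) ∞ (fun v : TotalSpace F A => f i v.proj) :=
    fun i => (hf i).comp (contMDiff_proj A)
  -- The test covectors are differentials of basic functions whose differentials at the base point
  -- form a basis, and of the linear functions of a dual frame. The former force a vector to be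
  -- vertical, the latter then force it to vanish.
  refine ⟨_, Fin.append (fun i => dFun (I.prod 𝓘(ℝ, F)) (fun v : TotalSpace F A => f i v.proj))
    (fun i => dFun (I.prod 𝓘(ℝ, F)) (fibLin F (α i))), fun i => ?_, fun i => ?_, fun w hw => ?_⟩
  · refine Fin.addCases (fun i => ?_) (fun i => ?_) i
    · rw [Fin.append_left]
      exact dFun_smooth (hfq i)
    · rw [Fin.append_right]
      exact dFun_smooth (fibLin_smooth (hα i))
  · refine Fin.addCases (fun i => ?_) (fun i => ?_) i
    · rw [Fin.append_left]
      exact (h1 _ (hf i)).congr fun v => dFun_comp_proj (hf i) v (W v)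
    · rw [Fin.append_right]
      exact h2 _ (hα i)
  · have hw1 : tproj I v₀ w = 0 := by
      refine b.ext_elem fun i => ?_
      have := hw (Fin.castAdd _ i)
      rw [Fin.append_left, dFun_comp_proj (hf i), hfφ] at this
      exact this.trans (map_zero (b.coord i)).symm
    refine tangent_eq_zero hw1 ?_
    rw [hfr.self_of_nhds (fibrePart I v₀ w)]
    refine Finset.sum_eq_zero fun i _ => ?_
    have := hw (Fin.natAdd _ i)
    rw [Fin.append_right, ← vert_fibrePart hw1, dFun_fibLin_vert (hα i)] at this
    rw [this, zero_smul]

theorem vertLift_smooth {a : ∀ x : M, A x} (ha : SmoothSec I F a) :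
    SmoothField (I.prod 𝓘(ℝ, F)) (fun v : TotalSpace F A => vert I v (a v.proj)) := by
  refine smoothField_totalSpace (fun f _ => ?_) fun β hβ => ?_
  · refine (contMDiff_const (c := (0 : ℝ))).congr fun v => ?_
    rw [tproj_vert, map_zero]
  · exact ((SmoothSec.pairing hβ ha).comp (contMDiff_proj A)).congr fun v =>
      dFun_fibLin_vert hβ v (a v.proj)

variable (F A) in
/-- The pullback of a one-form to `A`. -/
def pullForm (θ : ∀ x : M, Cotangent I x) (v : TotalSpace F A) : Cotangent (I.prod 𝓘(ℝ, F)) v :=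
  (θ v.proj).comp (tproj I v)

theorem contMDiff_tproj {W : ∀ v : TotalSpace F A, TangentSpace (I.prod 𝓘(ℝ, F)) v}
    (hW : SmoothField (I.prod 𝓘(ℝ, F)) W) :
    ContMDiff (I.prod 𝓘(ℝ, F)) (I.prod 𝓘(ℝ, E)) ∞
      (fun v : TotalSpace F A => (TotalSpace.mk' E v.proj (tproj I v (W v)) : TangentBundle I M)) :=
  ((contMDiff_proj (IB := I) A).contMDiff_tangentMap (n := ∞) (m := ∞) (by simp)).comp hW

theorem pullForm_smooth {θ : ∀ x : M, Cotangent I x} (hθ : SmoothForm I θ) :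
    SmoothForm (I.prod 𝓘(ℝ, F)) (pullForm F A θ) := by
  have := t2Space_totalSpace F A
  refine smoothSec_dual_of_pairing (V := fun v : TotalSpace F A => TangentSpace (I.prod 𝓘(ℝ, F)) v)
    fun W hW v => ?_
  exact contMDiffAt_pairing (I := I) (V := fun x : M => TangentSpace I x) (b := TotalSpace.proj)
    (α := fun v : TotalSpace F A => θ v.proj) (v := fun v : TotalSpace F A => tproj I v (W v))
    (ContMDiffAt.comp v (hθ v.proj) (contMDiffAt_proj A)) (contMDiff_tproj hW v)

variable (F) in
/-- Fibrewise multiplication by `r`. -/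
abbrev fibreMul (r : ℝ) (z : TotalSpace F A) : TotalSpace F A := TotalSpace.mk' F z.proj (r • z.2)

theorem contMDiff_fibreMul (r : ℝ) :
    ContMDiff (I.prod 𝓘(ℝ, F)) (I.prod 𝓘(ℝ, F)) ∞ (fibreMul F (A := A) r) := by
  intro v
  have hp : ContMDiffAt (I.prod 𝓘(ℝ, F)) I ∞ (TotalSpace.proj : TotalSpace F A → M) v :=
    contMDiffAt_proj A
  refine contMDiffAt_totalSpace.2 ⟨hp, ?_⟩
  have hr : ContMDiffAt (I.prod 𝓘(ℝ, F)) 𝓘(ℝ, ℝ) ∞ (fun _ : TotalSpace F A => r) v :=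
    contMDiffAt_const
  refine (hr.smul (contMDiffAt_fibreCoord v)).congr_of_eventuallyEq ?_
  filter_upwards [hp.continuousAt.eventually ((trivializationAt F A v.proj).open_baseSet.mem_nhds
    (FiberBundle.mem_baseSet_trivializationAt' v.proj))] with z hz
  exact ((trivializationAt F A v.proj).linear ℝ hz).map_smul r z.2

theorem tproj_mfderiv_fibreMul (r : ℝ) (v : TotalSpace F A) (w : TangentSpace (I.prod 𝓘(ℝ, F)) v) :
    tproj I (fibreMul F r v) (mfderiv (I.prod 𝓘(ℝ, F)) (I.prod 𝓘(ℝ, F)) (fibreMul F r) v w)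
      = tproj I v w :=
  (mfderiv_comp_apply v (g := fun u : TotalSpace F A => u.proj)
    ((contMDiff_proj (IB := I) A _).mdifferentiableAt (n := ∞) (by simp))
    ((contMDiff_fibreMul r v).mdifferentiableAt (by simp)) w).symm

theorem dFun_fibLin_mfderiv_fibreMul {β : ∀ x : M, A x →L[ℝ] ℝ} (hβ : SmoothSec I (F →L[ℝ] ℝ) β)
    (r : ℝ) (v : TotalSpace F A) (w : TangentSpace (I.prod 𝓘(ℝ, F)) v) :
    dFun (I.prod 𝓘(ℝ, F)) (fibLin F β) (fibreMul F r v)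
        (mfderiv (I.prod 𝓘(ℝ, F)) (I.prod 𝓘(ℝ, F)) (fibreMul F r) v w)
      = r * dFun (I.prod 𝓘(ℝ, F)) (fibLin F β) v w := by
  have h := mfderiv_comp_apply v (g := fibLin F β) ((fibLin_smooth hβ _).mdifferentiableAt (by simp))
    ((contMDiff_fibreMul (I := I) r v).mdifferentiableAt (by simp)) w
  have h1 : fibLin F β ∘ fibreMul F r = fun v => r * fibLin F β v := by
    funext v
    simp [fibLin]
  rw [h1] at h
  exact h.symm.trans (dFun_const_mul ((fibLin_smooth hβ v).mdifferentiableAt (by simp)) r w)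

/-- The equation `v.2 = s v.proj` is a hypothesis because in `exists_linearLift` the section is
itself built from `v`. -/
theorem exists_tangent_along {s : ∀ x : M, A x} (hs : SmoothSec I F s) {v : TotalSpace F A}
    (hv : v.2 = s v.proj) (X : TangentSpace I v.proj) :
    ∃ w : TangentSpace (I.prod 𝓘(ℝ, F)) v, tproj I v w = X ∧
      ∀ β : ∀ x : M, A x →L[ℝ] ℝ, SmoothSec I (F →L[ℝ] ℝ) β →
        dFun (I.prod 𝓘(ℝ, F)) (fibLin F β) v w = dFun I (fun y => β y (s y)) v.proj X := by
  obtain ⟨x, e⟩ := v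
  obtain rfl : e = s x := hv
  exact ⟨secTangent I F s x X, tproj_secTangent hs x X, fun β hβ =>
    dFun_secTangent (fibLin_smooth hβ) hs x X⟩

/-- Near every point, a vector field on `M` lifts to a linear vector field on `A`. -/
theorem exists_linearLift {X : ∀ x : M, TangentSpace I x} (hX : SmoothField I X) (x₀ : M) :
    ∃ (X' : ∀ x : M, TangentSpace I x) (W : ∀ v : TotalSpace F A, TangentSpace (I.prod 𝓘(ℝ, F)) v),
      SmoothField I X' ∧ (∀ᶠ y in 𝓝 x₀, X' y = X y) ∧ SmoothField (I.prod 𝓘(ℝ, F)) W ∧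
      (∀ v, tproj I v (W v) = X' v.proj) ∧
      ∀ r v, mfderiv (I.prod 𝓘(ℝ, F)) (I.prod 𝓘(ℝ, F)) (fibreMul F r) v (W v)
        = W (fibreMul F r v) := by
  obtain ⟨n, s, α, hs, hα, hfr⟩ := exists_smooth_frame I F A x₀
  obtain ⟨ψ, hψ, hsupp, hψ1⟩ := exists_bump (I := I) hfr
  -- Horizontal lift for the flat connection of the frame, damped by `ψ`: the tangent vector of the
  -- section through `v` with constant frame coefficients. Its action on fibrewise linear functions
  -- is linear in `v`, whence smoothness and homogeneity. Where `ψ = 0` the zero vector is taken.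
  have hex : ∀ v : TotalSpace F A, ∃ w : TangentSpace (I.prod 𝓘(ℝ, F)) v,
      tproj I v w = ψ v.proj • X v.proj ∧
      ∀ β : ∀ x : M, A x →L[ℝ] ℝ, SmoothSec I (F →L[ℝ] ℝ) β →
        dFun (I.prod 𝓘(ℝ, F)) (fibLin F β) v w
          = ∑ i, (ψ v.proj * dFun I (fun y => β y (s i y)) v.proj (X v.proj)) * fibLin F (α i) v := by
    intro v
    by_cases hv : ψ v.proj = 0
    · exact ⟨0, by simp [hv], fun β hβ => by simp [hv]⟩
    · have hmem := hsupp (subset_tsupport ψ hv) v.2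
      have hsv : SmoothSec I F (fun x => ∑ i, α i v.proj v.2 • s i x) :=
        SmoothSec.sum fun i _ => SmoothSec.smul contMDiff_const (hs i)
      obtain ⟨w, hw1, hw2⟩ := exists_tangent_along hsv hmem (X v.proj)
      refine ⟨ψ v.proj • w, by rw [map_smul, hw1], fun β hβ => ?_⟩
      have h1 : (fun y => β y (∑ i, α i v.proj v.2 • s i y))
          = fun y => ∑ i, α i v.proj v.2 * β y (s i y) := by
        funext y
        simp [map_sum]
      rw [map_smul, hw2 β hβ, h1, dFun_sum_const_mul (fun i => SmoothSec.pairing hβ (hs i)),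
        smul_eq_mul, Finset.mul_sum]
      exact Finset.sum_congr rfl fun i _ => by simp only [fibLin]; ring
  choose W hW1 hW2 using hex
  have hX' : SmoothField I (fun x => ψ x • X x) :=
    SmoothSec.smul (V := fun x : M => TangentSpace I x) hψ hX
  have hd : ∀ (f : M → ℝ), ContMDiff I 𝓘(ℝ, ℝ) ∞ f → ∀ {Y : ∀ x : M, TangentSpace I x},
      SmoothField I Y → ContMDiff I 𝓘(ℝ, ℝ) ∞ (fun x => dFun I f x (Y x)) := fun f hf Y hY =>
    SmoothSec.pairing (V := fun x : M => TangentSpace I x) (dFun_smooth hf) hY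
  refine ⟨_, W, hX', ?_, ?_, hW1, fun r v => ?_⟩
  · filter_upwards [hψ1] with y hy
    rw [hy, one_smul]
  · refine smoothField_totalSpace (fun f hf => ?_) fun β hβ => ?_
    · simp only [hW1]
      exact (hd f hf hX').comp (contMDiff_proj A)
    · simp only [hW2 _ β hβ]
      refine contMDiff_finsetSum fun i _ => ContMDiff.mul ?_ (fibLin_smooth (hα i))
      exact (hψ.mul (hd _ (SmoothSec.pairing hβ (hs i)) hX)).comp (contMDiff_proj A)
  · refine tangent_ext_fibLin ?_ fun β hβ => ?_
    · rw [tproj_mfderiv_fibreMul, hW1, hW1]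
    · rw [dFun_fibLin_mfderiv_fibreMul hβ, hW2 _ β hβ, hW2 _ β hβ, Finset.mul_sum]
      refine Finset.sum_congr rfl fun i _ => ?_
      simp [fibLin]
      ring

end Geometry

/-! ### Linear sections and their Courant–Dorfman brackets with core sections. -/

section LinearSections

variable {E : Type*} [NormedAddCommGroup E] [NormedSpace ℝ E] [FiniteDimensional ℝ E]
  {H : Type*} [TopologicalSpace H] {I : ModelWithCorners ℝ E H}
  {M : Type*} [TopologicalSpace M] [ChartedSpace H M] [IsManifold I ∞ M] [T2Space M]
  {F : Type*} [NormedAddCommGroup F] [NormedSpace ℝ F] [FiniteDimensional ℝ F]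
  {A : M → Type*} [TopologicalSpace (TotalSpace F A)]
  [∀ x, AddCommGroup (A x)] [∀ x, Module ℝ (A x)] [∀ x, TopologicalSpace (A x)]
  [FiberBundle F A] [VectorBundle ℝ F A] [ContMDiffVectorBundle ∞ F A I]
  [I.Boundaryless]

omit [T2Space M] in
theorem lieDerivForm_apply {X Y : ∀ x : M, TangentSpace I x} {θ : ∀ x : M, Cotangent I x}
    (hX : SmoothField I X) (hθ : SmoothForm I θ) (hY : SmoothField I Y) (x : M) :
    lieDerivForm I X θ x (Y x)
      = dFun I (fun y => θ y (Y y)) x (X x) - θ x (VectorField.mlieBracket I X Y x) := by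
  rw [lieDerivForm, add_apply, extDeriv₁_eq hθ hX hY]
  ring

omit [T2Space M] in
theorem smooth_dFun_apply {f : M → ℝ} (hf : ContMDiff I 𝓘(ℝ, ℝ) ∞ f)
    {X : ∀ x : M, TangentSpace I x} (hX : SmoothField I X) :
    ContMDiff I 𝓘(ℝ, ℝ) ∞ (fun x => dFun I f x (X x)) :=
  SmoothSec.pairing (V := fun x : M => TangentSpace I x) (dFun_smooth hf) hX

theorem SmoothField.zero : SmoothField I (fun x : M => (0 : TangentSpace I x)) :=
  SmoothSec.zero (V := fun x : M => TangentSpace I x)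

section Projectable

variable {W₁ W₂ : ∀ v : TotalSpace F A, TangentSpace (I.prod 𝓘(ℝ, F)) v}
  {X₁ X₂ : ∀ x : M, TangentSpace I x}
  (hW₁ : SmoothField (I.prod 𝓘(ℝ, F)) W₁) (hW₂ : SmoothField (I.prod 𝓘(ℝ, F)) W₂)
  (hX₁ : SmoothField I X₁) (hX₂ : SmoothField I X₂)
  (h₁ : ∀ v, tproj I v (W₁ v) = X₁ v.proj) (h₂ : ∀ v, tproj I v (W₂ v) = X₂ v.proj)
include hW₁ hW₂ hX₁ hX₂ h₁ h₂

/-- Tested on functions pulled back from `M`, on which both brackets are commutators of derivations.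
-/
theorem tproj_mlieBracket (v : TotalSpace F A) :
    tproj I v (VectorField.mlieBracket (I.prod 𝓘(ℝ, F)) W₁ W₂ v)
      = VectorField.mlieBracket I X₁ X₂ v.proj := by
  refine tangent_ext fun f hf => ?_
  have key : ∀ {W : ∀ v : TotalSpace F A, TangentSpace (I.prod 𝓘(ℝ, F)) v}
      {X : ∀ x : M, TangentSpace I x}, (∀ v, tproj I v (W v) = X v.proj) →
      (fun v : TotalSpace F A => dFun (I.prod 𝓘(ℝ, F)) (fun u : TotalSpace F A => f u.proj) v (W v))
        = fun v => (fun x => dFun I f x (X x)) v.proj := fun h => by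
    funext v
    rw [dFun_comp_proj hf, h]
  rw [← dFun_comp_proj hf, dFun_mlieBracket (f := fun u : TotalSpace F A => f u.proj)
    (hf.comp (contMDiff_proj A)) hW₁ hW₂, key h₁, key h₂, dFun_comp_proj (smooth_dFun_apply hf hX₁),
    dFun_comp_proj (smooth_dFun_apply hf hX₂), h₁, h₂, dFun_mlieBracket hf hX₁ hX₂]

/-- Naturality of `d`, read off from Cartan's formula on projectable fields. -/
theorem extDeriv₁_pullForm {θ : ∀ x : M, Cotangent I x} (hθ : SmoothForm I θ)
    (v : TotalSpace F A) :
    extDeriv₁ (I.prod 𝓘(ℝ, F)) (pullForm F A θ) v (W₁ v) (W₂ v)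
      = extDeriv₁ I θ v.proj (X₁ v.proj) (X₂ v.proj) := by
  have hs : ∀ {X : ∀ x : M, TangentSpace I x}, SmoothField I X →
      ContMDiff I 𝓘(ℝ, ℝ) ∞ (fun x => θ x (X x)) := fun hX =>
    SmoothSec.pairing (V := fun x : M => TangentSpace I x) hθ hX
  have key : ∀ {W : ∀ v : TotalSpace F A, TangentSpace (I.prod 𝓘(ℝ, F)) v}
      {X : ∀ x : M, TangentSpace I x}, (∀ v, tproj I v (W v) = X v.proj) →
      (fun v : TotalSpace F A => pullForm F A θ v (W v))
        = fun v => (fun x => θ x (X x)) v.proj := fun h => by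
    funext v
    exact congrArg (θ v.proj) (h v)
  have hb : pullForm F A θ v (VectorField.mlieBracket (I.prod 𝓘(ℝ, F)) W₁ W₂ v)
      = θ v.proj (VectorField.mlieBracket I X₁ X₂ v.proj) :=
    congrArg (θ v.proj) (tproj_mlieBracket hW₁ hW₂ hX₁ hX₂ h₁ h₂ v)
  rw [extDeriv₁_eq (pullForm_smooth hθ) hW₁ hW₂, extDeriv₁_eq hθ hX₁ hX₂, key h₁, key h₂,
    dFun_comp_proj (hs hX₁), dFun_comp_proj (hs hX₂), h₁, h₂, hb]

end Projectable

/-- `W` is a linear vector field on `A` over the vector field `X` on `M`. -/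
structure IsLinearField (W : ∀ v : TotalSpace F A, TangentSpace (I.prod 𝓘(ℝ, F)) v)
    (X : ∀ x : M, TangentSpace I x) : Prop where
  smooth : SmoothField (I.prod 𝓘(ℝ, F)) W
  base_smooth : SmoothField I X
  proj : ∀ v, tproj I v (W v) = X v.proj
  scaled : ∀ r v, mfderiv (I.prod 𝓘(ℝ, F)) (I.prod 𝓘(ℝ, F)) (fibreMul F r) v (W v)
    = W (fibreMul F r v)

/-- `ζ` is a linear section of `𝕋A → A` over the section `ν` of `TM ⊕ A*`. -/
structure IsLinearSection (ζ : ∀ v : TotalSpace F A, GTangent (I.prod 𝓘(ℝ, F)) v)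
    (ν : ∀ x : M, Side I A x) : Prop where
  field : IsLinearField (fun v => (ζ v).1) (fun x => (ν x).1)
  form_smooth : SmoothForm (I.prod 𝓘(ℝ, F)) (fun v => (ζ v).2)
  base_smooth : SmoothSec I (F →L[ℝ] ℝ) (fun x => (ν x).2)
  form_vert : ∀ v e, (ζ v).2 (vert I v e) = (ν v.proj).2 e
  form_scaled : ∀ r v w, (ζ (fibreMul F r v)).2
    (mfderiv (I.prod 𝓘(ℝ, F)) (I.prod 𝓘(ℝ, F)) (fibreMul F r) v w) = r * (ζ v).2 w

/-- On the line `t ↦ t e` a homogeneous function is `t h(e)`. Thus a derivative at the zero section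
equals a value at `e`, which is how brackets along the zero section come to involve the values of
linear objects along `a`. -/
theorem dFun_vert_of_homogeneous {h : TotalSpace F A → ℝ}
    (hs : ContMDiff (I.prod 𝓘(ℝ, F)) 𝓘(ℝ, ℝ) ∞ h) (hh : ∀ r v, h (fibreMul F r v) = r * h v)
    (x : M) (e : A x) :
    dFun (I.prod 𝓘(ℝ, F)) h (TotalSpace.mk' F x 0) (vert I (TotalSpace.mk' F x 0) e)
      = h (TotalSpace.mk' F x e) := by
  refine dFun_vert_of_affine (c := 0) hs fun t => ?_
  refine Eq.trans ?_ ((hh t (TotalSpace.mk' F x e)).trans (zero_add _).symm)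
  exact congrArg h (congrArg (TotalSpace.mk' F x) (zero_add _))

theorem dFun_comp_proj_vert {f : M → ℝ} (hf : ContMDiff I 𝓘(ℝ, ℝ) ∞ f) (v : TotalSpace F A)
    (e : A v.proj) :
    dFun (I.prod 𝓘(ℝ, F)) (fun u : TotalSpace F A => f u.proj) v (vert I v e) = 0 := by
  rw [dFun_comp_proj hf, tproj_vert, map_zero]

theorem IsLinearField.dFun_fibLin_homogeneous
    {W : ∀ v : TotalSpace F A, TangentSpace (I.prod 𝓘(ℝ, F)) v} {X : ∀ x : M, TangentSpace I x}
    (hW : IsLinearField W X) {β : ∀ x : M, A x →L[ℝ] ℝ} (hβ : SmoothSec I (F →L[ℝ] ℝ) β) (r : ℝ)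
    (v : TotalSpace F A) :
    dFun (I.prod 𝓘(ℝ, F)) (fibLin F β) (fibreMul F r v) (W (fibreMul F r v))
      = r * dFun (I.prod 𝓘(ℝ, F)) (fibLin F β) v (W v) := by
  rw [← hW.scaled, dFun_fibLin_mfderiv_fibreMul hβ]

theorem dFun_fibLin_vertProj {a : ∀ x : M, A x} (ha : SmoothSec I F a)
    {β : ∀ x : M, A x →L[ℝ] ℝ} (hβ : SmoothSec I (F →L[ℝ] ℝ) β) (x : M)
    (w : TangentSpace (I.prod 𝓘(ℝ, F)) (TotalSpace.mk' F x (a x))) :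
    β x (vertProj I F a x w) = dFun (I.prod 𝓘(ℝ, F)) (fibLin F β) (TotalSpace.mk' F x (a x)) w
      - dFun I (fun y => β y (a y)) x (tproj I (TotalSpace.mk' F x (a x)) w) := by
  have h1 := congrArg (dFun (I.prod 𝓘(ℝ, F)) (fibLin F β) (TotalSpace.mk' F x (a x)))
    (tangent_decomp ha x w)
  rw [map_add, dFun_secTangent (fibLin_smooth hβ) ha, dFun_fibLin_vert hβ] at h1
  rw [h1]
  exact (add_sub_cancel_left _ _).symm

theorem smooth_fibLin_section {a : ∀ x : M, A x} (ha : SmoothSec I F a)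
    {β : ∀ x : M, A x →L[ℝ] ℝ} (hβ : SmoothSec I (F →L[ℝ] ℝ) β) :
    ContMDiff I 𝓘(ℝ, ℝ) ∞ (fun x => β x (a x)) := SmoothSec.pairing hβ ha

variable {a : ∀ x : M, A x} (ha : SmoothSec I F a)
include ha

theorem dFun_fibLin_vertLift {β : ∀ x : M, A x →L[ℝ] ℝ} (hβ : SmoothSec I (F →L[ℝ] ℝ) β) :
    (fun v : TotalSpace F A => dFun (I.prod 𝓘(ℝ, F)) (fibLin F β) v (vert I v (a v.proj)))
      = fun v => (fun x => β x (a x)) v.proj :=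
  funext fun v => dFun_fibLin_vert hβ v (a v.proj)

/-- A vertical lift turns a fibrewise linear function into a basic one, which the other vertical
lift annihilates. -/
theorem mlieBracket_vertLift {b : ∀ x : M, A x} (hb : SmoothSec I F b) (v : TotalSpace F A) :
    VectorField.mlieBracket (I.prod 𝓘(ℝ, F)) (fun v : TotalSpace F A => vert I v (a v.proj))
      (fun v => vert I v (b v.proj)) v = 0 := by
  refine tangent_ext_fibLin ?_ fun β hβ => ?_
  · rw [tproj_mlieBracket (vertLift_smooth ha) (vertLift_smooth hb) SmoothField.zero
      SmoothField.zero (fun v => tproj_vert v _) (fun v => tproj_vert v _), map_zero]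
    exact congrFun VectorField.mlieBracket_zero_left v.proj
  · rw [dFun_mlieBracket (fibLin_smooth hβ) (vertLift_smooth ha) (vertLift_smooth hb),
      dFun_fibLin_vertLift ha hβ, dFun_fibLin_vertLift hb hβ,
      dFun_comp_proj_vert (smooth_fibLin_section ha hβ),
      dFun_comp_proj_vert (smooth_fibLin_section hb hβ), map_zero, sub_zero]

/-- On `ℓ_β` the bracket gives `a↑(W ℓ_β) - X(β(a))`. Since `W ℓ_β` is homogeneous, the first term
at `0_x` is its value at `a(x)`, and the difference is `β` of the vertical part of `W` along `a`. -/
theorem IsLinearField.mlieBracket_vertLift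
    {W : ∀ v : TotalSpace F A, TangentSpace (I.prod 𝓘(ℝ, F)) v} {X : ∀ x : M, TangentSpace I x}
    (hW : IsLinearField W X) (x : M) :
    VectorField.mlieBracket (I.prod 𝓘(ℝ, F)) (fun v : TotalSpace F A => vert I v (a v.proj)) W
        (TotalSpace.mk' F x 0)
      = vert I (TotalSpace.mk' F x 0) (vertProj I F a x (W (TotalSpace.mk' F x (a x)))) := by
  refine tangent_ext_fibLin ?_ fun β hβ => ?_
  · rw [tproj_mlieBracket (vertLift_smooth ha) hW.smooth SmoothField.zero
      hW.base_smooth (fun v => tproj_vert v _) hW.proj]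
    refine Eq.trans ?_ (tproj_vert (TotalSpace.mk' F x 0) _).symm
    exact congrFun VectorField.mlieBracket_zero_left x
  · have h1 := dFun_fibLin_vert hβ (TotalSpace.mk' F x 0)
      (vertProj I F a x (W (TotalSpace.mk' F x (a x))))
    rw [dFun_mlieBracket (fibLin_smooth hβ) (vertLift_smooth ha) hW.smooth,
      dFun_fibLin_vertLift ha hβ, dFun_comp_proj (smooth_fibLin_section ha hβ), hW.proj]
    refine Eq.trans ?_ h1.symm
    refine Eq.trans ?_ (dFun_fibLin_vertProj ha hβ x _).symm
    rw [hW.proj]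
    refine congrArg (· - _) ?_
    exact dFun_vert_of_homogeneous (smooth_dFun_apply (fibLin_smooth hβ) hW.smooth)
      (hW.dFun_fibLin_homogeneous hβ) x (a x)

/-- The Courant–Dorfman bracket of a core section and a linear section, along the zero section. -/
theorem IsLinearSection.courantDorfman_coreLift
    {ζ : ∀ v : TotalSpace F A, GTangent (I.prod 𝓘(ℝ, F)) v} {ν : ∀ x : M, Side I A x}
    (hζ : IsLinearSection ζ ν) {θ : ∀ x : M, Cotangent I x} (hθ : SmoothForm I θ) (x : M) :
    courantDorfman (I.prod 𝓘(ℝ, F)) (fun v => coreLift I v (a v.proj, θ v.proj)) ζ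
        (TotalSpace.mk' F x 0)
      = coreLift I (TotalSpace.mk' F x 0) (corePart I F a x (ζ (TotalSpace.mk' F x (a x)))
          - (0, extDeriv₁ I θ x (ν x).1)) := by
  have hpair : ∀ {Z : ∀ v : TotalSpace F A, TangentSpace (I.prod 𝓘(ℝ, F)) v},
      SmoothField (I.prod 𝓘(ℝ, F)) Z →
      ContMDiff (I.prod 𝓘(ℝ, F)) 𝓘(ℝ, ℝ) ∞ (fun v => (ζ v).2 (Z v)) := fun hZ =>
    SmoothSec.pairing (V := fun v : TotalSpace F A => TangentSpace (I.prod 𝓘(ℝ, F)) v)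
      hζ.form_smooth hZ
  refine Prod.ext ?_ (ContinuousLinearMap.ext fun w => ?_)
  · refine (hζ.field.mlieBracket_vertLift ha x).trans ?_
    exact congrArg (vert I _) (sub_zero _).symm
  · obtain ⟨Y, hY, hYx⟩ := exists_smoothSec_eq (I := I) (F := E)
      (V := fun x : M => TangentSpace I x) (tproj I (TotalSpace.mk' F x 0) w)
    obtain ⟨Y', Z, hY', hYY', hZ, hZY, hZs⟩ := exists_linearLift (F := F) (A := A) hY x
    have hZlin : IsLinearField Z Y' := ⟨hZ, hY', hZY, hZs⟩
    have hY'x : Y' x = tproj I (TotalSpace.mk' F x 0) w := hYY'.self_of_nhds.trans hYx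
    -- The covector is tested separately on the value of a linear lift and on a vertical vector.
    obtain ⟨e, he⟩ : ∃ e : A x, w = Z (TotalSpace.mk' F x 0) + vert I (TotalSpace.mk' F x 0) e := by
      refine ⟨fibrePart I (TotalSpace.mk' F x 0) (w - Z (TotalSpace.mk' F x 0)), ?_⟩
      rw [vert_fibrePart (by rw [map_sub, hZY, sub_eq_zero]; exact hY'x.symm)]
      abel
    obtain ⟨b, hb, rfl⟩ := exists_smoothSec_eq (I := I) (F := F) e
    have hform : ∀ {Z' : ∀ v : TotalSpace F A, TangentSpace (I.prod 𝓘(ℝ, F)) v}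
        {X' : ∀ x : M, TangentSpace I x}, SmoothField (I.prod 𝓘(ℝ, F)) Z' → SmoothField I X' →
        (∀ v, tproj I v (Z' v) = X' v.proj) →
        (courantDorfman (I.prod 𝓘(ℝ, F)) (fun v => coreLift I v (a v.proj, θ v.proj)) ζ
          (TotalSpace.mk' F x 0)).2 (Z' (TotalSpace.mk' F x 0))
        = dFun (I.prod 𝓘(ℝ, F)) (fun v => (ζ v).2 (Z' v)) (TotalSpace.mk' F x 0)
            (vert I (TotalSpace.mk' F x 0) (a x))
          - (ζ (TotalSpace.mk' F x 0)).2 (VectorField.mlieBracket (I.prod 𝓘(ℝ, F))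
            (fun v : TotalSpace F A => vert I v (a v.proj)) Z' (TotalSpace.mk' F x 0))
          - extDeriv₁ I θ x (ν x).1 (X' x) := by
      intro Z' X' hZ' hX' hp
      have h1 := lieDerivForm_apply (vertLift_smooth ha) hζ.form_smooth hZ' (TotalSpace.mk' F x 0)
      have h2 := extDeriv₁_pullForm hζ.field.smooth hZ' hζ.field.base_smooth hX' hζ.field.proj hp
        hθ (TotalSpace.mk' F x 0)
      exact congrArg₂ (· - ·) h1 h2
    -- On vertical lifts every term vanishes: they commute with `a↑`, `ζ` takes basic values on
    -- them, and they project to zero.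
    have hv : (courantDorfman (I.prod 𝓘(ℝ, F)) (fun v => coreLift I v (a v.proj, θ v.proj)) ζ
        (TotalSpace.mk' F x 0)).2 (vert I (TotalSpace.mk' F x 0) (b x)) = 0 := by
      have h1 := hform (vertLift_smooth hb) SmoothField.zero (fun v => tproj_vert v _)
      rw [mlieBracket_vertLift ha hb, map_zero, map_zero] at h1
      refine h1.trans ?_
      have h2 : (fun v : TotalSpace F A => (ζ v).2 (vert I v (b v.proj)))
          = fun v => (fun x => (ν x).2 (b x)) v.proj := funext fun v => hζ.form_vert v _
      rw [h2, dFun_comp_proj_vert (smooth_fibLin_section hb hζ.base_smooth), sub_zero, sub_zero]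
    have hZ0 : (courantDorfman (I.prod 𝓘(ℝ, F)) (fun v => coreLift I v (a v.proj, θ v.proj)) ζ
        (TotalSpace.mk' F x 0)).2 (Z (TotalSpace.mk' F x 0))
        = (ζ (TotalSpace.mk' F x (a x))).2 (secTangent I F a x (Y' x))
          - extDeriv₁ I θ x (ν x).1 (Y' x) := by
      rw [hform hZ hY' hZY, hZlin.mlieBracket_vertLift ha x]
      refine congrArg (· - _) ?_
      -- Homogeneity moves the evaluation from `0_x` to `a(x)`. The bracket term then removes the
      -- vertical part of `Z`, leaving `ζ` on the part of `Z` tangent to `a`.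
      have h1 : dFun (I.prod 𝓘(ℝ, F)) (fun v => (ζ v).2 (Z v)) (TotalSpace.mk' F x 0)
          (vert I (TotalSpace.mk' F x 0) (a x))
          = (ζ (TotalSpace.mk' F x (a x))).2 (Z (TotalSpace.mk' F x (a x))) :=
        dFun_vert_of_homogeneous (hpair hZ) (fun r v => by rw [← hZs, hζ.form_scaled]) x (a x)
      have h2 := congrArg (ζ (TotalSpace.mk' F x (a x))).2
        (tangent_decomp ha x (Z (TotalSpace.mk' F x (a x))))
      rw [map_add, hζ.form_vert, hZY] at h2
      rw [h1, hζ.form_vert, vertProj_apply, hZY, h2]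
      exact add_sub_cancel_right _ _
    rw [he, map_add, hv, hZ0, map_add, add_zero]
    have h3 : (coreLift I (TotalSpace.mk' F x 0) (corePart I F a x (ζ (TotalSpace.mk' F x (a x)))
          - (0, extDeriv₁ I θ x (ν x).1))).2 (vert I (TotalSpace.mk' F x 0) (b x)) = 0 :=
      (liesOver_coreLift (v := TotalSpace.mk' F x 0) _).2 (b x)
    rw [h3, add_zero]
    have h4 := hZY (TotalSpace.mk' F x 0)
    exact congrArg (fun X => (ζ (TotalSpace.mk' F x (a x))).2 (secTangent I F a x X)
          - extDeriv₁ I θ x (ν x).1 X) h4.symm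

end LinearSections

/-! ### The core component of `J σ(a)`. -/

section CrossTerm

variable {E : Type*} [NormedAddCommGroup E] [NormedSpace ℝ E] [FiniteDimensional ℝ E]
  {H : Type*} [TopologicalSpace H] {I : ModelWithCorners ℝ E H}
  {M : Type*} [TopologicalSpace M] [ChartedSpace H M] [IsManifold I ∞ M] [T2Space M]
  {F : Type*} [NormedAddCommGroup F] [NormedSpace ℝ F] [FiniteDimensional ℝ F]
  {A : M → Type*} [TopologicalSpace (TotalSpace F A)]
  [∀ x, AddCommGroup (A x)] [∀ x, Module ℝ (A x)] [∀ x, TopologicalSpace (A x)]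
  [FiberBundle F A] [VectorBundle ℝ F A] [ContMDiffVectorBundle ∞ F A I]
  [I.Boundaryless]
  {J : ∀ v : TotalSpace F A, GTangent (I.prod 𝓘(ℝ, F)) v →L[ℝ] GTangent (I.prod 𝓘(ℝ, F)) v}
  {j : ∀ x : M, Side I A x →L[ℝ] Side I A x} {jC : ∀ x : M, Core I A x →L[ℝ] Core I A x}

theorem SmoothCore.congr_of_eventually {τ : ∀ x : M, Core I A x}
    (h : ∀ x₀, ∃ υ : ∀ x : M, Core I A x, SmoothCore I F υ ∧ ∀ᶠ x in 𝓝 x₀, τ x = υ x) :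
    SmoothCore I F τ := by
  refine ⟨SmoothSec.congr_of_eventually fun x₀ => ?_,
    SmoothSec.congr_of_eventually (V := fun x : M => TangentSpace I x →L[ℝ] ℝ) fun x₀ => ?_⟩
  · obtain ⟨υ, hυ, h⟩ := h x₀
    exact ⟨_, hυ.1, h.mono fun x hx => congrArg Prod.fst hx⟩
  · obtain ⟨υ, hυ, h⟩ := h x₀
    exact ⟨_, hυ.2, h.mono fun x hx => congrArg Prod.snd hx⟩

theorem SmoothCore.sub {τ υ : ∀ x : M, Core I A x} (hτ : SmoothCore I F τ)
    (hυ : SmoothCore I F υ) : SmoothCore I F (τ - υ) := by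
  rw [sub_eq_add_neg]
  exact hτ.add hυ.neg

theorem IsLinearSection.liesOver {ζ : ∀ v : TotalSpace F A, GTangent (I.prod 𝓘(ℝ, F)) v}
    {ν : ∀ x : M, Side I A x} (hζ : IsLinearSection ζ ν) (v : TotalSpace F A) :
    LiesOver v (ζ v) (ν v.proj) := ⟨hζ.field.proj v, hζ.form_vert v⟩

/-- Over `(X, α)` the vector part is a linear lift of `X` and the covector part is `d ℓ_α`; only the
lift of `X` is local. -/
theorem exists_linearSection {ν : ∀ x : M, Side I A x} (hν : SmoothSide F ν) (x₀ : M) :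
    ∃ (ζ : ∀ v : TotalSpace F A, GTangent (I.prod 𝓘(ℝ, F)) v) (ν' : ∀ x : M, Side I A x),
      IsLinearSection ζ ν' ∧ ∀ᶠ x in 𝓝 x₀, ν' x = ν x := by
  obtain ⟨X, W, hX, hXν, hW, hWX, hWs⟩ := exists_linearLift (F := F) (A := A) hν.1 x₀
  refine ⟨fun v => (W v, dFun (I.prod 𝓘(ℝ, F)) (fibLin F fun x => (ν x).2) v),
    fun x => (X x, (ν x).2), ⟨⟨hW, hX, hWX, hWs⟩, dFun_smooth (fibLin_smooth hν.2), hν.2,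
    fun v e => dFun_fibLin_vert hν.2 v e, fun r v w => dFun_fibLin_mfderiv_fibreMul hν.2 r v w⟩, ?_⟩
  filter_upwards [hXν] with x hx
  exact Prod.ext hx rfl

section Smoothness

variable {a : ∀ x : M, A x} (ha : SmoothSec I F a)
include ha

theorem IsLinearField.vertProj_smooth
    {W : ∀ v : TotalSpace F A, TangentSpace (I.prod 𝓘(ℝ, F)) v} {X : ∀ x : M, TangentSpace I x}
    (hW : IsLinearField W X) :
    SmoothSec I F (fun x => vertProj I F a x (W (TotalSpace.mk' F x (a x)))) := by
  refine smoothSec_of_dual fun β hβ => ?_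
  have h1 := (smooth_dFun_apply (fibLin_smooth hβ) hW.smooth).comp ha
  have h2 := smooth_dFun_apply (smooth_fibLin_section ha hβ) hW.base_smooth
  refine (h1.sub h2).congr fun x => (dFun_fibLin_vertProj ha hβ x _).trans ?_
  rw [hW.proj]
  rfl

/-- The covector part is tested on a linear lift `Z` of `Y`: along `a`, its value on `Ta Y` is
`ζ(Z)` minus the value of `ζ` on the vertical part of `Z`, and both are smooth. -/
theorem IsLinearSection.corePart_smooth {ζ : ∀ v : TotalSpace F A, GTangent (I.prod 𝓘(ℝ, F)) v}
    {ν : ∀ x : M, Side I A x} (hζ : IsLinearSection ζ ν) :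
    SmoothCore I F (fun x => corePart I F a x (ζ (TotalSpace.mk' F x (a x)))) := by
  refine ⟨hζ.field.vertProj_smooth ha,
    smoothSec_dual_of_pairing (V := fun x : M => TangentSpace I x) fun Y hY x₀ => ?_⟩
  obtain ⟨Y', Z, hY', hYY', hZ, hZY, hZs⟩ := exists_linearLift (F := F) (A := A) hY x₀
  have h1 : ContMDiff I 𝓘(ℝ, ℝ) ∞ (fun x => (ζ (TotalSpace.mk' F x (a x))).2
      (Z (TotalSpace.mk' F x (a x)))) :=
    (SmoothSec.pairing (V := fun v : TotalSpace F A => TangentSpace (I.prod 𝓘(ℝ, F)) v)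
      hζ.form_smooth hZ).comp ha
  have h2 := smooth_fibLin_section (IsLinearField.vertProj_smooth ha ⟨hZ, hY', hZY, hZs⟩)
    hζ.base_smooth
  refine ((h1.sub h2) x₀).congr_of_eventuallyEq ?_
  filter_upwards [hYY'] with x hx
  have h3 := congrArg (ζ (TotalSpace.mk' F x (a x))).2
    (tangent_decomp ha x (Z (TotalSpace.mk' F x (a x))))
  rw [map_add, hζ.form_vert, ← vertProj_apply, hZY] at h3
  refine Eq.trans ?_ (eq_sub_of_add_eq h3.symm)
  exact congrArg (fun X => (ζ (TotalSpace.mk' F x (a x))).2 (secTangent I F a x X)) hx.symm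

end Smoothness

theorem sigma_smul (a : ∀ x : M, A x) (x : M) (r : ℝ) (ν : Side I A x) :
    sigma I F a x (r • ν) = r • sigma I F a x ν :=
  Prod.ext (map_smul _ _ _) (ContinuousLinearMap.smul_comp _ _ _)

theorem sigma_add (a : ∀ x : M, A x) (x : M) (ν μ : Side I A x) :
    sigma I F a x (ν + μ) = sigma I F a x ν + sigma I F a x μ :=
  Prod.ext (map_add _ _ _) (ContinuousLinearMap.add_comp _ _ _)

variable (J) in
/-- The core component of `J σ(a)`, as a map from `TM ⊕ A*` to `A ⊕ T*M`. -/
def crossTerm (a : ∀ x : M, A x) (x : M) : Side I A x →ₗ[ℝ] Core I A x where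
  toFun ν := corePart I F a x (J _ (sigma I F a x ν))
  map_add' ν μ := by rw [sigma_add, ContinuousLinearMap.map_add, map_add]
  map_smul' r ν := by rw [sigma_smul, ContinuousLinearMap.map_smul, map_smul]; rfl

section Morphism

variable (hlin : IsLinearOver J j)
include hlin

theorem IsLinearOver.apply_sigma {a : ∀ x : M, A x} (ha : SmoothSec I F a) (x : M)
    (ν : Side I A x) : J (TotalSpace.mk' F x (a x)) (sigma I F a x ν)
      = sigma I F a x (j x ν) + coreLift I _ (crossTerm J a x ν) :=
  (hlin.lies_over _ _ _ (liesOver_sigma ha ν)).eq_sigma_add ha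

/-- Homogeneity of a linear section says that its values at `v` and `r v` are related by `IsScaled`,
a relation that `J` preserves. -/
theorem IsLinearSection.map (hJ : IsGeneralisedComplex (I.prod 𝓘(ℝ, F)) J)
    {ζ : ∀ v : TotalSpace F A, GTangent (I.prod 𝓘(ℝ, F)) v}
    {ν : ∀ x : M, Side I A x} (hζ : IsLinearSection ζ ν) :
    IsLinearSection (fun v => J v (ζ v)) (fun x => j x (ν x)) := by
  have hs := hJ.smooth.comp ((smoothSec_prod
    (V₁ := fun v : TotalSpace F A => TangentSpace (I.prod 𝓘(ℝ, F)) v)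
    (V₂ := fun v : TotalSpace F A => TangentSpace (I.prod 𝓘(ℝ, F)) v →L[ℝ] ℝ) (s := ζ)).2
    ⟨hζ.field.smooth, hζ.form_smooth⟩)
  have hs' := (smoothSec_prod
    (V₁ := fun v : TotalSpace F A => TangentSpace (I.prod 𝓘(ℝ, F)) v)
    (V₂ := fun v : TotalSpace F A => TangentSpace (I.prod 𝓘(ℝ, F)) v →L[ℝ] ℝ)
    (s := fun v => J v (ζ v))).1 hs
  have hside := hlin.smoothSide (ν := ν) ⟨hζ.field.base_smooth, hζ.base_smooth⟩
  have hover := fun v => hlin.lies_over v _ _ (hζ.liesOver v)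
  have hscal : ∀ r (v : TotalSpace F A), IsScaled r v.proj v.2 (J v (ζ v))
      (J (fibreMul F r v) (ζ (fibreMul F r v))) := fun r v =>
    hlin.smul r v.proj v.2 _ _ ⟨hζ.field.scaled r v, hζ.form_scaled r v, fun e =>
      (hζ.form_vert (fibreMul F r v) e).trans (hζ.form_vert v e).symm⟩
  exact ⟨⟨hs'.1, hside.1, fun v => (hover v).1, fun r v => (hscal r v).1⟩, hs'.2, hside.2,
    fun v => (hover v).2, fun r v => (hscal r v).2.1⟩

variable (hsq : ∀ v p, J v (J v p) = -p) (horth : ∀ v p q, gPair (J v p) (J v q) = gPair p q)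
  (hC : IsCoreMorphism J jC)
include hsq horth hC

theorem IsCoreMorphism.corePart_apply {a : ∀ x : M, A x} (ha : SmoothSec I F a) {x : M}
    {p : GTangent (I.prod 𝓘(ℝ, F)) (TotalSpace.mk' F x (a x))} {ν : Side I A x}
    (hp : LiesOver _ p ν) :
    corePart I F a x (J _ p) = crossTerm J a x ν + jC x (corePart I F a x p) := by
  conv_lhs => rw [hp.eq_sigma_add ha, ContinuousLinearMap.map_add, hC.apply_coreLift hlin hsq horth, map_add]
  exact congrArg (_ + ·) (corePart_coreLift ha _)

/-- For a linear section `ζ` over `ν` near `x₀`, the cross term is the core part of `J ζ` minus `jC`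
of the core part of `ζ`. -/
theorem IsCoreMorphism.crossTerm_smooth (hJ : IsGeneralisedComplex (I.prod 𝓘(ℝ, F)) J)
    {a : ∀ x : M, A x} (ha : SmoothSec I F a) {ν : ∀ x : M, Side I A x} (hν : SmoothSide F ν) :
    SmoothCore I F (fun x => crossTerm J a x (ν x)) := by
  refine SmoothCore.congr_of_eventually fun x₀ => ?_
  obtain ⟨ζ, ν', hζ, h⟩ := exists_linearSection hν x₀
  refine ⟨_, ((hζ.map hlin hJ).corePart_smooth ha).sub
    (hC.smoothCore hlin hsq horth (hζ.corePart_smooth ha)), ?_⟩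
  filter_upwards [h] with x hx
  rw [← hx]
  exact (sub_eq_of_eq_add (hC.corePart_apply hlin hsq horth ha
    (hζ.liesOver (TotalSpace.mk' F x (a x))))).symm

end Morphism

end CrossTerm

/-! ### Compatibility of `J` with the brackets of `σ(a)` and core sections. -/

section BracketMorphism

variable {E : Type*} [NormedAddCommGroup E] [NormedSpace ℝ E] [FiniteDimensional ℝ E]
  {H : Type*} [TopologicalSpace H] {I : ModelWithCorners ℝ E H}
  {M : Type*} [TopologicalSpace M] [ChartedSpace H M] [IsManifold I ∞ M] [T2Space M]
  {F : Type*} [NormedAddCommGroup F] [NormedSpace ℝ F] [FiniteDimensional ℝ F]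
  {A : M → Type*} [TopologicalSpace (TotalSpace F A)]
  [∀ x, AddCommGroup (A x)] [∀ x, Module ℝ (A x)] [∀ x, TopologicalSpace (A x)]
  [FiberBundle F A] [VectorBundle ℝ F A] [ContMDiffVectorBundle ∞ F A I]
  [I.Boundaryless]
  {J : ∀ v : TotalSpace F A, GTangent (I.prod 𝓘(ℝ, F)) v →L[ℝ] GTangent (I.prod 𝓘(ℝ, F)) v}
  {j : ∀ x : M, Side I A x →L[ℝ] Side I A x} {jC : ∀ x : M, Core I A x →L[ℝ] Core I A x}
  {L : LieAlgebroid I F A}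

variable (I F A) in
/-- Near every point, `TM ⊕ A*` has a smooth frame with a smooth dual frame in `A ⊕ T*M`. -/
theorem exists_side_frame (x₀ : M) :
    ∃ (n : ℕ) (ν : Fin n → ∀ x : M, Side I A x) (η : Fin n → ∀ x : M, Core I A x),
      (∀ k, SmoothSide F (ν k)) ∧ (∀ k, SmoothCore I F (η k)) ∧
      ∀ᶠ x in 𝓝 x₀, ∀ μ : Side I A x, μ = ∑ k, sidePair μ (η k x) • ν k x := by
  obtain ⟨m, s, α, hs, hα, h1⟩ := exists_smooth_frame I E (fun x : M => TangentSpace I x) x₀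
  obtain ⟨n, b, β, hb, hβ, h2⟩ := exists_smooth_frame I F A x₀
  refine ⟨m + n, Fin.append (fun i x => (s i x, 0)) (fun i x => (0, β i x)),
    Fin.append (fun i x => (0, α i x)) (fun i x => (b i x, 0)), fun k => ?_, fun k => ?_, ?_⟩
  · refine Fin.addCases (fun i => ?_) (fun i => ?_) k
    · rw [Fin.append_left]
      exact ⟨hs i, SmoothSec.zero (V := fun x : M => A x →L[ℝ] ℝ)⟩
    · rw [Fin.append_right]
      exact ⟨SmoothSec.zero (V := fun x : M => TangentSpace I x), hβ i⟩
  · refine Fin.addCases (fun i => ?_) (fun i => ?_) k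
    · rw [Fin.append_left]
      exact ⟨SmoothSec.zero, hα i⟩
    · rw [Fin.append_right]
      exact ⟨hb i, SmoothSec.zero (V := fun x : M => TangentSpace I x →L[ℝ] ℝ)⟩
  · filter_upwards [h1, h2] with x h1 h2 μ
    rw [Fin.sum_univ_add]
    simp only [Fin.append_left, Fin.append_right]
    refine Prod.ext ?_ (ContinuousLinearMap.ext fun e => ?_)
    · rw [Prod.fst_add, Prod.fst_sum, Prod.fst_sum]
      refine (h1 μ.1).trans ?_
      simp [sidePair]
    · rw [Prod.snd_add, Prod.snd_sum, Prod.snd_sum]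
      have h3 := congrArg μ.2 (h2 e)
      simp only [map_sum, map_smul, smul_eq_mul] at h3
      refine h3.trans ?_
      simp [sidePair, mul_comm]

theorem smoothGen_core {τ : ∀ x : M, Core I A x} (hτ : SmoothCore I F τ) :
    SmoothGen F ((0, τ) : Gen I A) := ⟨SmoothSec.zero, hτ⟩

theorem smoothGen_section {a : ∀ x : M, A x} (ha : SmoothSec I F a) :
    SmoothGen F ((a, 0) : Gen I A) := ⟨ha, SmoothCore.zero⟩

/-- The generating section of a pair `(a, τ)`, as a section with one summand. -/
def SideSection.single (g : Gen I A) (hg : SmoothGen F g) : SideSection I F A where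
  n := 1
  coeff _ _ := 1
  gen _ := g
  coeff_smooth _ := contMDiff_const
  gen_smooth _ := hg

theorem SideSection.frozen_single (g : Gen I A) (hg : SmoothGen F g) (ν : SideTot I F A) :
    (SideSection.single g hg).frozen ν = g := by
  change ∑ _i : Fin 1, (1 : ℝ) • g = g
  simp

theorem genLift_zero_injective {κ κ' : ∀ x : M, Core I A x} {ν : SideTot I F A}
    (h : genLift (0, κ) ν = genLift (0, κ') ν) : κ ν.proj = κ' ν.proj := by
  rw [genLift_eq, genLift_eq] at h
  have h1 := eq_of_heq (TotalSpace.mk.inj h).2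
  exact coreLift_injective (I := I) (F := F) (a := 0) SmoothSec.zero (add_left_cancel h1)

theorem genBracket_core {a : ∀ x : M, A x} (ha : SmoothSec I F a) {κ τ : ∀ x : M, Core I A x}
    (hκ : SmoothCore I F κ) : genBracket L (a, κ) (0, τ) = (0, lieDerivCore L a τ) := by
  refine Prod.ext (L.bracket_zero_right ha) ?_
  simp only [genBracket]
  rw [lieDerivCore_zero hκ, sub_zero]

/-- The section `σ(a) + ∑ ℓ_{η_k} υ_k†`. -/
def SideSection.linearCombination {a : ∀ x : M, A x} (ha : SmoothSec I F a) {n : ℕ}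
    {η υ : Fin n → ∀ x : M, Core I A x} (hη : ∀ k, SmoothCore I F (η k))
    (hυ : ∀ k, SmoothCore I F (υ k)) : SideSection I F A where
  n := n + 1
  coeff := Fin.cons (fun _ => 1) fun k => linFun (η k)
  gen := Fin.cons (a, 0) fun k => (0, υ k)
  coeff_smooth := Fin.cases contMDiff_const fun k => linFun_smooth (hη k)
  gen_smooth := Fin.cases ⟨ha, SmoothCore.zero⟩ fun k => ⟨SmoothSec.zero, hυ k⟩

section LinearCombination

variable {a : ∀ x : M, A x} (ha : SmoothSec I F a) {n : ℕ}
  {η υ : Fin n → ∀ x : M, Core I A x} (hη : ∀ k, SmoothCore I F (η k))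
  (hυ : ∀ k, SmoothCore I F (υ k))

theorem SideSection.frozen_linearCombination (ν : SideTot I F A) :
    (SideSection.linearCombination ha hη hυ).frozen ν
      = (a, ∑ k, linFun (η k) ν • υ k) := by
  have h : (SideSection.linearCombination ha hη hυ).frozen ν
      = (1 : ℝ) • ((a, 0) : Gen I A) + ∑ k, linFun (η k) ν • ((0, υ k) : Gen I A) :=
    Fin.sum_univ_succ _
  rw [h]
  refine Prod.ext ?_ ?_
  · simp [Prod.fst_sum]
  · simp [Prod.snd_sum]

theorem SideSection.bracketVal_single {τ : ∀ x : M, Core I A x} (hτ : SmoothCore I F τ)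
    (ν : SideTot I F A) :
    (SideSection.single (a, 0) (smoothGen_section ha)).bracketVal L
      (SideSection.single (0, τ) (smoothGen_core hτ)) ν = genLift (0, lieDerivCore L a τ) ν := by
  rw [SideSection.bracketVal, SideSection.frozen_single, SideSection.frozen_single,
    genBracket_core ha SmoothCore.zero]
  have h : ∀ w : TangentSpace (sideModel E I F) ν,
      dFun (sideModel E I F) (fun _ : SideTot I F A => (1 : ℝ)) ν w = 0 := fun w =>
    congrArg (fun L : Cotangent (sideModel E I F) ν => L w) (dFun_const 1 ν)
  simp [SideSection.single, h]

theorem SmoothCore.const_smul {τ : ∀ x : M, Core I A x} (c : ℝ) (hτ : SmoothCore I F τ) :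
    SmoothCore I F (c • τ) :=
  ⟨SmoothSec.smul contMDiff_const hτ.1,
    SmoothSec.smul (V := fun x : M => TangentSpace I x →L[ℝ] ℝ) contMDiff_const hτ.2⟩

theorem SmoothCore.sum {ι : Type*} {S : Finset ι} {τ : ι → ∀ x : M, Core I A x}
    (hτ : ∀ i, SmoothCore I F (τ i)) : SmoothCore I F (∑ i ∈ S, τ i) := by
  classical
  induction S using Finset.induction_on with
  | empty => exact SmoothCore.zero
  | insert i S hi ih =>
    rw [Finset.sum_insert hi]
    exact (hτ i).add ih

/-- Core sections commute, so the sum contributes only Leibniz terms: the anchor of `τ†`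
differentiates `ℓ_{η_k}` to `⟨τ, η_k⟩_d`. -/
theorem SideSection.bracketVal_linearCombination {τ : ∀ x : M, Core I A x} (hτ : SmoothCore I F τ)
    (ν : SideTot I F A) :
    (SideSection.linearCombination ha hη hυ).bracketVal L
      (SideSection.single (0, τ) (smoothGen_core hτ)) ν
      = genLift (0, lieDerivCore L a τ
          - ∑ k, degPairing L ν.proj (τ ν.proj) (η k ν.proj) • υ k) ν := by
  rw [SideSection.bracketVal, SideSection.frozen_single, SideSection.frozen_linearCombination,
    genBracket_core ha (SmoothCore.sum fun k => (hυ k).const_smul _)]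
  have h : ∀ w : TangentSpace (sideModel E I F) ν,
      dFun (sideModel E I F) (fun _ : SideTot I F A => (1 : ℝ)) ν w = 0 := fun w =>
    congrArg (fun L : Cotangent (sideModel E I F) ν => L w) (dFun_const 1 ν)
  have h1 : ∑ i, dFun (sideModel E I F) ((SideSection.linearCombination ha hη hυ).coeff i) ν
        (genAnchor L (0, τ) ν) • (SideSection.linearCombination ha hη hυ).gen i
      = dFun (sideModel E I F) (fun _ : SideTot I F A => (1 : ℝ)) ν (genAnchor L (0, τ) ν)
          • ((a, 0) : Gen I A)
        + ∑ k, dFun (sideModel E I F) (linFun (η k)) ν (genAnchor L (0, τ) ν)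
          • ((0, υ k) : Gen I A) := Fin.sum_univ_succ _
  rw [h1, h, zero_smul, zero_add]
  simp only [fun k => genAnchor_core (L := L) (τ := τ) (hη k) ν]
  congr 1
  refine Prod.ext ?_ ?_
  · simp [SideSection.single, h, Prod.fst_sum]
  · simp [SideSection.single, h, Prod.snd_sum]

end LinearCombination

variable (hlin : IsLinearOver J j) (hC : IsCoreMorphism J jC)
  (hJ : IsGeneralisedComplex (I.prod 𝓘(ℝ, F)) J) (hmor : IsAlgebroidMorphism L J j)
include hlin hC hJ hmor

/-- The cross term makes `σ(a)` related to `σ(a)` plus core sections with linear coefficients;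
differentiating these coefficients along the anchor of `(jC τ)†` produces the correction. -/
theorem IsCoreMorphism.lieDerivCore_apply {a : ∀ x : M, A x} (ha : SmoothSec I F a)
    {τ : ∀ x : M, Core I A x} (hτ : SmoothCore I F τ) (x : M) :
    lieDerivCore L a (fun y => jC y (τ y)) x
      = jC x (lieDerivCore L a τ x) + crossTerm J a x (coreAnchor L (τ x)) := by
  have hsq := hJ.sq
  have horth : ∀ v p q, gPair (J v p) (J v q) = gPair p q := hJ.orthogonal
  obtain ⟨n, ν, η, hν, hη, hfr⟩ := exists_side_frame I F A x
  have hjη : ∀ k, SmoothCore I F (fun y => jC y (η k y)) := fun k =>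
    hC.smoothCore hlin hsq horth (hη k)
  have hjτ := hC.smoothCore hlin hsq horth hτ
  have hυ : ∀ k, SmoothCore I F (fun y => crossTerm J a y (ν k y)) := fun k =>
    hC.crossTerm_smooth hlin hsq horth hJ ha (hν k)
  let ν₀ : SideTot I F A := ⟨x, 0⟩
  have hc : Filter.Tendsto (fun μ : SideTot I F A => μ.proj) (𝓝 ν₀) (𝓝 x) :=
    (FiberBundle.continuous_proj (E × (F →L[ℝ] ℝ))
      ((fun x : M => TangentSpace I x) ×ᵇ (fun x : M => A x →L[ℝ] ℝ))).continuousAt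
  have hproj := hc.eventually
    (p := fun y => ∀ κ : Side I A y, κ = ∑ k, sidePair κ (η k y) • ν k y) hfr
  -- Expanding the argument of the cross term in the side frame writes `J ∘ σ(a) ∘ j⁻¹` near `j ν₀`
  -- as `σ(a) + ∑ ℓ_{jC η_k} (c_a ν_k)†`.
  have hs : ∀ᶠ μ in 𝓝 ν₀, ttMap J ((SideSection.single (a, 0) (smoothGen_section ha)).val μ)
      = (SideSection.linearCombination ha hjη hυ).val (sideMap F j μ) := by
    filter_upwards [hproj] with μ hμ
    rw [SideSection.val, SideSection.val, SideSection.frozen_single,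
      SideSection.frozen_linearCombination, genLift_eq, genLift_eq]
    refine congrArg (fun p => (⟨TotalSpace.mk' F μ.proj (a μ.proj), p⟩ : TTot I F A)) ?_
    refine (congrArg (J _) (congrArg (sigma I F a μ.proj μ.2 + ·)
      (coreLift_zero (TotalSpace.mk' F μ.proj (a μ.proj))))).trans ?_
    rw [add_zero, hlin.apply_sigma ha]
    refine congrArg (fun c => sigma I F a μ.proj (j μ.proj μ.2)
      + coreLift I (TotalSpace.mk' F μ.proj (a μ.proj)) c) ?_
    conv_lhs => rw [hμ μ.2, map_sum]
    simp only [map_smul, Finset.sum_apply, Pi.smul_apply]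
    refine Finset.sum_congr rfl fun k _ => congrArg (· • _) ?_
    -- The coefficients match since `⟨j μ, jC η⟩ = -⟨j² μ, η⟩ = ⟨μ, η⟩`.
    have h1 := hC.sidePair_eq hlin hsq horth (j μ.proj μ.2) (η k μ.proj)
    rw [hlin.side_sq hsq, sidePair_neg_left, neg_neg] at h1
    exact h1.symm
  have ht : ∀ᶠ μ in 𝓝 ν₀, ttMap J ((SideSection.single (0, τ) (smoothGen_core hτ)).val μ)
      = (SideSection.single (0, fun y => jC y (τ y)) (smoothGen_core hjτ)).val
          (sideMap F j μ) := by
    refine Filter.Eventually.of_forall fun μ => ?_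
    rw [SideSection.val, SideSection.val, SideSection.frozen_single, SideSection.frozen_single]
    exact hC.ttMap_core hlin hsq horth μ
  have hbr := hmor.bracket _ _ _ _ ν₀ hs ht
  rw [SideSection.bracketVal_single ha hτ, SideSection.bracketVal_linearCombination ha hjη hυ hjτ,
    hC.ttMap_core hlin hsq horth] at hbr
  have h2 := genLift_zero_injective hbr
  -- By orthogonality `⟨jC τ, jC η_k⟩_d = ⟨τ, η_k⟩_d`, which are the frame coefficients of `(ρ, ρ^t)
  -- τ`.
  have h3 : crossTerm J a x (coreAnchor L (τ x))
      = ∑ k, degPairing L x (jC x (τ x)) (jC x (η k x)) • crossTerm J a x (ν k x) := by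
    conv_lhs => rw [hfr.self_of_nhds (coreAnchor L (τ x)), map_sum]
    refine Finset.sum_congr rfl fun k _ => ?_
    rw [map_smul, sidePair_coreAnchor, hC.degPairing_eq hlin hsq horth hmor]
  have h4 : jC x (lieDerivCore L a τ x) = lieDerivCore L a (fun y => jC y (τ y)) x
      - crossTerm J a x (coreAnchor L (τ x)) := by
    rw [h3]
    refine h2.trans ?_
    simp only [Pi.sub_apply, Finset.sum_apply, Pi.smul_apply]
    rfl
  rw [h4, sub_add_cancel]

end BracketMorphism

/-! ### Vanishing of the torsion of the core morphism. -/

section Torsion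

variable {E : Type*} [NormedAddCommGroup E] [NormedSpace ℝ E] [FiniteDimensional ℝ E]
  {H : Type*} [TopologicalSpace H] {I : ModelWithCorners ℝ E H}
  {M : Type*} [TopologicalSpace M] [ChartedSpace H M] [IsManifold I ∞ M] [T2Space M]
  {F : Type*} [NormedAddCommGroup F] [NormedSpace ℝ F] [FiniteDimensional ℝ F]
  {A : M → Type*} [TopologicalSpace (TotalSpace F A)]
  [∀ x, AddCommGroup (A x)] [∀ x, Module ℝ (A x)] [∀ x, TopologicalSpace (A x)]
  [FiberBundle F A] [VectorBundle ℝ F A] [ContMDiffVectorBundle ∞ F A I]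
  [I.Boundaryless]
  {J : ∀ v : TotalSpace F A, GTangent (I.prod 𝓘(ℝ, F)) v →L[ℝ] GTangent (I.prod 𝓘(ℝ, F)) v}
  {j : ∀ x : M, Side I A x →L[ℝ] Side I A x} {jC : ∀ x : M, Core I A x →L[ℝ] Core I A x}
  {L : LieAlgebroid I F A}

theorem degBracket_eq (τ υ : ∀ x : M, Core I A x) (x : M) :
    degBracket L τ υ x = lieDerivCore L (fun y => (τ y).1) υ x
      - (0, extDeriv₁ I (fun y => (τ y).2) x (L.anchor x (υ x).1)) :=
  Prod.ext (sub_zero _).symm rfl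

/-- With `f² = -1` the terms `p, p'` cancel in `h` and the terms `l, l'` cancel in the conclusion;
both sides reduce to `-i - c' + k' + f (-i' + c - k)`. -/
theorem torsion_of_cross_terms {V : Type*} [AddCommGroup V] {f : V → V}
    (hadd : ∀ u v, f (u + v) = f u + f v) (hneg : ∀ u, f (-u) = -f u)
    (hf : ∀ v, f (f v) = -v) {p p' c c' i i' k k' l l' m m' : V}
    (h : (p - i) - ((c' + f p') - k') + f ((p' - i') + ((c + f p) - k)) = 0)
    (hm : m = f l + c) (hm' : m' = f l' + c') :
    (l - i) - (m' - k') + f ((l' - i') + (m - k)) = 0 := by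
  subst hm hm'
  simp only [sub_eq_add_neg, hadd, hneg, hf] at h ⊢
  rw [← h]
  abel

variable (hlin : IsLinearOver J j) (hC : IsCoreMorphism J jC)
  (hJ : IsGeneralisedComplex (I.prod 𝓘(ℝ, F)) J) (hmor : IsAlgebroidMorphism L J j)
include hlin hC hJ hmor

/-- Skewness of `jC` for the degenerate pairing, combined with the duality of `jC` and `j`; the core
separates side elements. -/
theorem IsCoreMorphism.coreAnchor_apply {x : M} (τ : Core I A x) :
    coreAnchor L (jC x τ) = j x (coreAnchor L τ) := by
  have hsq := hJ.sq
  have horth : ∀ v p q, gPair (J v p) (J v q) = gPair p q := hJ.orthogonal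
  have h : ∀ υ : Core I A x,
      sidePair (coreAnchor L (jC x τ)) υ = sidePair (j x (coreAnchor L τ)) υ := fun υ => by
    rw [sidePair_coreAnchor, hC.degPairing_left hlin hsq horth hmor, ← sidePair_coreAnchor,
      hC.sidePair_eq hlin hsq horth, neg_neg]
  refine Prod.ext (tangent_ext fun f _ => ?_) (ContinuousLinearMap.ext fun e => ?_)
  · simpa [sidePair] using h (0, dFun I f x)
  · simpa [sidePair] using h (e, 0)

theorem IsCoreMorphism.torsion {τ υ : ∀ x : M, Core I A x} (hτ : SmoothCore I F τ)
    (hυ : SmoothCore I F υ) (x : M) :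
    nijenhuis (degBracket L) (fun x τ => jC x τ) τ υ x = 0 := by
  have hsq := hJ.sq
  have horth : ∀ v p q, gPair (J v p) (J v q) = gPair p q := hJ.orthogonal
  have hjτ := hC.smoothCore hlin hsq horth hτ
  -- The side section has value `(ρ, ρ^t) υ` at `x`, so that `i_X dθ` becomes the term `i_{ρ(b)} dθ`
  -- of the degenerate bracket. Only this value matters.
  obtain ⟨μ, hμ, hμx⟩ := exists_smoothSide_eq (F := F) (coreAnchor L (υ x))
  obtain ⟨ζ, ν, hζ, hν⟩ := exists_linearSection hμ x
  have hνx : ν x = coreAnchor L (υ x) := hν.self_of_nhds.trans hμx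
  have hjν : j x (ν x) = coreAnchor L (jC x (υ x)) := by
    rw [hνx, hC.coreAnchor_apply hlin hJ hmor]
  have hJζ := hζ.map hlin hJ
  have hB : ∀ {κ : ∀ x : M, Core I A x} {ξ : ∀ v : TotalSpace F A, GTangent (I.prod 𝓘(ℝ, F)) v}
      {ν : ∀ x : M, Side I A x}, SmoothCore I F κ → IsLinearSection ξ ν →
      courantDorfman (I.prod 𝓘(ℝ, F)) (fun v => coreLift I v (κ v.proj)) ξ (TotalSpace.mk' F x 0)
      = coreLift I (TotalSpace.mk' F x 0) (corePart I F (fun y => (κ y).1) x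
          (ξ (TotalSpace.mk' F x (κ x).1)) - (0, extDeriv₁ I (fun y => (κ y).2) x (ν x).1)) :=
    fun hκ hξ => hξ.courantDorfman_coreLift hκ.1 hκ.2 x
  have hN := hJ.integrable (fun v => coreLift I v (τ v.proj)) ζ (vertLift_smooth hτ.1)
    (pullForm_smooth hτ.2) hζ.field.smooth hζ.form_smooth (TotalSpace.mk' F x 0)
  have hJτ : (fun v => J v (coreLift I v (τ v.proj)))
      = fun v => coreLift I v (jC v.proj (τ v.proj)) :=
    funext fun v => hC.apply_coreLift hlin hsq horth v _
  rw [nijenhuis, hJτ, hB hτ hζ, hB hjτ hJζ, hB hjτ hζ, hB hτ hJζ, ← coreLift_sub, ← coreLift_add,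
    hC.apply_coreLift hlin hsq horth (TotalSpace.mk' F x 0), ← coreLift_add,
    ← coreLift_zero (TotalSpace.mk' F x 0)] at hN
  have hN' := coreLift_injective (I := I) (F := F) (a := 0) SmoothSec.zero hN
  have hcτ := hC.corePart_apply hlin hsq horth hτ.1 (hζ.liesOver (TotalSpace.mk' F x (τ x).1))
  have hcjτ := hC.corePart_apply hlin hsq horth hjτ.1
    (hζ.liesOver (TotalSpace.mk' F x (jC x (τ x)).1))
  rw [nijenhuis, degBracket_eq, degBracket_eq, degBracket_eq, degBracket_eq]
  refine torsion_of_cross_terms (f := jC x) (jC x).map_add (jC x).map_neg (hC.sq hlin hsq horth x) ?_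
    (hC.lieDerivCore_apply hlin hJ hmor hτ.1 hυ x) (hC.lieDerivCore_apply hlin hJ hmor hjτ.1 hυ x)
    (p := corePart I F (fun y => (τ y).1) x (ζ (TotalSpace.mk' F x (τ x).1)))
    (p' := corePart I F (fun y => (jC y (τ y)).1) x (ζ (TotalSpace.mk' F x (jC x (τ x)).1)))
  -- The core parts of `J ζ` along the `A`-components of `τ` and of `jC τ` are replaced by cross
  -- terms plus `jC` of the core parts of `ζ`.
  erw [hcτ, hcjτ] at hN'
  rw [hjν, hνx] at hN'
  exact hN'

end Torsion

end GenComplex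

end

theorem mainTheorem12
    {E : Type*} [NormedAddCommGroup E] [NormedSpace ℝ E] [FiniteDimensional ℝ E]
    {M : Type*} [TopologicalSpace M] [T2Space M] [SecondCountableTopology M]
    [ChartedSpace E M] [IsManifold 𝓘(ℝ, E) ∞ M]
    {F : Type*} [NormedAddCommGroup F] [NormedSpace ℝ F] [FiniteDimensional ℝ F]
    {A : M → Type*} [TopologicalSpace (TotalSpace F A)]
    [∀ x, AddCommGroup (A x)] [∀ x, Module ℝ (A x)] [∀ x, TopologicalSpace (A x)]
    [FiberBundle F A] [VectorBundle ℝ F A] [ContMDiffVectorBundle ∞ F A 𝓘(ℝ, E)]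
    (L : GenComplex.LieAlgebroid 𝓘(ℝ, E) F A)
    (J : ∀ v : TotalSpace F A, GenComplex.GTangent (𝓘(ℝ, E).prod 𝓘(ℝ, F)) v →L[ℝ]
      GenComplex.GTangent (𝓘(ℝ, E).prod 𝓘(ℝ, F)) v)
    (j : ∀ x : M, GenComplex.Side 𝓘(ℝ, E) A x →L[ℝ] GenComplex.Side 𝓘(ℝ, E) A x)
    (hJ : GenComplex.IsGeneralisedComplexLieAlgebroid L J j) :
    (∃! jC : ∀ x : M, GenComplex.Core 𝓘(ℝ, E) A x →L[ℝ] GenComplex.Core 𝓘(ℝ, E) A x,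
      GenComplex.IsCoreMorphism J jC) ∧
    ∀ jC : ∀ x : M, GenComplex.Core 𝓘(ℝ, E) A x →L[ℝ] GenComplex.Core 𝓘(ℝ, E) A x,
      GenComplex.IsCoreMorphism J jC →
      GenComplex.IsDegenerateGeneralisedComplex L jC := by
  have hlin := hJ.linear
  have hsq := hJ.generalisedComplex.sq
  have horth : ∀ v p q, GenComplex.gPair (J v p) (J v q) = GenComplex.gPair p q :=
    hJ.generalisedComplex.orthogonal
  refine ⟨?_, fun jC hC => ⟨hC.contMDiff hlin hsq horth, hC.sq hlin hsq horth,
    fun x τ υ => hC.degPairing_eq hlin hsq horth hJ.morphism τ υ,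
    fun τ υ hτ hυ x => hC.torsion hlin hJ.generalisedComplex hJ.morphism hτ hυ x⟩⟩
  obtain ⟨jC, hC⟩ := hlin.exists_coreMorphism hsq horth
  exact ⟨jC, hC, fun jC' hC' => hC'.unique hC⟩
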